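/- Let $\Bbbk$ be a field of characteristic $\neq 2$. All (super) vector spaces, algebras and tensor products are over $\Bbbk$; "super" means $\mathbb{Z}/2$-graded. A super Hopf algebra is a Hopf algebra object in the symmetric tensor category of super vector spaces with symmetry $v\otimes w\mapsto(-1)^{|v||w|}w\otimes v$; in particular its coproduct is a graded algebra map into $A\otimes A$ with product $(a\otimes b)(c\otimes d)=(-1)^{|b||c|}ac\otimes bd$. It is called super commutative if even elements are central and $ab=-ba$ for odd $a,b$. For a super commutative Hopf algebra $A=A_0\oplus A_1$ with counit $\varepsilon$, let $\overline{A}=A/(A_1)$ be the quotient by the ideal generated by $A_1$ (the largest purely even quotient, a quotient Hopf algebra of $A$), let $A_0^+=A_0\cap\ker\varepsilon$, and let $W^A=A_1/A_0^+A_1$. The exterior algebra $\wedge(W^A)$ is a super algebra graded by the parity of the exterior degree, with counit the algebra map vanishing on $W^A$. Regard $A$ as a left $\overline{A}$-comodule super algebra through $A\xrightarrow{\Delta}A\otimes A\to\overline{A}\otimes A$, with counit $\varepsilon$, and $\overline{A}\otimes\wedge(W^A)$ as one through $\Delta_{\overline{A}}\otimes\mathrm{id}$, with counit $\varepsilon\otimes\varepsilon$.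 **Theorem.** Let $A$ be a super commutative Hopf algebra. 1. There is a counit-preserving isomorphism $\varphi_A: A\xrightarrow{\ \simeq\ }\overline{A}\otimes\wedge(W^A)$ of left $\overline{A}$-comodule super algebras, that is, a bijective, parity-preserving, left $\overline{A}$-colinear algebra map with $(\varepsilon\otimes\varepsilon)\circ\varphi_A=\varepsilon$. 2. For every map $f:A\to B$ of super commutative Hopf algebras, inducing $\overline{f}:\overline{A}\to\overline{B}$ and $W^f:W^A\to W^B$, there are isomorphisms $\varphi_A$ and $\varphi_B$ as in part 1, for $A$ and for $B$ respectively, such that $$\varphi_B\circ f=(\overline{f}\otimes\wedge(W^f))\circ\varphi_A .$$ -/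

import Mathlib

open scoped TensorProduct

noncomputable section

namespace SuperHopf

/-! Super vector spaces are `ZMod 2`-graded vector spaces; a super algebra over `k` is a
`ZMod 2`-graded algebra, i.e. `𝒜 : ZMod 2 → Submodule k A` with `GradedAlgebra 𝒜`. -/

section TensorGrading

variable {k A B : Type*} [CommRing k] [AddCommGroup A] [Module k A] [AddCommGroup B] [Module k B]

/-- The grading of a tensor product by the total degree:
`(A ⊗ B)ₙ` is the sum of the images of `Aᵢ ⊗ Bⱼ` with `i + j = n`. -/
def tensorGrading (𝒜 : ZMod 2 → Submodule k A) (ℬ : ZMod 2 → Submodule k B) (n : ZMod 2) :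
    Submodule k (A ⊗[k] B) :=
  ⨆ (i : ZMod 2) (j : ZMod 2) (_ : i + j = n),
    LinearMap.range (TensorProduct.map (𝒜 i).subtype (ℬ j).subtype)

end TensorGrading

section SuperHopfAlgebra

variable (k : Type*) {A : Type*} [Field k] [Ring A] [Algebra k A]

/-- A super algebra is super-commutative if even elements commute with everything and odd
elements anticommute with each other. -/
class IsSuperCommutative (𝒜 : ZMod 2 → Submodule k A) : Prop where
  even_comm : ∀ a ∈ 𝒜 0, ∀ b : A, a * b = b * a
  odd_anticomm : ∀ a ∈ 𝒜 1, ∀ b ∈ 𝒜 1, a * b = -(b * a)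

/-- A super Hopf algebra: a Hopf algebra object in super vector spaces. The coproduct and
the counit are maps of super algebras, where the target of the coproduct is the graded
tensor product `𝒜 ᵍ⊗[k] 𝒜`, whose product is
`(a ⊗ b) (c ⊗ d) = (-1) ^ (|b| |c|) (a c ⊗ b d)`. -/
class SuperHopfAlgebra (𝒜 : ZMod 2 → Submodule k A) [GradedAlgebra 𝒜] [Coalgebra k A] where
  comul_mem : ∀ n, ∀ a ∈ 𝒜 n, Coalgebra.comul (R := k) a ∈ tensorGrading 𝒜 𝒜 n
  comul_one : GradedTensorProduct.of k 𝒜 𝒜 (Coalgebra.comul (R := k) (1 : A)) = 1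
  comul_mul : ∀ a b : A,
    GradedTensorProduct.of k 𝒜 𝒜 (Coalgebra.comul (R := k) (a * b)) =
      GradedTensorProduct.of k 𝒜 𝒜 (Coalgebra.comul (R := k) a) *
        GradedTensorProduct.of k 𝒜 𝒜 (Coalgebra.comul (R := k) b)
  counit_odd : ∀ a ∈ 𝒜 1, Coalgebra.counit (R := k) a = 0
  counit_one : Coalgebra.counit (R := k) (1 : A) = 1
  counit_mul : ∀ a b : A, Coalgebra.counit (R := k) (a * b) =
    Coalgebra.counit (R := k) a * Coalgebra.counit (R := k) b
  antipode : A →ₗ[k] A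
  antipode_mem : ∀ n, ∀ a ∈ 𝒜 n, antipode a ∈ 𝒜 n
  mul_antipode_rTensor_comul :
    LinearMap.mul' k A ∘ₗ antipode.rTensor A ∘ₗ Coalgebra.comul =
      Algebra.linearMap k A ∘ₗ Coalgebra.counit
  mul_antipode_lTensor_comul :
    LinearMap.mul' k A ∘ₗ antipode.lTensor A ∘ₗ Coalgebra.comul =
      Algebra.linearMap k A ∘ₗ Coalgebra.counit

end SuperHopfAlgebra

section EvenQuotient

variable {k A : Type*} [Field k] [Ring A] [Algebra k A]

/-- The two-sided ideal generated by the odd component `A₁`. -/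
def oddIdeal (𝒜 : ZMod 2 → Submodule k A) : Ideal A :=
  (TwoSidedIdeal.span (𝒜 1 : Set A)).asIdeal

instance (𝒜 : ZMod 2 → Submodule k A) : (oddIdeal 𝒜).IsTwoSided :=
  inferInstanceAs ((TwoSidedIdeal.span (𝒜 1 : Set A)).asIdeal).IsTwoSided

/-- The largest purely even quotient `Ā = A / (A₁)`. -/
abbrev EvenQuotient (𝒜 : ZMod 2 → Submodule k A) : Type _ := A ⧸ oddIdeal 𝒜

/-- The quotient map `A → Ā`. -/
abbrev toEven (𝒜 : ZMod 2 → Submodule k A) : A →ₐ[k] EvenQuotient 𝒜 :=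
  Ideal.Quotient.mkₐ k (oddIdeal 𝒜)

/-- The grading of `Ā` induced from that of `A`. -/
def evenQuotientGrading (𝒜 : ZMod 2 → Submodule k A) (n : ZMod 2) :
    Submodule k (EvenQuotient 𝒜) :=
  (𝒜 n).map (toEven 𝒜).toLinearMap

theorem odd_mem_oddIdeal (𝒜 : ZMod 2 → Submodule k A) {a : A} (ha : a ∈ 𝒜 1) :
    a ∈ oddIdeal 𝒜 := by
  rw [oddIdeal, TwoSidedIdeal.mem_asIdeal]
  exact TwoSidedIdeal.subset_span ha

theorem toEven_odd (𝒜 : ZMod 2 → Submodule k A) {a : A} (ha : a ∈ 𝒜 1) :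
    toEven 𝒜 a = 0 :=
  Ideal.Quotient.eq_zero_iff_mem.2 (odd_mem_oddIdeal 𝒜 ha)

/-- `Ā` is purely even. -/
theorem evenQuotientGrading_one (𝒜 : ZMod 2 → Submodule k A) :
    evenQuotientGrading 𝒜 1 = ⊥ := by
  rw [eq_bot_iff]
  rintro _ ⟨a, ha, rfl⟩
  exact toEven_odd 𝒜 ha

/-- An algebra map which vanishes on `A₁` vanishes on `(A₁)`. -/
theorem eq_zero_of_mem_oddIdeal (𝒜 : ZMod 2 → Submodule k A) {C : Type*} [Ring C] [Algebra k C]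
    (g : A →ₐ[k] C) (hg : ∀ a ∈ 𝒜 1, g a = 0) (a : A) (ha : a ∈ oddIdeal 𝒜) : g a = 0 := by
  have h : TwoSidedIdeal.span (𝒜 1 : Set A) ≤ TwoSidedIdeal.ker g :=
    TwoSidedIdeal.span_le.2 fun x hx => by
      simpa [TwoSidedIdeal.mem_ker] using hg x hx
  rw [oddIdeal, TwoSidedIdeal.mem_asIdeal] at ha
  simpa [TwoSidedIdeal.mem_ker] using h ha

theorem map_toEven_of_mem_one (𝒜 : ZMod 2 → Submodule k A) {x : A ⊗[k] A} (hx : x ∈ tensorGrading 𝒜 𝒜 1) :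
    TensorProduct.map (toEven 𝒜).toLinearMap (toEven 𝒜).toLinearMap x = 0 := by
  suffices h : tensorGrading 𝒜 𝒜 1 ≤
      LinearMap.ker (TensorProduct.map (toEven 𝒜).toLinearMap (toEven 𝒜).toLinearMap) from h hx
  refine iSup_le fun i => iSup_le fun j => iSup_le fun hij => ?_
  rintro _ ⟨y, rfl⟩
  rw [LinearMap.mem_ker]
  induction y with
  | zero => simp
  | add x y hx hy => simp only [map_add, hx, hy, add_zero]
  | tmul a b =>
    have h : ∀ i j : ZMod 2, i + j = 1 → i = 1 ∨ j = 1 := by decide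
    rcases h i j hij with rfl | rfl
    · have h1 := toEven_odd 𝒜 a.2
      simp [-Ideal.Quotient.mkₐ_eq_mk, h1]
    · have h1 := toEven_odd 𝒜 b.2
      simp [-Ideal.Quotient.mkₐ_eq_mk, h1]

variable (𝒜 : ZMod 2 → Submodule k A) [GradedAlgebra 𝒜]

/-- The projection `A ⊗ A → Ā ⊗ Ā` is an algebra map out of the graded tensor product. -/
def toEvenTensor : (GradedTensorProduct k 𝒜 𝒜) →ₐ[k] EvenQuotient 𝒜 ⊗[k] EvenQuotient 𝒜 :=
  GradedTensorProduct.lift 𝒜 𝒜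
    (Algebra.TensorProduct.includeLeft.comp (toEven 𝒜))
    (Algebra.TensorProduct.includeRight.comp (toEven 𝒜)) (by
      intro i j a b
      have h : ∀ i : ZMod 2, i = 0 ∨ i = 1 := by decide
      rcases h i with rfl | rfl
      · simp
      · rcases h j with rfl | rfl
        · simp
        · have h1 := toEven_odd 𝒜 a.2
          have h2 := toEven_odd 𝒜 b.2
          simp only [AlgHom.comp_apply, h1, h2, map_zero, mul_zero, smul_zero])

theorem toEvenTensor_of (x : A ⊗[k] A) :
    toEvenTensor 𝒜 (GradedTensorProduct.of k 𝒜 𝒜 x) =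
      TensorProduct.map (toEven 𝒜).toLinearMap (toEven 𝒜).toLinearMap x := by
  induction x with
  | zero => simp
  | add x y hx hy => simp only [map_add, hx, hy]
  | tmul a b =>
    rw [toEvenTensor]
    erw [GradedTensorProduct.lift_tmul]
    simp

variable [Coalgebra k A] [SuperHopfAlgebra k 𝒜]

/-- The counit of a super Hopf algebra as an algebra map. -/
def counitHom : A →ₐ[k] k :=
  AlgHom.ofLinearMap (Coalgebra.counit (R := k) (A := A))
    (SuperHopfAlgebra.counit_one 𝒜) (SuperHopfAlgebra.counit_mul 𝒜)

/-- The coproduct of a super Hopf algebra as an algebra map. -/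
def comulHom : A →ₐ[k] GradedTensorProduct k 𝒜 𝒜 :=
  AlgHom.ofLinearMap
    ((GradedTensorProduct.of k 𝒜 𝒜).toLinearMap ∘ₗ Coalgebra.comul (R := k) (A := A))
    (SuperHopfAlgebra.comul_one) (SuperHopfAlgebra.comul_mul)

/-- The counit of `Ā`, induced from that of `A`. -/
def evenCounit : EvenQuotient 𝒜 →ₐ[k] k :=
  Ideal.Quotient.liftₐ (oddIdeal 𝒜) (counitHom 𝒜)
    (eq_zero_of_mem_oddIdeal 𝒜 _ (SuperHopfAlgebra.counit_odd (k := k) (𝒜 := 𝒜)))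

/-- The coproduct of `Ā`, induced from that of `A`. -/
def evenComul : EvenQuotient 𝒜 →ₐ[k] EvenQuotient 𝒜 ⊗[k] EvenQuotient 𝒜 :=
  Ideal.Quotient.liftₐ (oddIdeal 𝒜) ((toEvenTensor 𝒜).comp (comulHom 𝒜))
    (eq_zero_of_mem_oddIdeal 𝒜 _ fun a ha => by
      change toEvenTensor 𝒜 (GradedTensorProduct.of k 𝒜 𝒜 (Coalgebra.comul (R := k) a)) = 0
      rw [toEvenTensor_of]
      exact map_toEven_of_mem_one 𝒜 (SuperHopfAlgebra.comul_mem 1 a ha))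

theorem evenCounit_comp :
    (evenCounit 𝒜).toLinearMap ∘ₗ (toEven 𝒜).toLinearMap = Coalgebra.counit := rfl

theorem evenComul_comp :
    (evenComul 𝒜).toLinearMap ∘ₗ (toEven 𝒜).toLinearMap =
      TensorProduct.map (toEven 𝒜).toLinearMap (toEven 𝒜).toLinearMap ∘ₗ Coalgebra.comul := by
  ext a
  exact toEvenTensor_of 𝒜 (Coalgebra.comul (R := k) a)

open Coalgebra in
/-- `Ā` with the bialgebra structure of a quotient of `A`. -/
instance : Bialgebra k (EvenQuotient 𝒜) := by
  refine .ofAlgHom (evenComul 𝒜) (evenCounit 𝒜) ?_ ?_ ?_ <;>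
    refine Ideal.Quotient.algHom_ext k (AlgHom.toLinearMap_injective ?_) <;>
    simp only [coassoc_simps, AlgHom.comp_toLinearMap, Algebra.TensorProduct.toLinearMap_map,
      evenComul_comp, evenCounit_comp]
  · simp [coassoc_simps]
  · rw [CoassocSimps.map_counit_comp_comul_left]; rfl
  · rw [CoassocSimps.map_counit_comp_comul_right]; rfl

end EvenQuotient

section OddCotangent

variable {k A : Type*} [Field k] [Ring A] [Algebra k A] [Coalgebra k A]

/-- The subspace `A₀⁺ A₁` of `A₁`, spanned by the products of an element of
`A₀⁺ = A₀ ∩ ker ε` and an element of `A₁`. -/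
def augmentationMulOdd (𝒜 : ZMod 2 → Submodule k A) : Submodule k (𝒜 1) :=
  ((𝒜 0 ⊓ LinearMap.ker (Coalgebra.counit (R := k) (A := A))) * 𝒜 1).submoduleOf (𝒜 1)

/-- The vector space `W^A = A₁ / A₀⁺ A₁`. -/
abbrev OddCotangent (𝒜 : ZMod 2 → Submodule k A) : Type _ := 𝒜 1 ⧸ augmentationMulOdd 𝒜

/-- The exterior algebra `∧(W^A)`. -/
abbrev ExteriorOdd (𝒜 : ZMod 2 → Submodule k A) : Type _ := ExteriorAlgebra k (OddCotangent 𝒜)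

/-- The parity grading of `∧(W^A)`: the component of degree `i` is the sum of the
exterior powers whose exponent is congruent to `i` modulo `2`. -/
abbrev exteriorGrading (𝒜 : ZMod 2 → Submodule k A) : ZMod 2 → Submodule k (ExteriorOdd 𝒜) :=
  CliffordAlgebra.evenOdd (0 : QuadraticForm k (OddCotangent 𝒜))

end OddCotangent

section Decomposition

variable {k A : Type*} [Field k] [Ring A] [Algebra k A]

/-- `Ā ⊗ ∧(W^A)`. The product is that of the usual tensor product of algebras; it is also the
product `(a ⊗ b) (c ⊗ d) = (-1) ^ (|b| |c|) (a c ⊗ b d)` of the tensor product of super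
algebras, because `Ā` is purely even, see `tmul_mul_tmul_super`. -/
abbrev Model (𝒜 : ZMod 2 → Submodule k A) [Coalgebra k A] : Type _ :=
  EvenQuotient 𝒜 ⊗[k] ExteriorOdd 𝒜

/-- The product of `Ā ⊗ ∧(W^A)` satisfies the sign rule. -/
theorem tmul_mul_tmul_super (𝒜 : ZMod 2 → Submodule k A) [Coalgebra k A] (i j : ZMod 2)
    (a c : EvenQuotient 𝒜) (b d : ExteriorOdd 𝒜) (_hb : b ∈ exteriorGrading 𝒜 j)
    (hc : c ∈ evenQuotientGrading 𝒜 i) :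
    (a ⊗ₜ[k] b * c ⊗ₜ[k] d : Model 𝒜) = (-1 : ℤˣ) ^ (j * i) • ((a * c) ⊗ₜ[k] (b * d)) := by
  have h : ∀ i : ZMod 2, i = 0 ∨ i = 1 := by decide
  rcases h i with rfl | rfl
  · simp
  · rw [evenQuotientGrading_one, Submodule.mem_bot] at hc
    simp [hc]

variable (𝒜 : ZMod 2 → Submodule k A) [Coalgebra k A]

/-- The left coaction `A → A ⊗ A → Ā ⊗ A` of `Ā` on `A`. -/
def coaction : A →ₗ[k] EvenQuotient 𝒜 ⊗[k] A :=
  (toEven 𝒜).toLinearMap.rTensor A ∘ₗ Coalgebra.comul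

variable [GradedAlgebra 𝒜] [SuperHopfAlgebra k 𝒜]

/-- The left coaction `Δ ⊗ id` of `Ā` on `Ā ⊗ ∧(W^A)`. -/
def modelCoaction : Model 𝒜 →ₗ[k] EvenQuotient 𝒜 ⊗[k] Model 𝒜 :=
  (TensorProduct.assoc k (EvenQuotient 𝒜) (EvenQuotient 𝒜) (ExteriorOdd 𝒜)).toLinearMap ∘ₗ
    (Coalgebra.comul (R := k) (A := EvenQuotient 𝒜)).rTensor (ExteriorOdd 𝒜)

/-- The counit `ε ⊗ ε` of `Ā ⊗ ∧(W^A)`, where the counit of `∧(W^A)` is the algebra map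
which vanishes on `W^A`. -/
def modelCounit : Model 𝒜 →ₐ[k] k :=
  Algebra.TensorProduct.lift (Bialgebra.counitAlgHom k (EvenQuotient 𝒜))
    (ExteriorAlgebra.algebraMapInv (R := k) (M := OddCotangent 𝒜)) fun _ _ => mul_comm _ _

/-- A counit-preserving isomorphism `A ≃ Ā ⊗ ∧(W^A)` of left `Ā`-comodule super algebras. -/
structure Decomposition extends A ≃ₐ[k] Model 𝒜 where
  map_mem : ∀ n, ∀ a ∈ 𝒜 n,
    toFun a ∈ tensorGrading (evenQuotientGrading 𝒜) (exteriorGrading 𝒜) n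
  map_coaction : ∀ a : A,
    modelCoaction 𝒜 (toAlgEquiv a) =
      toAlgEquiv.toLinearMap.lTensor (EvenQuotient 𝒜) (coaction 𝒜 a)
  map_counit : ∀ a : A, modelCounit 𝒜 (toAlgEquiv a) = Coalgebra.counit (R := k) a

end Decomposition

section Functoriality

variable {k A B : Type*} [Field k] [Ring A] [Algebra k A] [Coalgebra k A]
  [Ring B] [Algebra k B] [Coalgebra k B]

/-- A map of super Hopf algebras: a parity preserving map of algebras and of coalgebras. -/
structure SuperHopfHom (𝒜 : ZMod 2 → Submodule k A) (ℬ : ZMod 2 → Submodule k B)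
    extends A →ₐ[k] B where
  map_mem : ∀ n, ∀ a ∈ 𝒜 n, toAlgHom a ∈ ℬ n
  counit_map : ∀ a : A,
    Coalgebra.counit (R := k) (toAlgHom a) = Coalgebra.counit (R := k) a
  comul_map : ∀ a : A, Coalgebra.comul (R := k) (toAlgHom a) =
    TensorProduct.map toAlgHom.toLinearMap toAlgHom.toLinearMap (Coalgebra.comul (R := k) a)

variable {𝒜 : ZMod 2 → Submodule k A} {ℬ : ZMod 2 → Submodule k B}

/-- The induced map `f̄ : Ā → B̄`. -/
def SuperHopfHom.evenMap (f : SuperHopfHom 𝒜 ℬ) : EvenQuotient 𝒜 →ₐ[k] EvenQuotient ℬ :=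
  Ideal.Quotient.liftₐ (oddIdeal 𝒜) ((toEven ℬ).comp f.toAlgHom)
    (eq_zero_of_mem_oddIdeal 𝒜 _ fun a ha => toEven_odd ℬ (f.map_mem 1 a ha))

/-- The restriction `A₁ → B₁`. -/
def SuperHopfHom.oddRestrict (f : SuperHopfHom 𝒜 ℬ) : 𝒜 1 →ₗ[k] ℬ 1 :=
  f.toAlgHom.toLinearMap.restrict (f.map_mem 1)

theorem SuperHopfHom.augmentationMulOdd_le (f : SuperHopfHom 𝒜 ℬ) :
    augmentationMulOdd 𝒜 ≤ (augmentationMulOdd ℬ).comap f.oddRestrict := by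
  rintro ⟨x, hx1⟩ hx
  change f.toAlgHom x ∈ (ℬ 0 ⊓ LinearMap.ker (Coalgebra.counit (R := k) (A := B))) * ℬ 1
  replace hx : x ∈ (𝒜 0 ⊓ LinearMap.ker (Coalgebra.counit (R := k) (A := A))) * 𝒜 1 := hx
  clear hx1
  induction hx using Submodule.mul_induction_on' with
  | mem_mul_mem a ha b hb =>
    rw [map_mul]
    refine Submodule.mul_mem_mul ⟨f.map_mem 0 a ha.1, ?_⟩ (f.map_mem 1 b hb)
    have h := ha.2
    simp only [SetLike.mem_coe, LinearMap.mem_ker] at h ⊢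
    rw [f.counit_map, h]
  | add a _ b _ ha hb => rw [map_add]; exact add_mem ha hb

/-- The induced map `W^f : W^A → W^B`. -/
def SuperHopfHom.oddCotangentMap (f : SuperHopfHom 𝒜 ℬ) :
    OddCotangent 𝒜 →ₗ[k] OddCotangent ℬ :=
  Submodule.mapQ _ _ f.oddRestrict f.augmentationMulOdd_le

/-- The induced map `f̄ ⊗ ∧(W^f) : Ā ⊗ ∧(W^A) → B̄ ⊗ ∧(W^B)`. -/
def SuperHopfHom.modelMap (f : SuperHopfHom 𝒜 ℬ) : Model 𝒜 →ₐ[k] Model ℬ :=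
  Algebra.TensorProduct.map f.evenMap (ExteriorAlgebra.map f.oddCotangentMap)

end Functoriality

end SuperHopf

end

/-!
# The tensor decomposition of super commutative Hopf algebras

Write `π : A → Ā` for the projection and `[a] ∈ W^A` for the class of the odd part of `a`.

**The map.** A super algebra map `g : A → ∧(W^A)` yields the map of `Ā`-comodule super algebras
`phi g : a ↦ ∑ π(a₁) ⊗ g(a₂)`. The class `a ↦ [a]` is a derivation along the counit, so
`a ↦ ε(a) + η[a]` is a super algebra map whenever `η` is an endomorphism of `W^A` such that all
products `η(u) η(v)` vanish in `∧(W^A)`, for instance an endomorphism of rank one. Convolution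
products of super algebra maps into a super commutative algebra are super algebra maps again. If the
`E i` form a resolution of the identity of `W^A` into such endomorphisms (`IsResolution`; think of
the projections to the lines spanned by a basis), then, since every element lies in a
finite-dimensional subcoalgebra, the infinite ordered convolution product of the maps
`a ↦ ε(a) + E i [a]` makes sense (`exists_superExp`). It agrees with `a ↦ ε(a) + [a]` up to terms
of exterior degree at least two (`IsSuperExp.sub_mem`), and it is natural in the resolution
(`SuperHopfHom.superExp_map`). In finite dimension any such `g` would do; in general the resolution
has to be adapted to a well-ordered chain of subspaces of `W^A`.

**Injectivity.** Filter `A` by the powers `I ^ n` of the ideal `I` generated by `A₁`, and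
`Ā ⊗ ∧(W^A)` by the exterior degree. With the antipode `S`, the elements `∑ S((x₁)₀) (x₂)₁` are odd,
are coinvariant up to `I ^ 2`, depend only on `[x]` up to `I ^ 2`, and generate `I` up to `I ^ 2`.
They provide a left inverse of `phi g` on the associated graded spaces, so that `phi g` is injective
up to `⋂ I ^ n` (`mem_oddPow_of_phi_eq_zero`). To deal with the intersection, choose a
finite-dimensional subcoalgebra `V` containing a given element `a` of the kernel, and a finitely
generated sub super Hopf algebra `D` which contains `V` and in which `a` is in `I ^ n` for an
`n > dim V`. In `D` the ideal `I` is nilpotent, so every map `phi γ` of `D` is injective. For a `γ`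
adapted to the image `U` of `V` in `W^D`, the element `phi γ a` is in `D̄ ⊗ ∧(U)` and has exterior
degree at least `n > dim U`; hence `a = 0` (`phi_injective`).

**Surjectivity.** Add the finitely generated sub super Hopf algebras `D` one after the other, along a
well-order. If the resolution preserves the subspaces of `W^A` reached so far (`oddChain`), a
finite-dimensional space `Q` that contains the classes of `D` is spanned by classes of `D` and by
elements `u` for which `1 ⊗ u` is already known to be in the image. Descending induction on the
exterior degree then shows that `D̄ ⊗ ∧(Q)` is in the image (`modelFil_le_range`,
`phi_surjective`).

**Naturality.** For a map `f : A → B` one needs resolutions of `W^A` and `W^B` that are intertwined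
by `W^f` and adapted to the chains on both sides. They are found by splitting `W^A` and `W^B` along
the kernel and the image of `W^f` (`exists_compatible_resolutions`); the chain of `W^B` starts from
the image of `W^f`, all of which is reached because `phi` is surjective for `A`.
-/

open scoped TensorProduct

noncomputable section

namespace SuperHopf

universe u v

/-! ### Adapted bases and resolutions of the identity -/

section AdaptedResolution

variable {k : Type*} [Field k]

/-- Every vector space has a basis adapted to a given well-ordered chain of subspaces: among the
vectors of a well-order refining the chain, those outside the span of their predecessors. -/
theorem exists_basis_adapted {W Λ : Type*} [AddCommGroup W] [Module k W] [LinearOrder Λ]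
    [WellFoundedLT Λ] (P : Λ → Submodule k W) :
    Monotone P → ∃ (s : Set W) (b : Module.Basis s k W),
      ∀ l, ∀ u ∈ P l, ∀ i, b.repr u i ≠ 0 → b i ∈ P l := by
  classical
  intro hP
  let rank : W → WithTop Λ := fun w =>
    if h : ∃ l, w ∈ P l then ((WellFounded.min wellFounded_lt {l | w ∈ P l} h : Λ) : WithTop Λ)
    else ⊤
  have rank_le : ∀ w (l : Λ), rank w ≤ l ↔ w ∈ P l := by
    intro w l
    by_cases h : ∃ l, w ∈ P l
    · simp only [rank, dif_pos h, WithTop.coe_le_coe]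
      refine ⟨fun hl => hP hl (WellFounded.min_mem wellFounded_lt {l | w ∈ P l} h), fun hl => ?_⟩
      exact not_lt.1 (WellFounded.not_lt_min wellFounded_lt {l | w ∈ P l} hl)
    · simp only [rank, dif_neg h]
      refine ⟨fun hl => absurd hl (by simp), fun hl => (h ⟨l, hl⟩).elim⟩
  let e : W → WithTop Λ × W := fun w => (rank w, w)
  have he : Function.Injective e := fun a b h => (Prod.ext_iff.1 h).2
  let r : W → W → Prop := e ⁻¹'o (Prod.Lex (· < ·) WellOrderingRel)
  have : IsWellOrder W r :=
    (RelEmbedding.preimage ⟨e, he⟩ (Prod.Lex (· < ·) WellOrderingRel)).isWellOrder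
  have hr : ∀ v w, r v w → rank v ≤ rank w := by
    intro v w h
    rcases Prod.lex_def.1 h with h | h
    · exact h.le
    · exact h.1.le
  -- by well-founded induction, every vector is in the span of the `v ∈ s` with `v ≤ w`
  let s : Set W := {w | w ∉ Submodule.span k {v | r v w}}
  have hspan : ∀ w, w ∈ Submodule.span k {v | v ∈ s ∧ (r v w ∨ v = w)} := by
    intro w
    induction w using IsWellFounded.induction r with
    | ind w ih =>
    by_cases hw : w ∈ s
    · exact Submodule.subset_span ⟨hw, Or.inr rfl⟩
    · have hw' : w ∈ Submodule.span k {v | r v w} := not_not.1 hw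
      refine Submodule.span_le.2 (fun v hv => ?_) hw'
      refine Submodule.span_mono ?_ (ih v hv)
      rintro x ⟨hx, hxv⟩
      refine ⟨hx, Or.inl ?_⟩
      rcases hxv with h | rfl
      · exact _root_.trans h hv
      · exact hv
  have hli : LinearIndependent k ((↑) : s → W) := by
    let _ := linearOrderOfSTO r
    rw [linearIndependent_iff]
    intro c hc
    by_contra hne
    have hsupp : c.support.Nonempty := Finsupp.support_nonempty_iff.2 hne
    set m := c.support.max' hsupp with hm
    have hmem : m ∈ c.support := Finset.max'_mem _ _
    -- in a nontrivial relation the largest vector would be in the span of its predecessors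
    refine m.2 ?_
    have hsum : c m • (m : W) + ∑ i ∈ c.support.erase m, c i • (i : W) = 0 := by
      rw [Finset.add_sum_erase _ (fun i => c i • (i : W)) hmem]
      simpa [Finsupp.linearCombination_apply, Finsupp.sum] using hc
    have hcm : c m ≠ 0 := Finsupp.mem_support_iff.1 hmem
    have hm' : (m : W) = -((c m)⁻¹ • ∑ i ∈ c.support.erase m, c i • (i : W)) := by
      rw [eq_neg_of_add_eq_zero_right hsum, smul_neg, neg_neg, smul_smul, inv_mul_cancel₀ hcm,
        one_smul]
    rw [show (m : W) ∈ Submodule.span k {v | r v m} ↔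
      -((c m)⁻¹ • ∑ i ∈ c.support.erase m, c i • (i : W)) ∈ Submodule.span k {v | r v m} by
        rw [← hm']]
    refine Submodule.neg_mem _ (Submodule.smul_mem _ _ (Submodule.sum_mem _ fun i hi => ?_))
    refine Submodule.smul_mem _ _ (Submodule.subset_span ?_)
    have hi' := Finset.mem_erase.1 hi
    exact lt_of_le_of_ne (Finset.le_max' _ _ hi'.2) hi'.1
  have htop : ⊤ ≤ Submodule.span k (Set.range ((↑) : s → W)) := by
    intro w _
    refine Submodule.span_mono ?_ (hspan w)
    rintro v ⟨hv, -⟩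
    exact ⟨⟨v, hv⟩, rfl⟩
  refine ⟨s, Module.Basis.mk hli htop, fun l u hu i hi => ?_⟩
  set b := Module.Basis.mk hli htop
  have hb : ∀ i, b i = (i : W) := fun i => by simp [b]
  have h1 : u ∈ Submodule.span k (b '' {i | (i : W) ∈ P l}) := by
    refine Submodule.span_mono ?_ (hspan u)
    rintro v ⟨hv, hvu⟩
    refine ⟨⟨v, hv⟩, ?_, hb _⟩
    refine (rank_le v l).1 (le_trans ?_ ((rank_le u l).2 hu))
    rcases hvu with h | rfl
    · exact hr _ _ h
    · exact le_rfl
  rw [b.mem_span_image] at h1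
  rw [hb]
  exact h1 (Finsupp.mem_support_iff.2 hi)

/-- A resolution of the identity of `W`: a locally finite family of endomorphisms with sum `1`,
such that any two vectors in the range of the same endomorphism have exterior product `0`
(so that each endomorphism has rank at most `1`). -/
structure IsResolution {W ι : Type*} [AddCommGroup W] [Module k W] (E : ι → W →ₗ[k] W) :
    Prop where
  sq_zero : ∀ i u v, ExteriorAlgebra.ι k (E i u) * ExteriorAlgebra.ι k (E i v) = 0
  sum_eq : ∀ u, ∃ T : Finset ι, (∀ i, i ∉ T → E i u = 0) ∧ ∑ i ∈ T, E i u = u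

theorem IsResolution.sum_eq_of_vanish {W ι : Type*} [AddCommGroup W] [Module k W]
    {E : ι → W →ₗ[k] W} (hE : IsResolution E) {u : W} {T : Finset ι}
    (hT : ∀ i, i ∉ T → E i u = 0) : ∑ i ∈ T, E i u = u := by
  classical
  obtain ⟨T', h1, h2⟩ := hE.sum_eq u
  calc ∑ i ∈ T, E i u = ∑ i ∈ T ∪ T', E i u :=
        Finset.sum_subset Finset.subset_union_left fun i _ hi => hT i hi
    _ = ∑ i ∈ T', E i u :=
        (Finset.sum_subset Finset.subset_union_right fun i _ hi => h1 i hi).symm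
    _ = u := h2

/-- The rank one projections along an adapted basis. -/
theorem exists_resolution {W Λ : Type*} [AddCommGroup W] [Module k W] [LinearOrder Λ]
    [WellFoundedLT Λ] (P : Λ → Submodule k W) (hP : Monotone P) :
    ∃ (s : Set W) (E : s → W →ₗ[k] W), IsResolution E ∧ ∀ l i, ∀ u ∈ P l, E i u ∈ P l := by
  classical
  obtain ⟨s, b, hb⟩ := exists_basis_adapted P hP
  refine ⟨s, fun i => (b.coord i).smulRight (b i), ⟨fun i u v => ?_, fun u => ?_⟩,
    fun l i u hu => ?_⟩
  · simp
  · refine ⟨(b.repr u).support, fun i hi => ?_, ?_⟩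
    · simp [Finsupp.notMem_support_iff.1 hi]
    · simpa [Finsupp.linearCombination_apply, Finsupp.sum] using b.linearCombination_repr u
  · by_cases h : b.repr u i = 0
    · simp [h]
    · simpa using (P l).smul_mem _ (hb l u hu i h)

/-- A surjective linear map has a section which respects a well-ordered chain of subspaces. -/
theorem exists_section_adapted {W R Λ : Type*} [AddCommGroup W] [Module k W] [AddCommGroup R]
    [Module k R] [LinearOrder Λ] [WellFoundedLT Λ] (f : W →ₗ[k] R) (hf : Function.Surjective f)
    (P : Λ → Submodule k W) (hP : Monotone P) :
    ∃ s : R →ₗ[k] W, f ∘ₗ s = LinearMap.id ∧ ∀ l, ∀ u ∈ P l, s (f u) ∈ P l := by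
  classical
  obtain ⟨t, b, hb⟩ := exists_basis_adapted (fun l => (P l).map f)
    (fun i j h => Submodule.map_mono (hP h))
  have key : ∀ i, ∃ w, f w = b i ∧ ∀ l, b i ∈ (P l).map f → w ∈ P l := by
    intro i
    by_cases h : ∃ l, b i ∈ (P l).map f
    · have hm : b i ∈ (P (WellFounded.min wellFounded_lt {l | b i ∈ (P l).map f} h)).map f :=
        WellFounded.min_mem wellFounded_lt {l | b i ∈ (P l).map f} h
      obtain ⟨w, hw, hwi⟩ := hm
      refine ⟨w, hwi, fun l hl => hP ?_ hw⟩
      exact not_lt.1 (WellFounded.not_lt_min wellFounded_lt {l | b i ∈ (P l).map f} hl)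
    · obtain ⟨w, hw⟩ := hf (b i)
      exact ⟨w, hw, fun l hl => (h ⟨l, hl⟩).elim⟩
  choose w hw hwP using key
  refine ⟨b.constr k w, b.ext fun i => by simp [hw], fun l u hu => ?_⟩
  rw [b.constr_apply]
  refine Submodule.sum_mem _ fun i hi => Submodule.smul_mem _ _ (hwP i l ?_)
  exact hb l (f u) (Submodule.mem_map_of_mem hu) i (Finsupp.mem_support_iff.1 hi)

theorem ι_mul_ι_map_eq_zero {W W' : Type*} [AddCommGroup W] [Module k W] [AddCommGroup W']
    [Module k W'] (f : W →ₗ[k] W') {u v : W}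
    (h : ExteriorAlgebra.ι k u * ExteriorAlgebra.ι k v = 0) :
    ExteriorAlgebra.ι k (f u) * ExteriorAlgebra.ι k (f v) = 0 := by
  have := congrArg (ExteriorAlgebra.map f) h
  simpa using this

/-- Compatible resolutions for the source and the target of a linear map, adapted to given
chains of subspaces; those of the target are assumed to contain the range. -/
theorem exists_compatible_resolutions {W : Type u} {W' : Type v} {Λ Λ' : Type*} [AddCommGroup W]
    [Module k W]
    [AddCommGroup W'] [Module k W'] [LinearOrder Λ] [WellFoundedLT Λ] [LinearOrder Λ']
    [WellFoundedLT Λ'] (f : W →ₗ[k] W') (P : Λ → Submodule k W) (hP : Monotone P)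
    (P' : Λ' → Submodule k W') (hP' : Monotone P') (hf : ∀ l, LinearMap.range f ≤ P' l) :
    ∃ (ι : Type (max u v)) (E : ι → W →ₗ[k] W) (E' : ι → W' →ₗ[k] W'),
      IsResolution E ∧ IsResolution E' ∧ (∀ i, E' i ∘ₗ f = f ∘ₗ E i) ∧
      (∀ l i, ∀ u ∈ P l, E i u ∈ P l) ∧ (∀ l i, ∀ u ∈ P' l, E' i u ∈ P' l) := by
  classical
  -- The section `s` identifies `W` with `K × R`, and `t` identifies `W'` with `R × W' / R`. Take
  -- resolutions of `K`, `R` and `W' / R`, where the one of `R` is used on both sides.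
  let R := LinearMap.range f
  let K := LinearMap.ker f
  let f₀ : W →ₗ[k] R := f.rangeRestrict
  obtain ⟨s, hs, hsP⟩ := exists_section_adapted f₀ f.surjective_rangeRestrict P hP
  obtain ⟨t, ht⟩ := R.mkQ.exists_rightInverse_of_surjective (by simp)
  obtain ⟨α, EK, hK, hKP⟩ := exists_resolution (fun l => (P l).comap K.subtype)
    (fun i j h => Submodule.comap_mono (hP h))
  obtain ⟨β, ER, hR, hRP⟩ := exists_resolution (fun l => (P l).map f₀)
    (fun i j h => Submodule.map_mono (hP h))
  obtain ⟨γ, EQ, hQ, hQP⟩ := exists_resolution (fun l => (P' l).map R.mkQ)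
    (fun i j h => Submodule.map_mono (hP' h))
  have hs' : ∀ x, f₀ (s x) = x := fun x => LinearMap.congr_fun hs x
  have hs'' : ∀ x, f (s x) = x := fun x => congrArg Subtype.val (hs' x)
  have ht' : ∀ x, R.mkQ (t x) = x := fun x => LinearMap.congr_fun ht x
  let p : W →ₗ[k] K := (LinearMap.id - s ∘ₗ f₀).codRestrict K fun u => by
    simp only [K, LinearMap.mem_ker, LinearMap.sub_apply, map_sub, LinearMap.id_apply,
      LinearMap.comp_apply, hs'']
    exact sub_self _
  have hp : ∀ u, (p u : W) = u - s (f₀ u) := fun u => rfl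
  let q : W' →ₗ[k] R := (LinearMap.id - t ∘ₗ R.mkQ).codRestrict R fun u => by
    rw [← Submodule.Quotient.mk_eq_zero R, ← Submodule.mkQ_apply]
    simp [-Submodule.mkQ_apply, ht']
  have hq : ∀ u, (q u : W') = u - t (R.mkQ u) := fun u => rfl
  have hmkf : ∀ u, R.mkQ (f u) = 0 := fun u =>
    (Submodule.Quotient.mk_eq_zero R).2 (LinearMap.mem_range_self f u)
  have hqf : ∀ u, q (f u) = f₀ u := fun u => Subtype.ext (by rw [hq, hmkf]; simp [f₀])
  let E : (α ⊕ β) ⊕ γ → W →ₗ[k] W := Sum.elim (Sum.elim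
    (fun i => K.subtype ∘ₗ EK i ∘ₗ p) (fun i => s ∘ₗ ER i ∘ₗ f₀)) 0
  let E' : (α ⊕ β) ⊕ γ → W' →ₗ[k] W' := Sum.elim (Sum.elim
    0 (fun i => R.subtype ∘ₗ ER i ∘ₗ q)) (fun i => t ∘ₗ EQ i ∘ₗ R.mkQ)
  refine ⟨(α ⊕ β) ⊕ γ, E, E', ⟨?_, ?_⟩, ⟨?_, ?_⟩, ?_, ?_, ?_⟩
  · rintro ((i | i) | i) u v
    · exact ι_mul_ι_map_eq_zero K.subtype (hK.sq_zero i _ _)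
    · exact ι_mul_ι_map_eq_zero s (hR.sq_zero i _ _)
    · simp [E]
  · intro u
    obtain ⟨T₁, h1, h1'⟩ := hK.sum_eq (p u)
    obtain ⟨T₂, h2, h2'⟩ := hR.sum_eq (f₀ u)
    refine ⟨(T₁.disjSum T₂).disjSum ∅, ?_, ?_⟩
    · rintro ((i | i) | i) hi
      · simp [E, h1 i (by simpa using hi)]
      · simp [E, h2 i (by simpa using hi)]
      · simp [E]
    · simp only [Finset.sum_disjSum, Finset.sum_empty, add_zero, E, Sum.elim_inl, Sum.elim_inr,
        LinearMap.comp_apply]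
      rw [← map_sum, ← map_sum, h1', h2', Submodule.subtype_apply, hp, sub_add_cancel]
  · rintro ((i | i) | i) u v
    · simp [E']
    · exact ι_mul_ι_map_eq_zero R.subtype (hR.sq_zero i _ _)
    · exact ι_mul_ι_map_eq_zero t (hQ.sq_zero i _ _)
  · intro u
    obtain ⟨T₁, h1, h1'⟩ := hQ.sum_eq (R.mkQ u)
    obtain ⟨T₂, h2, h2'⟩ := hR.sum_eq (q u)
    refine ⟨(Finset.disjSum ∅ T₂).disjSum T₁, ?_, ?_⟩
    · rintro ((i | i) | i) hi
      · simp [E']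
      · simp [E', h2 i (by simpa using hi)]
      · have := h1 i (by simpa using hi)
        simp only [E', Sum.elim_inr, LinearMap.comp_apply, this, map_zero]
    · simp only [Finset.sum_disjSum, Finset.sum_empty, zero_add, E', Sum.elim_inl, Sum.elim_inr,
        LinearMap.comp_apply]
      rw [← map_sum, ← map_sum, h1', h2', Submodule.subtype_apply, hq, sub_add_cancel]
  · rintro ((i | i) | i) <;> ext u
    · simp [E, E']
    · simp [E, E', hqf, hs'']
    · have : EQ i (R.mkQ (f u)) = 0 := by rw [hmkf, map_zero]
      simp only [E, E', Sum.elim_inr, LinearMap.comp_apply, this, map_zero, Pi.zero_apply,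
        LinearMap.zero_apply]
  · rintro l ((i | i) | i) u hu
    · refine hKP l i (p u) ?_
      simpa [hp] using (P l).sub_mem hu (hsP l u hu)
    · obtain ⟨w, hw, hwu⟩ := hRP l i (f₀ u) (Submodule.mem_map_of_mem hu)
      change s (ER i (f₀ u)) ∈ P l
      rw [← hwu]
      exact hsP l w hw
    · simp [E]
  · rintro l ((i | i) | i) u hu
    · simp [E']
    · exact hf l (ER i (q u)).2
    · obtain ⟨w, hw, hwu⟩ := hQP l i (R.mkQ u) (Submodule.mem_map_of_mem hu)
      change t (EQ i (R.mkQ u)) ∈ P' l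
      rw [← hwu]
      have h3 : (q w : W') ∈ P' l := hf l (q w).2
      rw [hq] at h3
      simpa using (P' l).sub_mem hw h3

end AdaptedResolution

/-! ### Parity -/

theorem zmod_two_cases (i : ZMod 2) : i = 0 ∨ i = 1 := by
  revert i; decide

section Parity

variable {k A : Type*} [Field k] [Ring A] [Algebra k A] (𝒜 : ZMod 2 → Submodule k A)
  [GradedAlgebra 𝒜]

/-- The projection of a super algebra to its component of parity `i`. -/
abbrev pr (i : ZMod 2) : A →ₗ[k] A := GradedAlgebra.proj 𝒜 i

theorem pr_mem (i : ZMod 2) (a : A) : pr 𝒜 i a ∈ 𝒜 i := by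
  rw [GradedAlgebra.proj_apply]; exact SetLike.coe_mem _

variable {𝒜}

theorem pr_of_mem {i : ZMod 2} {a : A} (ha : a ∈ 𝒜 i) : pr 𝒜 i a = a := by
  rw [GradedAlgebra.proj_apply, DirectSum.decompose_of_mem_same 𝒜 ha]

theorem pr_of_mem_ne {i j : ZMod 2} {a : A} (ha : a ∈ 𝒜 i) (h : i ≠ j) : pr 𝒜 j a = 0 := by
  rw [GradedAlgebra.proj_apply, DirectSum.decompose_of_mem_ne 𝒜 ha h]

theorem pr_one_of_even {a : A} (ha : a ∈ 𝒜 0) : pr 𝒜 1 a = 0 := pr_of_mem_ne ha (by decide)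

theorem pr_zero_of_odd {a : A} (ha : a ∈ 𝒜 1) : pr 𝒜 0 a = 0 := pr_of_mem_ne ha (by decide)

variable (𝒜)

theorem pr_zero_add_pr_one (a : A) : pr 𝒜 0 a + pr 𝒜 1 a = a := by
  have h : ∀ a ∈ (⊤ : Submodule k A), pr 𝒜 0 a + pr 𝒜 1 a = a := by
    intro a _
    induction a using DirectSum.Decomposition.inductionOn 𝒜 with
    | zero => simp
    | add a b ha hb =>
      rw [map_add, map_add, add_add_add_comm, ha trivial, hb trivial]
    | @homogeneous i a =>
      rcases zmod_two_cases i with rfl | rfl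
      · rw [pr_of_mem a.2, pr_one_of_even a.2, add_zero]
      · rw [pr_of_mem a.2, pr_zero_of_odd a.2, zero_add]
  exact h a trivial

variable {𝒜} in
theorem mul_mem_of_eq {i j n : ZMod 2} {a b : A} (ha : a ∈ 𝒜 i) (hb : b ∈ 𝒜 j) (h : i + j = n) :
    a * b ∈ 𝒜 n := h ▸ SetLike.mul_mem_graded ha hb

theorem pr_zero_mul (a b : A) :
    pr 𝒜 0 (a * b) = pr 𝒜 0 a * pr 𝒜 0 b + pr 𝒜 1 a * pr 𝒜 1 b := by
  have h00 := mul_mem_of_eq (pr_mem 𝒜 0 a) (pr_mem 𝒜 0 b) (n := 0) (by decide)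
  have h01 := mul_mem_of_eq (pr_mem 𝒜 0 a) (pr_mem 𝒜 1 b) (n := 1) (by decide)
  have h10 := mul_mem_of_eq (pr_mem 𝒜 1 a) (pr_mem 𝒜 0 b) (n := 1) (by decide)
  have h11 := mul_mem_of_eq (pr_mem 𝒜 1 a) (pr_mem 𝒜 1 b) (n := 0) (by decide)
  conv_lhs => rw [← pr_zero_add_pr_one 𝒜 a, ← pr_zero_add_pr_one 𝒜 b]
  simp only [add_mul, mul_add, map_add]
  rw [pr_of_mem h00, pr_of_mem h11, pr_zero_of_odd h01, pr_zero_of_odd h10]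
  abel

theorem pr_one_mul (a b : A) :
    pr 𝒜 1 (a * b) = pr 𝒜 0 a * pr 𝒜 1 b + pr 𝒜 1 a * pr 𝒜 0 b := by
  have h00 := mul_mem_of_eq (pr_mem 𝒜 0 a) (pr_mem 𝒜 0 b) (n := 0) (by decide)
  have h01 := mul_mem_of_eq (pr_mem 𝒜 0 a) (pr_mem 𝒜 1 b) (n := 1) (by decide)
  have h10 := mul_mem_of_eq (pr_mem 𝒜 1 a) (pr_mem 𝒜 0 b) (n := 1) (by decide)
  have h11 := mul_mem_of_eq (pr_mem 𝒜 1 a) (pr_mem 𝒜 1 b) (n := 0) (by decide)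
  conv_lhs => rw [← pr_zero_add_pr_one 𝒜 a, ← pr_zero_add_pr_one 𝒜 b]
  simp only [add_mul, mul_add, map_add]
  rw [pr_of_mem h01, pr_of_mem h10, pr_one_of_even h00, pr_one_of_even h11]
  abel

end Parity

section TensorParity

variable {k A B : Type*} [Field k] [Ring A] [Algebra k A] [Ring B] [Algebra k B]
  {𝒜 : ZMod 2 → Submodule k A} {ℬ : ZMod 2 → Submodule k B}

theorem tmul_mem_tensorGrading {i j n : ZMod 2} {a : A} {b : B} (ha : a ∈ 𝒜 i) (hb : b ∈ ℬ j)
    (h : i + j = n) : a ⊗ₜ[k] b ∈ tensorGrading 𝒜 ℬ n :=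
  Submodule.mem_iSup_of_mem i <| Submodule.mem_iSup_of_mem j <| Submodule.mem_iSup_of_mem h
    ⟨(⟨a, ha⟩ : 𝒜 i) ⊗ₜ (⟨b, hb⟩ : ℬ j), rfl⟩

theorem tensorGrading_le {n : ZMod 2} {S : Submodule k (A ⊗[k] B)}
    (h : ∀ i j, i + j = n → ∀ a ∈ 𝒜 i, ∀ b ∈ ℬ j, a ⊗ₜ[k] b ∈ S) :
    tensorGrading 𝒜 ℬ n ≤ S := by
  refine iSup_le fun i => iSup_le fun j => iSup_le fun hij => ?_
  rintro _ ⟨y, rfl⟩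
  induction y with
  | zero => simp
  | add x y hx hy => rw [map_add]; exact S.add_mem hx hy
  | tmul a b => exact h i j hij a a.2 b b.2

theorem eq_of_mem_tensorGrading {M : Type*} [AddCommGroup M] [Module k M] {n : ZMod 2}
    {F G : A ⊗[k] B →ₗ[k] M}
    (h : ∀ i j, i + j = n → ∀ a ∈ 𝒜 i, ∀ b ∈ ℬ j, F (a ⊗ₜ[k] b) = G (a ⊗ₜ[k] b))
    {x : A ⊗[k] B} (hx : x ∈ tensorGrading 𝒜 ℬ n) : F x = G x :=
  tensorGrading_le (S := LinearMap.eqLocus F G) h hx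

variable (𝒜 ℬ) [GradedAlgebra 𝒜] [GradedAlgebra ℬ]

/-- The projection of a tensor product of super algebras to its component of parity `n`. -/
def tensorPr (n : ZMod 2) : A ⊗[k] B →ₗ[k] A ⊗[k] B :=
  TensorProduct.map (pr 𝒜 0) (pr ℬ n) + TensorProduct.map (pr 𝒜 1) (pr ℬ (n + 1))

theorem tensorPr_mem (n : ZMod 2) (x : A ⊗[k] B) : tensorPr 𝒜 ℬ n x ∈ tensorGrading 𝒜 ℬ n := by
  induction x with
  | zero => simp
  | add x y hx hy => rw [map_add]; exact add_mem hx hy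
  | tmul a b =>
    refine add_mem (tmul_mem_tensorGrading (pr_mem 𝒜 0 a) (pr_mem ℬ n b) (zero_add n))
      (tmul_mem_tensorGrading (pr_mem 𝒜 1 a) (pr_mem ℬ (n + 1) b) ?_)
    revert n; decide

variable {𝒜 ℬ}

theorem tensorPr_of_mem {n : ZMod 2} {x : A ⊗[k] B} (hx : x ∈ tensorGrading 𝒜 ℬ n) :
    tensorPr 𝒜 ℬ n x = x := by
  refine eq_of_mem_tensorGrading (G := LinearMap.id) (fun i j hij a ha b hb => ?_) hx
  rcases zmod_two_cases i with rfl | rfl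
  · obtain rfl : j = n := by simpa using hij
    simp [tensorPr, pr_of_mem ha, pr_of_mem hb, pr_one_of_even ha, -GradedAlgebra.proj_apply]
  · obtain rfl := (by decide : ∀ j n : ZMod 2, 1 + j = n → j = n + 1) j n hij
    simp [tensorPr, pr_of_mem ha, pr_of_mem hb, pr_zero_of_odd ha, -GradedAlgebra.proj_apply]

theorem tensorPr_of_mem_ne {m n : ZMod 2} {x : A ⊗[k] B} (hx : x ∈ tensorGrading 𝒜 ℬ m)
    (h : m ≠ n) : tensorPr 𝒜 ℬ n x = 0 := by
  refine eq_of_mem_tensorGrading (G := 0) (fun i j hij a ha b hb => ?_) hx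
  rcases zmod_two_cases i with rfl | rfl
  · have := (by decide : ∀ j m n : ZMod 2, 0 + j = m → m ≠ n → j ≠ n) j m n hij h
    simp [tensorPr, pr_of_mem_ne hb this, pr_one_of_even ha, -GradedAlgebra.proj_apply]
  · have := (by decide : ∀ j m n : ZMod 2, 1 + j = m → m ≠ n → j ≠ n + 1) j m n hij h
    simp [tensorPr, pr_of_mem_ne hb this, pr_zero_of_odd ha, -GradedAlgebra.proj_apply]

end TensorParity

section SuperCommutative

variable {k A : Type*} [Field k] [Ring A] [Algebra k A] {𝒜 : ZMod 2 → Submodule k A}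
  [IsSuperCommutative k 𝒜]

theorem even_mul_comm {a : A} (ha : a ∈ 𝒜 0) (b : A) : a * b = b * a :=
  IsSuperCommutative.even_comm (k := k) (𝒜 := 𝒜) a ha b

theorem odd_mul_comm {a b : A} (ha : a ∈ 𝒜 1) (hb : b ∈ 𝒜 1) : a * b = -(b * a) :=
  IsSuperCommutative.odd_anticomm (k := k) (𝒜 := 𝒜) a ha b hb

theorem super_mul_comm {i j : ZMod 2} {a b : A} (ha : a ∈ 𝒜 i) (hb : b ∈ 𝒜 j) :
    a * b = (-1 : ℤˣ) ^ (j * i) • (b * a) := by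
  rcases zmod_two_cases i with rfl | rfl
  · simpa using even_mul_comm ha b
  · rcases zmod_two_cases j with rfl | rfl
    · simpa using (even_mul_comm hb a).symm
    · simpa using odd_mul_comm ha hb

theorem odd_sq_zero (hk : ringChar k ≠ 2) {a : A} (ha : a ∈ 𝒜 1) : a * a = 0 := by
  have h2 : (2 : k) ≠ 0 := Ring.two_ne_zero hk
  have h := odd_mul_comm ha ha
  have h' : (2 : k) • (a * a) = 0 := by
    rw [two_smul]; nth_rewrite 1 [h]; exact neg_add_cancel _
  exact (smul_eq_zero.1 h').resolve_left h2

end SuperCommutative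

section Exterior

variable {k U : Type*} [Field k] [AddCommGroup U] [Module k U]

theorem ι_mul_eq_involute_mul (m : U) (y : CliffordAlgebra (0 : QuadraticForm k U)) :
    CliffordAlgebra.ι (0 : QuadraticForm k U) m * y =
      CliffordAlgebra.involute y * CliffordAlgebra.ι (0 : QuadraticForm k U) m := by
  induction y using CliffordAlgebra.induction with
  | algebraMap r => rw [AlgHom.commutes, Algebra.commutes]
  | ι x =>
    have := ExteriorAlgebra.ι_add_mul_swap (R := k) m x
    rw [CliffordAlgebra.involute_ι, neg_mul]
    exact eq_neg_of_add_eq_zero_left this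
  | mul a b ha hb => rw [← mul_assoc, ha, mul_assoc, hb, map_mul, mul_assoc]
  | add a b ha hb => rw [mul_add, ha, hb, map_add, add_mul]

theorem exterior_even_mul {x : CliffordAlgebra (0 : QuadraticForm k U)}
    (hx : x ∈ CliffordAlgebra.evenOdd (0 : QuadraticForm k U) 0)
    (y : CliffordAlgebra (0 : QuadraticForm k U)) : x * y = y * x := by
  induction x, hx using CliffordAlgebra.even_induction with
  | algebraMap r => exact Algebra.commutes r y
  | add a b _ _ ha hb => rw [add_mul, mul_add, ha, hb]
  | ι_mul_ι_mul m n x _ h =>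
    rw [mul_assoc, h, ← mul_assoc, mul_assoc _ _ y, ι_mul_eq_involute_mul n y, ← mul_assoc,
      ι_mul_eq_involute_mul m (CliffordAlgebra.involute y), CliffordAlgebra.involute_involute]
    simp only [mul_assoc]

theorem exterior_odd_mul {x : CliffordAlgebra (0 : QuadraticForm k U)}
    (hx : x ∈ CliffordAlgebra.evenOdd (0 : QuadraticForm k U) 1)
    (y : CliffordAlgebra (0 : QuadraticForm k U)) : x * y = CliffordAlgebra.involute y * x := by
  induction x, hx using CliffordAlgebra.odd_induction with
  | ι m => exact ι_mul_eq_involute_mul m y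
  | add a b _ _ ha hb => rw [add_mul, mul_add, ha, hb]
  | ι_mul_ι_mul m n x _ h =>
    rw [mul_assoc, h, ← mul_assoc,
      exterior_even_mul (CliffordAlgebra.ι_mul_ι_mem_evenOdd_zero _ m n), mul_assoc]

instance exterior_isSuperCommutative :
    IsSuperCommutative k (CliffordAlgebra.evenOdd (0 : QuadraticForm k U)) where
  even_comm _ ha b := exterior_even_mul ha b
  odd_anticomm a ha b hb := by
    rw [exterior_odd_mul ha, CliffordAlgebra.involute_eq_of_mem_odd hb, neg_mul]

end Exterior

section Comul

variable {k A : Type*} [Field k] [Ring A] [Algebra k A] [Coalgebra k A]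
  (𝒜 : ZMod 2 → Submodule k A) [GradedAlgebra 𝒜]

local notation "Δ" => Coalgebra.comul (R := k) (A := A)
local notation "ε" => Coalgebra.counit (R := k) (A := A)

/-- The projection `A → A₁ → W^A`. -/
def oddClass : A →ₗ[k] OddCotangent 𝒜 :=
  (augmentationMulOdd 𝒜).mkQ ∘ₗ (pr 𝒜 1).codRestrict (𝒜 1) (pr_mem 𝒜 1)

theorem oddClass_surjective (w : OddCotangent 𝒜) : ∃ a ∈ 𝒜 1, oddClass 𝒜 a = w := by
  obtain ⟨⟨a, ha⟩, rfl⟩ := Submodule.mkQ_surjective _ w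
  refine ⟨a, ha, ?_⟩
  exact congrArg (augmentationMulOdd 𝒜).mkQ (Subtype.ext (pr_of_mem ha))

theorem oddClass_of_even {a : A} (ha : a ∈ 𝒜 0) : oddClass 𝒜 a = 0 := by
  have : (pr 𝒜 1).codRestrict (𝒜 1) (pr_mem 𝒜 1) a = 0 := Subtype.ext (pr_one_of_even ha)
  rw [oddClass, LinearMap.comp_apply, this, map_zero]

theorem oddClass_pr_one (a : A) : oddClass 𝒜 (pr 𝒜 1 a) = oddClass 𝒜 a := by
  conv_rhs => rw [← pr_zero_add_pr_one 𝒜 a, map_add, oddClass_of_even 𝒜 (pr_mem 𝒜 0 a), zero_add]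

theorem oddClass_eq_zero_iff {a : A} (ha : a ∈ 𝒜 1) :
    oddClass 𝒜 a = 0 ↔ a ∈ (𝒜 0 ⊓ LinearMap.ker ε) * 𝒜 1 := by
  have : (pr 𝒜 1).codRestrict (𝒜 1) (pr_mem 𝒜 1) a = ⟨a, ha⟩ := Subtype.ext (pr_of_mem ha)
  rw [oddClass, LinearMap.comp_apply, this, Submodule.mkQ_apply, Submodule.Quotient.mk_eq_zero]
  rfl

variable [SuperHopfAlgebra k 𝒜]

theorem comul_mem {n : ZMod 2} {a : A} (ha : a ∈ 𝒜 n) : Δ a ∈ tensorGrading 𝒜 𝒜 n :=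
  SuperHopfAlgebra.comul_mem n a ha

theorem counit_of_odd {a : A} (ha : a ∈ 𝒜 1) : ε a = 0 :=
  SuperHopfAlgebra.counit_odd (𝒜 := 𝒜) a ha

theorem counit_pr_zero (a : A) : ε (pr 𝒜 0 a) = ε a := by
  conv_rhs => rw [← pr_zero_add_pr_one 𝒜 a]
  rw [map_add, counit_of_odd 𝒜 (pr_mem 𝒜 1 a), add_zero]

theorem comul_pr (n : ZMod 2) (a : A) : Δ (pr 𝒜 n a) = tensorPr 𝒜 𝒜 n (Δ a) := by
  conv_rhs => rw [← pr_zero_add_pr_one 𝒜 a, map_add, map_add]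
  have h0 := comul_mem 𝒜 (pr_mem 𝒜 0 a)
  have h1 := comul_mem 𝒜 (pr_mem 𝒜 1 a)
  rcases zmod_two_cases n with rfl | rfl
  · rw [tensorPr_of_mem h0, tensorPr_of_mem_ne h1 (by decide), add_zero]
  · rw [tensorPr_of_mem h1, tensorPr_of_mem_ne h0 (by decide), zero_add]

theorem oddClass_even_mul {a b : A} (ha : a ∈ 𝒜 0) (hb : b ∈ 𝒜 1) :
    oddClass 𝒜 (a * b) = ε a • oddClass 𝒜 b := by
  have h1 : algebraMap k A (ε a) ∈ 𝒜 0 := SetLike.algebraMap_mem_graded 𝒜 _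
  have h : (a - algebraMap k A (ε a)) * b ∈ (𝒜 0 ⊓ LinearMap.ker ε) * 𝒜 1 := by
    refine Submodule.mul_mem_mul ⟨sub_mem ha h1, ?_⟩ hb
    rw [SetLike.mem_coe, LinearMap.mem_ker, map_sub, Algebra.algebraMap_eq_smul_one, map_smul,
      SuperHopfAlgebra.counit_one 𝒜, smul_eq_mul, mul_one, sub_self]
  have h2 : (a - algebraMap k A (ε a)) * b ∈ 𝒜 1 :=
    mul_mem_of_eq (sub_mem ha h1) hb (by decide)
  have h3 := (oddClass_eq_zero_iff 𝒜 h2).2 h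
  rw [sub_mul, map_sub, sub_eq_zero] at h3
  rw [h3, ← Algebra.smul_def, map_smul]

/-- `A → W^A` is a derivation with respect to the counit. -/
theorem oddClass_mul [IsSuperCommutative k 𝒜] (a b : A) :
    oddClass 𝒜 (a * b) = ε a • oddClass 𝒜 b + ε b • oddClass 𝒜 a := by
  rw [← oddClass_pr_one, pr_one_mul, map_add, ← even_mul_comm (pr_mem 𝒜 0 b),
    oddClass_even_mul 𝒜 (pr_mem 𝒜 0 a) (pr_mem 𝒜 1 b),
    oddClass_even_mul 𝒜 (pr_mem 𝒜 0 b) (pr_mem 𝒜 1 a)]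
  simp only [counit_pr_zero, oddClass_pr_one]

end Comul

/-! ### The antipode -/

section Signs

variable {k A : Type*} [Field k] [Ring A] [Algebra k A] (𝒜 : ZMod 2 → Submodule k A)
  [GradedAlgebra 𝒜]

/-- The parity automorphism of a super algebra. -/
def parityHom : A →ₐ[k] A :=
  AlgHom.ofLinearMap (pr 𝒜 0 - pr 𝒜 1)
    (by
      have h : (1 : A) ∈ 𝒜 0 := SetLike.one_mem_graded 𝒜
      rw [LinearMap.sub_apply, pr_of_mem h, pr_one_of_even h, sub_zero])
    (fun a b => by
      simp only [LinearMap.sub_apply, pr_zero_mul, pr_one_mul]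
      noncomm_ring)

/-- The automorphism which multiplies `a ∈ 𝒜 i` by the sign `(-1) ^ (i * j)`. -/
def signHom (j : ZMod 2) : A →ₐ[k] A := if j = 0 then AlgHom.id k A else parityHom 𝒜

theorem signHom_of_mem {i : ZMod 2} (j : ZMod 2) {a : A} (ha : a ∈ 𝒜 i) :
    signHom 𝒜 j a = (-1 : ℤˣ) ^ (i * j) • a := by
  rcases zmod_two_cases j with rfl | rfl
  · simp [signHom]
  · have : signHom 𝒜 1 a = pr 𝒜 0 a - pr 𝒜 1 a := rfl
    rw [this]
    rcases zmod_two_cases i with rfl | rfl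
    · rw [pr_of_mem ha, pr_one_of_even ha]; simp
    · rw [pr_of_mem ha, pr_zero_of_odd ha]; simp

end Signs

section Antipode

open WithConv

variable {k A : Type*} [Field k] [Ring A] [Algebra k A] [Coalgebra k A]
  (𝒜 : ZMod 2 → Submodule k A) [GradedAlgebra 𝒜] [SuperHopfAlgebra k 𝒜]

/-- The antipode of a super Hopf algebra. -/
abbrev anti : A →ₗ[k] A := SuperHopfAlgebra.antipode 𝒜

theorem anti_conv_id :
    toConv (anti 𝒜) * toConv (LinearMap.id : A →ₗ[k] A) = 1 :=
  congrArg toConv (SuperHopfAlgebra.mul_antipode_rTensor_comul (k := k) (𝒜 := 𝒜))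

theorem id_conv_anti :
    toConv (LinearMap.id : A →ₗ[k] A) * toConv (anti 𝒜) = 1 :=
  congrArg toConv (SuperHopfAlgebra.mul_antipode_lTensor_comul (k := k) (𝒜 := 𝒜))

theorem algHom_comp_conv {C : Type*} [Ring C] [Algebra k C] (h : A →ₐ[k] C) (f g : A →ₗ[k] A) :
    toConv (h.toLinearMap ∘ₗ f) * toConv (h.toLinearMap ∘ₗ g) =
      toConv (h.toLinearMap ∘ₗ (toConv f * toConv g).ofConv) := by
  rw [LinearMap.algHom_comp_convMul_distrib]

theorem algHom_comp_one {C : Type*} [Ring C] [Algebra k C] (h : A →ₐ[k] C) :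
    toConv (h.toLinearMap ∘ₗ (1 : WithConv (A →ₗ[k] A)).ofConv) = 1 := by
  ext a
  change h (algebraMap k A _) = algebraMap k C _
  rw [h.commutes]

theorem algHom_conv_anti {C : Type*} [Ring C] [Algebra k C] (h : A →ₐ[k] C) :
    toConv h.toLinearMap * toConv (h.toLinearMap ∘ₗ anti 𝒜) = 1 := by
  have := algHom_comp_conv h LinearMap.id (anti 𝒜)
  rwa [id_conv_anti, algHom_comp_one, LinearMap.comp_id] at this

theorem anti_conv_algHom {C : Type*} [Ring C] [Algebra k C] (h : A →ₐ[k] C) :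
    toConv (h.toLinearMap ∘ₗ anti 𝒜) * toConv h.toLinearMap = 1 := by
  have := algHom_comp_conv h (anti 𝒜) LinearMap.id
  rwa [anti_conv_id, algHom_comp_one, LinearMap.comp_id] at this

/-- The linear map `x ⊗ y ↦ S (a x) y`. -/
def antiMul (a : A) : A ⊗[k] A →ₗ[k] A :=
  LinearMap.mul' k A ∘ₗ (anti 𝒜 ∘ₗ LinearMap.mulLeft k a).rTensor A

/-- The linear map `a ↦ ∑ S (a x) y` for a tensor `∑ x ⊗ y`. -/
def antiMulRight (z : A ⊗[k] A) : A →ₗ[k] A where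
  toFun a := antiMul 𝒜 a z
  map_add' a b := by
    induction z with
    | zero => simp
    | add x y hx hy => simp only [map_add, hx, hy]; abel
    | tmul x y => simp [antiMul, add_mul]
  map_smul' r a := by
    induction z with
    | zero => simp
    | add x y hx hy => simp only [map_add, hx, hy, smul_add]
    | tmul x y => simp [antiMul]

theorem anti_one : anti 𝒜 1 = 1 := by
  have h := LinearMap.congr_fun
        (SuperHopfAlgebra.mul_antipode_rTensor_comul (k := k) (𝒜 := 𝒜)) 1
  have h1 : Coalgebra.comul (R := k) (1 : A) = 1 ⊗ₜ[k] 1 := SuperHopfAlgebra.comul_one (𝒜 := 𝒜)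
  simpa [h1, SuperHopfAlgebra.counit_one 𝒜] using h

/-- The antipode reverses the coproduct: in `A ⊗ A`, the element `Δ (S a)` is
`∑ (1 ⊗ S a₁) (S a₂ ⊗ 1)`. -/
theorem comul_anti (a : A) :
    GradedTensorProduct.of k 𝒜 𝒜 (Coalgebra.comul (R := k) (anti 𝒜 a)) =
      LinearMap.mul' k _ (TensorProduct.map
        ((GradedTensorProduct.includeRight 𝒜 𝒜).toLinearMap ∘ₗ anti 𝒜)
        ((GradedTensorProduct.includeLeft 𝒜 𝒜).toLinearMap ∘ₗ anti 𝒜)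
        (Coalgebra.comul (R := k) a)) := by
  set i₁ := GradedTensorProduct.includeLeft (R := k) 𝒜 𝒜
  set i₂ := GradedTensorProduct.includeRight (R := k) 𝒜 𝒜
  have h0 : toConv (comulHom 𝒜).toLinearMap = toConv i₁.toLinearMap * toConv i₂.toLinearMap := by
    ext a
    change GradedTensorProduct.of k 𝒜 𝒜 (Coalgebra.comul (R := k) a) =
      LinearMap.mul' k _ (TensorProduct.map _ _ (Coalgebra.comul (R := k) a))
    generalize Coalgebra.comul (R := k) a = w
    induction w with
    | zero => simp
    | add x y hx hy => simp only [map_add, hx, hy]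
    | tmul x y => exact (GradedTensorProduct.tmul_one_mul_one_tmul 𝒜 𝒜 x y).symm
  have h1 := anti_conv_algHom 𝒜 (comulHom 𝒜)
  have h2 : toConv (comulHom 𝒜).toLinearMap *
      (toConv (i₂.toLinearMap ∘ₗ anti 𝒜) * toConv (i₁.toLinearMap ∘ₗ anti 𝒜)) = 1 := by
    rw [h0, mul_assoc, ← mul_assoc (toConv i₂.toLinearMap), algHom_conv_anti, one_mul,
      algHom_conv_anti]
  have h3 := left_inv_eq_right_inv h1 h2
  exact LinearMap.congr_fun (congrArg ofConv h3) a

variable [IsSuperCommutative k 𝒜]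

/-- For a tensor `z` of parity `j`, the convolution of `a ↦ ∑ S (a x) y` with the sign automorphism
sends `w` to the value of `∑ S(x) y` at the graded product `w z`: the sign automorphism accounts
for the sign in that product. -/
theorem antiMulRight_conv {j : ZMod 2} {z : A ⊗[k] A} (hz : z ∈ tensorGrading 𝒜 𝒜 j)
    (w : A ⊗[k] A) :
    LinearMap.mul' k A (TensorProduct.map (antiMulRight 𝒜 z) (signHom 𝒜 j).toLinearMap w) =
      LinearMap.mul' k A ((anti 𝒜).rTensor A ((GradedTensorProduct.of k 𝒜 𝒜).symm
        (GradedTensorProduct.of k 𝒜 𝒜 w * GradedTensorProduct.of k 𝒜 𝒜 z))) := by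
  induction w with
  | zero => simp
  | add x y hx hy => rw [map_add, map_add, hx, hy]; simp [add_mul]
  | tmul a b =>
    have hb : ∀ i : ZMod 2, ∀ b ∈ 𝒜 i,
        LinearMap.mul' k A (TensorProduct.map (antiMulRight 𝒜 z) (signHom 𝒜 j).toLinearMap
          (a ⊗ₜ b)) =
        LinearMap.mul' k A ((anti 𝒜).rTensor A ((GradedTensorProduct.of k 𝒜 𝒜).symm
        (GradedTensorProduct.of k 𝒜 𝒜 (a ⊗ₜ b) * GradedTensorProduct.of k 𝒜 𝒜 z))) := by
      intro i b hb
      refine eq_of_mem_tensorGrading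
        (F := (LinearMap.mulRight k (signHom 𝒜 j b)) ∘ₗ antiMul 𝒜 a)
        (G := LinearMap.mul' k A ∘ₗ (anti 𝒜).rTensor A ∘ₗ
          (GradedTensorProduct.of k 𝒜 𝒜).symm.toLinearMap ∘ₗ
          (LinearMap.mulLeft k (GradedTensorProduct.of k 𝒜 𝒜 (a ⊗ₜ[k] b))) ∘ₗ
          (GradedTensorProduct.of k 𝒜 𝒜).toLinearMap) ?_ hz
      intro p q hpq x hx y hy
      have key := GradedTensorProduct.tmul_coe_mul_coe_tmul 𝒜 𝒜 a ⟨b, hb⟩ ⟨x, hx⟩ y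
      simp only [LinearMap.comp_apply, LinearEquiv.coe_coe, LinearMap.mulLeft_apply,
        LinearMap.mulRight_apply]
      erw [key]
      have e1 : antiMul 𝒜 a (x ⊗ₜ y) = anti 𝒜 (a * x) * y := rfl
      rw [e1, signHom_of_mem 𝒜 j hb, mul_assoc, mul_smul_comm, super_mul_comm hy hb]
      rw [smul_smul, ← hpq]
      have e2 : ((-1 : ℤˣ) ^ (i * (p + q)) * (-1 : ℤˣ) ^ (i * q)) = (-1 : ℤˣ) ^ (i * p) := by
        rw [mul_add, uzpow_add, mul_assoc, Int.units_mul_self, mul_one]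
      rw [e2]
      simp only [Units.smul_def, map_zsmul, mul_smul_comm]
      rfl
    rw [← pr_zero_add_pr_one 𝒜 b, TensorProduct.tmul_add]
    simp only [map_add, add_mul]
    rw [hb 0 _ (pr_mem 𝒜 0 b), hb 1 _ (pr_mem 𝒜 1 b)]

/-- The identity `∑ S (a b₁) b₂ = ε(b) S(a)`: by `antiMulRight_conv`, the convolution of the
left-hand side with the sign automorphism is `ε(b) ε`. For odd `b` both sides vanish. -/
theorem antiMulRight_comul (b : A) :
    antiMulRight 𝒜 (Coalgebra.comul (R := k) b) = Coalgebra.counit (R := k) b • anti 𝒜 := by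
  have h : ∀ j, ∀ b ∈ 𝒜 j, antiMulRight 𝒜 (Coalgebra.comul (R := k) b) =
      Coalgebra.counit (R := k) b • anti 𝒜 := by
    intro j b hb
    have h1 : toConv (antiMulRight 𝒜 (Coalgebra.comul (R := k) b)) *
        toConv (signHom 𝒜 j).toLinearMap =
        Coalgebra.counit (R := k) b • (1 : WithConv (A →ₗ[k] A)) := by
      ext a
      refine (antiMulRight_conv 𝒜 (comul_mem 𝒜 hb) (Coalgebra.comul (R := k) a)).trans ?_
      rw [← SuperHopfAlgebra.comul_mul]
      refine (LinearMap.congr_fun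
        (SuperHopfAlgebra.mul_antipode_rTensor_comul (k := k) (𝒜 := 𝒜)) (a * b)).trans ?_
      change algebraMap k A (Coalgebra.counit (R := k) (a * b)) =
        Coalgebra.counit (R := k) b • algebraMap k A (Coalgebra.counit (R := k) a)
      rw [SuperHopfAlgebra.counit_mul 𝒜, mul_comm, map_mul, ← Algebra.smul_def]
    have h2 := congrArg (· * toConv ((signHom 𝒜 j).toLinearMap ∘ₗ anti 𝒜)) h1
    simp only [mul_assoc, algHom_conv_anti, mul_one, smul_mul_assoc, one_mul] at h2
    rcases zmod_two_cases j with rfl | rfl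
    · exact congrArg ofConv h2
    · rw [counit_of_odd 𝒜 hb, zero_smul] at h2 ⊢
      exact congrArg ofConv h2
  have e : ∀ x y, antiMulRight 𝒜 (x + y) = antiMulRight 𝒜 x + antiMulRight 𝒜 y := by
    intro x y; ext a; exact map_add (antiMul 𝒜 a) x y
  rw [← pr_zero_add_pr_one 𝒜 b, map_add, map_add, e, h 0 _ (pr_mem 𝒜 0 b),
    h 1 _ (pr_mem 𝒜 1 b), add_smul]

/-- The antipode of a super commutative Hopf algebra is multiplicative. -/
theorem anti_mul (a b : A) : anti 𝒜 (a * b) = anti 𝒜 a * anti 𝒜 b := by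
  -- `b ↦ S (a b)` and `b ↦ S a * S b` have the same convolution with the identity
  have h1 : toConv (anti 𝒜 ∘ₗ LinearMap.mulLeft k a) * toConv (LinearMap.id : A →ₗ[k] A) =
      toConv (LinearMap.mulLeft k (anti 𝒜 a) ∘ₗ anti 𝒜) * toConv LinearMap.id := by
    ext b
    have h2 : ∀ w : A ⊗[k] A, LinearMap.mul' k A (TensorProduct.map
        (LinearMap.mulLeft k (anti 𝒜 a) ∘ₗ anti 𝒜) LinearMap.id w) =
        anti 𝒜 a * LinearMap.mul' k A ((anti 𝒜).rTensor A w) := by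
      intro w
      induction w with
      | zero => simp
      | add x y hx hy => simp only [map_add, hx, hy, mul_add]
      | tmul x y => simp [mul_assoc]
    refine (LinearMap.congr_fun (antiMulRight_comul 𝒜 b) a).trans ?_
    refine Eq.trans ?_ (h2 _).symm
    have h3 := LinearMap.congr_fun
        (SuperHopfAlgebra.mul_antipode_rTensor_comul (k := k) (𝒜 := 𝒜)) b
    simp only [LinearMap.comp_apply] at h3
    erw [h3]
    rw [LinearMap.smul_apply, Algebra.linearMap_apply, ← Algebra.commutes, ← Algebra.smul_def]
  have h2 := congrArg (· * toConv (anti 𝒜)) h1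
  simp only [mul_assoc, id_conv_anti, mul_one] at h2
  exact LinearMap.congr_fun (congrArg ofConv h2) b

/-- The antipode as an algebra map. -/
def antiHom : A →ₐ[k] A := AlgHom.ofLinearMap (anti 𝒜) (anti_one 𝒜) (anti_mul 𝒜)

/-- The antipode is an involution: being an algebra map, it has `S ∘ S` as a convolution inverse, as
well as the identity. -/
theorem anti_anti (a : A) : anti 𝒜 (anti 𝒜 a) = a := by
  have h := anti_conv_algHom 𝒜 (antiHom 𝒜)
  have h2 := congrArg (· * toConv (LinearMap.id : A →ₗ[k] A)) h
  simp only [mul_assoc, one_mul] at h2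
  rw [show toConv (antiHom 𝒜).toLinearMap = toConv (anti 𝒜) from rfl, anti_conv_id, mul_one] at h2
  exact LinearMap.congr_fun (congrArg ofConv h2) a

end Antipode

/-! ### Finite-dimensional subcoalgebras -/

section Subcoalgebra

variable {k C : Type*} [Field k] [AddCommGroup C] [Module k C]

theorem mem_range_mapIncl_of_sum {M N : Submodule k C} {ι : Type*} (s : Finset ι) (f g : ι → C)
    (hf : ∀ i ∈ s, f i ∈ M) (hg : ∀ i ∈ s, g i ∈ N) :
    ∑ i ∈ s, f i ⊗ₜ[k] g i ∈ LinearMap.range (TensorProduct.mapIncl M N) :=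
  Submodule.sum_mem _ fun i hi => ⟨⟨f i, hf i hi⟩ ⊗ₜ ⟨g i, hg i hi⟩, rfl⟩

theorem mapIncl_mono {M N M' N' : Submodule k C} (h : M ≤ M') (h' : N ≤ N') :
    LinearMap.range (TensorProduct.mapIncl M N) ≤
      LinearMap.range (TensorProduct.mapIncl M' N') := by
  rintro _ ⟨z, rfl⟩
  induction z with
  | zero => simp
  | add x y hx hy => rw [map_add]; exact add_mem hx hy
  | tmul x y => exact ⟨⟨x, h x.2⟩ ⊗ₜ ⟨y, h' y.2⟩, rfl⟩

theorem range_mapIncl_le {M N : Submodule k C} {S : Submodule k (C ⊗[k] C)}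
    (h : ∀ x ∈ M, ∀ y ∈ N, x ⊗ₜ[k] y ∈ S) : LinearMap.range (TensorProduct.mapIncl M N) ≤ S := by
  rintro _ ⟨z, rfl⟩
  induction z with
  | zero => simp
  | add x y hx hy => rw [map_add]; exact add_mem hx hy
  | tmul x y => exact h x x.2 y y.2

theorem tmul_mem_range_mapIncl {M N : Submodule k C} {x y : C} (hx : x ∈ M) (hy : y ∈ N) :
    x ⊗ₜ[k] y ∈ LinearMap.range (TensorProduct.mapIncl M N) := ⟨⟨x, hx⟩ ⊗ₜ ⟨y, hy⟩, rfl⟩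

variable [Coalgebra k C]

/-- A subspace `V` with `Δ V ⊆ V ⊗ V`. -/
def IsSubcoalgebra (V : Submodule k C) : Prop :=
  ∀ v ∈ V, Coalgebra.comul (R := k) v ∈ LinearMap.range (TensorProduct.mapIncl V V)

theorem IsSubcoalgebra.iSup {ι : Sort*} {V : ι → Submodule k C} (h : ∀ i, IsSubcoalgebra (V i)) :
    IsSubcoalgebra (⨆ i, V i) := by
  have : ⨆ i, V i ≤ (LinearMap.range (TensorProduct.mapIncl (⨆ i, V i) (⨆ i, V i))).comap
      (Coalgebra.comul (R := k)) :=
    iSup_le fun i v hv => mapIncl_mono (le_iSup V i) (le_iSup V i) (h i v hv)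
  exact fun v hv => this hv

theorem isSubcoalgebra_top : IsSubcoalgebra (⊤ : Submodule k C) := fun v _ => by
  have : LinearMap.range (TensorProduct.mapIncl (⊤ : Submodule k C) (⊤ : Submodule k C)) = ⊤ :=
    LinearMap.range_eq_top.2 (TensorProduct.map_surjective
      (fun x => ⟨⟨x, trivial⟩, rfl⟩) (fun x => ⟨⟨x, trivial⟩, rfl⟩))
  rw [this]; trivial

/-- A finite-dimensional right subcomodule of `C` which contains a given element. -/
theorem exists_subcomodule (c : C) : ∃ M : Submodule k C, FiniteDimensional k M ∧ c ∈ M ∧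
    ∀ m ∈ M, Coalgebra.comul (R := k) m ∈ LinearMap.range (TensorProduct.mapIncl M ⊤) := by
  classical
  -- the subcomodule consists of the slices `∑ f(c₂) c₁`
  let slice : Module.Dual k C →ₗ[k] C ⊗[k] C →ₗ[k] C :=
    (TensorProduct.rid k C).toLinearMap.compRight k ∘ₗ LinearMap.lTensorHom C
  have hslice : ∀ f x y, slice f (x ⊗ₜ y) = f y • x := fun f x y => by simp [slice]
  let M : Submodule k C := LinearMap.range (slice.flip (Coalgebra.comul (R := k) c))
  have hM : ∀ f, slice f (Coalgebra.comul (R := k) c) ∈ M := fun f => ⟨f, rfl⟩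
  have hfin : FiniteDimensional k M := by
    have : ∀ z : C ⊗[k] C, FiniteDimensional k (LinearMap.range (slice.flip z)) := by
      intro z
      induction z with
      | zero => rw [map_zero, LinearMap.range_zero]; infer_instance
      | add x y hx hy =>
        rw [map_add]
        exact Submodule.finiteDimensional_of_le (LinearMap.range_add_le _ _)
      | tmul x y =>
        refine Submodule.finiteDimensional_of_le (S₂ := Submodule.span k {x}) ?_
        rintro _ ⟨f, rfl⟩
        rw [LinearMap.flip_apply, hslice]
        exact Submodule.smul_mem _ _ (Submodule.mem_span_singleton_self x)
    exact this _
  let b := Module.Basis.ofVectorSpace k C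
  obtain ⟨t, ht⟩ := TensorProduct.eq_repr_basis_right b (Coalgebra.comul (R := k) c)
  have ht' : ∀ i, slice (b.coord i) (Coalgebra.comul (R := k) c) = t i := by
    intro i
    rw [← ht, Finsupp.sum, map_sum]
    simp only [hslice, Module.Basis.coord_apply, Module.Basis.repr_self, Finsupp.single_apply]
    simp [eq_comm]
  refine ⟨M, hfin, ?_, ?_⟩
  · have h := hM (Coalgebra.counit (R := k))
    have h2 : slice (Coalgebra.counit (R := k)) (Coalgebra.comul (R := k) c) = c := by
      have e := congrArg (TensorProduct.rid k C) (Coalgebra.lTensor_counit_comul (R := k) c)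
      rw [TensorProduct.rid_tmul, one_smul] at e
      exact e
    rwa [h2] at h
  · rintro _ ⟨f, rfl⟩
    let h : C →ₗ[k] C := slice f ∘ₗ Coalgebra.comul
    have key : Coalgebra.comul (R := k) (slice f (Coalgebra.comul (R := k) c)) =
        h.lTensor C (Coalgebra.comul (R := k) c) := by
      have e : ∀ z : C ⊗[k] C, Coalgebra.comul (R := k) (slice f z) =
          (slice f).lTensor C (TensorProduct.assoc k C C C
            ((Coalgebra.comul (R := k)).rTensor C z)) := by
        intro z
        induction z with
        | zero => simp
        | add x y hx hy => simp only [map_add, hx, hy]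
        | tmul x y =>
          rw [hslice, map_smul, LinearMap.rTensor_tmul]
          generalize Coalgebra.comul (R := k) x = w
          induction w with
          | zero => simp
          | add u v hu hv => simp only [TensorProduct.add_tmul, map_add, smul_add, hu, hv]
          | tmul u v => simp [hslice]
      rw [e, Coalgebra.coassoc_apply, ← LinearMap.comp_apply, ← LinearMap.lTensor_comp]
    rw [LinearMap.flip_apply, key, ← ht, Finsupp.sum, map_sum]
    refine mem_range_mapIncl_of_sum t.support t (fun i => h (b i)) (fun i _ => ?_)
      fun _ _ => trivial
    rw [← ht']
    exact hM _

/-- Every element of a coalgebra lies in a finite-dimensional subcoalgebra. -/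
theorem exists_finiteDimensional_subcoalgebra (c : C) :
    ∃ V : Submodule k C, FiniteDimensional k V ∧ c ∈ V ∧ IsSubcoalgebra V := by
  classical
  obtain ⟨M, hfin, hc, hM⟩ := exists_subcomodule (k := k) c
  let b := Module.finBasis k M
  -- the subcoalgebra is spanned by the matrix coefficients `t j i` of a subcomodule
  have h1 : ∀ j, ∃ t : Fin (Module.finrank k M) → C,
      Coalgebra.comul (R := k) (b j : C) = ∑ i, (b i : C) ⊗ₜ[k] t i := by
    intro j
    obtain ⟨z, hz⟩ := hM (b j) (b j).2
    obtain ⟨t, rfl⟩ := TensorProduct.eq_repr_basis_left b z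
    refine ⟨fun i => (t i : C), ?_⟩
    rw [← hz, Finsupp.sum_fintype _ _ (by simp), map_sum]
    rfl
  choose t ht using h1
  -- functionals on `C` which extend the dual basis
  have hext : ∀ l, ∃ μ : C →ₗ[k] k, ∀ i, μ (b i) = if i = l then 1 else 0 := by
    intro l
    obtain ⟨μ, hμ⟩ := LinearMap.exists_extend (b.coord l)
    refine ⟨μ, fun i => ?_⟩
    have := LinearMap.congr_fun hμ (b i)
    simpa [Finsupp.single_apply] using this
  choose μ hμ using hext
  have hcoef : ∀ j l, Coalgebra.comul (R := k) (t j l) = ∑ i, t i l ⊗ₜ[k] t j i := by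
    intro j l
    have e := Coalgebra.coassoc_apply (R := k) (b j : C)
    rw [ht] at e
    simp only [map_sum, LinearMap.rTensor_tmul, LinearMap.lTensor_tmul, ht,
      TensorProduct.sum_tmul, TensorProduct.assoc_tmul] at e
    have e2 := congrArg (TensorProduct.lid k _ ∘ (μ l).rTensor (C ⊗[k] C)) e
    simpa [hμ] using e2.symm
  refine ⟨Submodule.span k (Set.range fun p : _ × _ => t p.1 p.2),
    FiniteDimensional.span_of_finite k (Set.finite_range _), ?_, ?_⟩
  · have hb : ∀ j, (b j : C) ∈ Submodule.span k (Set.range fun p : _ × _ => t p.1 p.2) := by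
      intro j
      have e := congrArg (TensorProduct.lid k C) (Coalgebra.rTensor_counit_comul (R := k) (b j : C))
      rw [ht] at e
      simp only [map_sum, LinearMap.rTensor_tmul, TensorProduct.lid_tmul, one_smul] at e
      rw [← e]
      exact Submodule.sum_mem _ fun i _ =>
        Submodule.smul_mem _ _ (Submodule.subset_span ⟨(j, i), rfl⟩)
    have e := congrArg Subtype.val (b.sum_repr ⟨c, hc⟩)
    rw [← show _ = c from e]
    push_cast
    exact Submodule.sum_mem _ fun i _ => Submodule.smul_mem _ _ (hb i)
  · intro v hv
    induction hv using Submodule.span_induction with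
    | zero => simp
    | add x y _ _ hx hy => rw [map_add]; exact add_mem hx hy
    | smul r x _ hx => rw [map_smul]; exact Submodule.smul_mem _ _ hx
    | mem x hx =>
      obtain ⟨⟨j, l⟩, rfl⟩ := hx
      rw [hcoef]
      exact mem_range_mapIncl_of_sum _ _ _ (fun i _ => Submodule.subset_span ⟨(i, l), rfl⟩)
        fun i _ => Submodule.subset_span ⟨(j, i), rfl⟩

end Subcoalgebra

/-! ### Filtrations by powers of a subspace -/

section PowGE

variable {k R : Type*} [Field k] [Ring R] [Algebra k R]

/-- The sum of the powers `q ^ m` with `m ≥ n`. -/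
def powGE (q : Submodule k R) (n : ℕ) : Submodule k R := ⨆ m, q ^ (n + m)

theorem pow_le_powGE (q : Submodule k R) {n m : ℕ} (h : n ≤ m) : q ^ m ≤ powGE q n := by
  obtain ⟨r, rfl⟩ := Nat.exists_eq_add_of_le h
  exact le_iSup (fun m => q ^ (n + m)) r

theorem powGE_le {q : Submodule k R} {n : ℕ} {S : Submodule k R} (h : ∀ m, n ≤ m → q ^ m ≤ S) :
    powGE q n ≤ S := iSup_le fun _ => h _ (Nat.le_add_right _ _)

theorem powGE_anti (q : Submodule k R) {n m : ℕ} (h : n ≤ m) : powGE q m ≤ powGE q n :=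
  powGE_le fun _ hr => pow_le_powGE q (h.trans hr)

theorem powGE_mono {q q' : Submodule k R} (h : q ≤ q') (n : ℕ) : powGE q n ≤ powGE q' n :=
  iSup_mono fun _ => pow_le_pow_left' h _

theorem powGE_mul (q : Submodule k R) (i j : ℕ) : powGE q i * powGE q j ≤ powGE q (i + j) := by
  simp only [powGE, Submodule.iSup_mul, Submodule.mul_iSup]
  refine iSup_le fun a => iSup_le fun b => ?_
  rw [← pow_add]
  exact pow_le_powGE q (by omega)

theorem mul_mem_powGE {q : Submodule k R} {i j n : ℕ} {x y : R} (hx : x ∈ powGE q i)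
    (hy : y ∈ powGE q j) (h : i + j = n) : x * y ∈ powGE q n :=
  h ▸ powGE_mul q i j (Submodule.mul_mem_mul hx hy)

theorem algebraMap_mem_powGE (q : Submodule k R) (r : k) : algebraMap k R r ∈ powGE q 0 :=
  pow_le_powGE q le_rfl (by rw [pow_zero]; exact Submodule.algebraMap_mem r)

theorem mem_powGE_one {q : Submodule k R} {x : R} (hx : x ∈ q) : x ∈ powGE q 1 :=
  pow_le_powGE q le_rfl (by rwa [pow_one])

theorem powGE_eq_sup (q : Submodule k R) (n : ℕ) : powGE q n = q ^ n ⊔ powGE q (n + 1) := by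
  refine le_antisymm (powGE_le fun m hm => ?_)
    (sup_le (pow_le_powGE q le_rfl) (powGE_anti q n.le_succ))
  rcases hm.eq_or_lt with rfl | h
  · exact le_sup_left
  · exact le_sup_of_le_right (pow_le_powGE q h)

theorem powGE_eq_bot {q : Submodule k R} {n : ℕ} (h : q ^ n = ⊥) : powGE q n = ⊥ := by
  refine le_bot_iff.1 (powGE_le fun m hm => ?_)
  obtain ⟨r, rfl⟩ := Nat.exists_eq_add_of_le hm
  rw [pow_add, h, Submodule.bot_mul]

theorem map_powGE {R' : Type*} [Ring R'] [Algebra k R'] (f : R →ₐ[k] R') (q : Submodule k R)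
    (n : ℕ) : (powGE q n).map f.toLinearMap = powGE (q.map f.toLinearMap) n := by
  simp only [powGE, Submodule.map_iSup, Submodule.map_pow]

end PowGE

/-! ### Super algebra maps to the exterior algebra -/

section Conv

variable {k A C : Type*} [Field k] [AddCommGroup A] [Module k A] [Coalgebra k A] [Ring C]
  [Algebra k C]

theorem counit_conv (G : A →ₗ[k] C) (a : A) :
    LinearMap.mul' k C (TensorProduct.map (Algebra.linearMap k C ∘ₗ Coalgebra.counit) G
      (Coalgebra.comul (R := k) a)) = G a :=
  LinearMap.congr_fun (congrArg WithConv.ofConv (one_mul (WithConv.toConv G))) a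

theorem conv_counit (G : A →ₗ[k] C) (a : A) :
    LinearMap.mul' k C (TensorProduct.map G (Algebra.linearMap k C ∘ₗ Coalgebra.counit)
      (Coalgebra.comul (R := k) a)) = G a :=
  LinearMap.congr_fun (congrArg WithConv.ofConv (mul_one (WithConv.toConv G))) a

end Conv

section SuperExp

variable {k A : Type*} [Field k] [Ring A] [Algebra k A] [Coalgebra k A]
  (𝒜 : ZMod 2 → Submodule k A) [GradedAlgebra 𝒜]

local notation "Δ" => Coalgebra.comul (R := k) (A := A)
local notation "ε" => Coalgebra.counit (R := k) (A := A)

/-- The map `A → k`, viewed as a map to an algebra. -/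
def counitTo (C : Type*) [Ring C] [Algebra k C] : A →ₗ[k] C := Algebra.linearMap k C ∘ₗ ε

/-- The map `a ↦ ε(a) + η[a]`, the exponential of the odd tangent vector `η`. -/
def expLin (η : OddCotangent 𝒜 →ₗ[k] OddCotangent 𝒜) : A →ₗ[k] ExteriorOdd 𝒜 :=
  counitTo (ExteriorOdd 𝒜) + ExteriorAlgebra.ι k ∘ₗ η ∘ₗ oddClass 𝒜

/-- The convolution product of the exponentials of the `E i`, for `i` in a list. -/
def prodExp {ι : Type*} (E : ι → OddCotangent 𝒜 →ₗ[k] OddCotangent 𝒜) :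
    List ι → (A →ₗ[k] ExteriorOdd 𝒜)
  | [] => counitTo (ExteriorOdd 𝒜)
  | i :: L => LinearMap.mul' k _ ∘ₗ TensorProduct.map (expLin 𝒜 (E i)) (prodExp E L) ∘ₗ Δ

variable {ι : Type*} {E : ι → OddCotangent 𝒜 →ₗ[k] OddCotangent 𝒜}

/-- The values on a subcoalgebra `V` do not change when the indices `i` are left out for which `E i`
vanishes on the classes of `V`: their exponentials are the counit on `V`. -/
theorem prodExp_filter (p : ι → Prop) [DecidablePred p] {V : Submodule k A}
    (hV : IsSubcoalgebra V) (L : List ι)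
    (h : ∀ i, ¬ p i → ∀ v ∈ V, E i (oddClass 𝒜 v) = 0) :
    ∀ v ∈ V, prodExp 𝒜 E L v = prodExp 𝒜 E (L.filter p) v := by
  induction L with
  | nil => intro v _; rfl
  | cons i L ih =>
    intro v hv
    have key : prodExp 𝒜 E (i :: L) v = LinearMap.mul' k _ (TensorProduct.map (expLin 𝒜 (E i))
        (prodExp 𝒜 E (L.filter p)) (Δ v)) := by
      have : LinearMap.range (TensorProduct.mapIncl V V) ≤ LinearMap.eqLocus
          (LinearMap.mul' k _ ∘ₗ TensorProduct.map (expLin 𝒜 (E i)) (prodExp 𝒜 E L))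
          (LinearMap.mul' k _ ∘ₗ TensorProduct.map (expLin 𝒜 (E i))
            (prodExp 𝒜 E (L.filter p))) := by
        refine range_mapIncl_le fun x hx y hy => ?_
        rw [LinearMap.mem_eqLocus]
        simp [ih y hy]
      exact this (hV v hv)
    rw [key]
    by_cases hp : p i
    · rw [List.filter_cons_of_pos (by simpa using hp)]; rfl
    · rw [List.filter_cons_of_neg (by simpa using hp)]
      have : LinearMap.range (TensorProduct.mapIncl V V) ≤ LinearMap.eqLocus
          (LinearMap.mul' k _ ∘ₗ TensorProduct.map (expLin 𝒜 (E i)) (prodExp 𝒜 E (L.filter p)))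
          (LinearMap.mul' k _ ∘ₗ TensorProduct.map (counitTo (ExteriorOdd 𝒜))
            (prodExp 𝒜 E (L.filter p))) := by
        refine range_mapIncl_le fun x hx y hy => ?_
        rw [LinearMap.mem_eqLocus]
        simp [expLin, h i hp x hx]
      refine (this (hV v hv)).trans ?_
      exact counit_conv (prodExp 𝒜 E (L.filter p)) v

/-- The image in the exterior algebra of a subspace of `W^A`. -/
abbrev extSub (Q : Submodule k (OddCotangent 𝒜)) : Submodule k (ExteriorOdd 𝒜) :=
  Q.map (ExteriorAlgebra.ι k)

/-- Up to terms of degree at least `2`, a product of exponentials is `a ↦ ε(a) + (∑ E i) [a]`. -/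
theorem prodExp_sub_mem {V : Submodule k A} (hV : IsSubcoalgebra V)
    {Q : Submodule k (OddCotangent 𝒜)} (L : List ι)
    (h : ∀ i ∈ L, ∀ v ∈ V, E i (oddClass 𝒜 v) ∈ Q) :
    ∀ v ∈ V, prodExp 𝒜 E L v - algebraMap k _ (ε v) -
      ExteriorAlgebra.ι k ((L.map fun i => E i (oddClass 𝒜 v)).sum) ∈ powGE (extSub 𝒜 Q) 2 := by
  induction L with
  | nil => intro v _; simp [prodExp, counitTo]
  | cons i L ih =>
    have hi := h i (by simp)
    have ih := ih fun j hj => h j (List.mem_cons_of_mem _ hj)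
    let η : A →ₗ[k] OddCotangent 𝒜 := (L.map fun i => E i ∘ₗ oddClass 𝒜).sum
    have hη : ∀ v, η v = (L.map fun i => E i (oddClass 𝒜 v)).sum := by
      intro v
      have : ∀ L : List ι, (L.map fun i => E i ∘ₗ oddClass 𝒜).sum v =
          (L.map fun i => E i (oddClass 𝒜 v)).sum := by
        intro L
        induction L with
        | nil => rfl
        | cons j L ih => simp [ih]
      exact this L
    have hηQ : ∀ v ∈ V, η v ∈ Q := by
      intro v hv
      rw [hη]
      refine list_sum_mem fun x hx => ?_
      obtain ⟨j, hj, rfl⟩ := List.mem_map.1 hx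
      exact h j (List.mem_cons_of_mem _ hj) v hv
    -- the terms of degree at most `1` of the convolution product
    let cε : A →ₗ[k] ExteriorOdd 𝒜 := counitTo (ExteriorOdd 𝒜)
    let B : A ⊗[k] A →ₗ[k] ExteriorOdd 𝒜 := LinearMap.mul' k _ ∘ₗ (TensorProduct.map cε cε +
      TensorProduct.map cε (ExteriorAlgebra.ι k ∘ₗ η) +
      TensorProduct.map (ExteriorAlgebra.ι k ∘ₗ E i ∘ₗ oddClass 𝒜) cε)
    intro v hv
    have hB : B (Δ v) = algebraMap k _ (ε v) +
        ExteriorAlgebra.ι k (((i :: L).map fun i => E i (oddClass 𝒜 v)).sum) := by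
      simp only [B, LinearMap.comp_apply, LinearMap.add_apply, map_add]
      erw [counit_conv, counit_conv, conv_counit]
      simp only [LinearMap.comp_apply, hη, cε, counitTo, List.map_cons, List.sum_cons, map_add,
        Algebra.linearMap_apply]
      abel
    rw [sub_sub, ← hB]
    have : LinearMap.range (TensorProduct.mapIncl V V) ≤ (powGE (extSub 𝒜 Q) 2).comap
        (LinearMap.mul' k _ ∘ₗ TensorProduct.map (expLin 𝒜 (E i)) (prodExp 𝒜 E L) - B) := by
      refine range_mapIncl_le fun x hx y hy => ?_
      have e : (LinearMap.mul' k _ ∘ₗ TensorProduct.map (expLin 𝒜 (E i)) (prodExp 𝒜 E L) - B)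
          (x ⊗ₜ y) = algebraMap k _ (ε x) * (prodExp 𝒜 E L y - algebraMap k _ (ε y) -
            ExteriorAlgebra.ι k (η y)) + ExteriorAlgebra.ι k (E i (oddClass 𝒜 x)) *
            ((prodExp 𝒜 E L y - algebraMap k _ (ε y) - ExteriorAlgebra.ι k (η y)) +
            ExteriorAlgebra.ι k (η y)) := by
        simp only [B, LinearMap.sub_apply, LinearMap.comp_apply, LinearMap.add_apply,
          TensorProduct.map_tmul, LinearMap.mul'_apply, expLin, cε, counitTo,
          Algebra.linearMap_apply, map_add]
        noncomm_ring
      rw [Submodule.mem_comap, e]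
      have h1 := ih y hy
      rw [← hη] at h1
      refine add_mem (mul_mem_powGE (algebraMap_mem_powGE _ _) h1 rfl)
        (mul_mem_powGE (mem_powGE_one (Submodule.mem_map_of_mem (hi x hx)))
          (add_mem (powGE_anti _ one_le_two h1)
            (mem_powGE_one (Submodule.mem_map_of_mem (hηQ y hy)))) rfl)
    exact this (hV v hv)

/-- The products of exponentials over larger and larger finite sets of indices become stationary at
every `a`: all but finitely many `E i` vanish on the classes of a finite-dimensional subcoalgebra
which contains `a`. -/
theorem exists_stable [LinearOrder ι] (hE : IsResolution E) (a : A) :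
    ∃ T₀ : Finset ι, ∀ T, T₀ ⊆ T → prodExp 𝒜 E T.sort a = prodExp 𝒜 E T₀.sort a := by
  classical
  obtain ⟨V, hfin, ha, hV⟩ := exists_finiteDimensional_subcoalgebra (k := k) a
  obtain ⟨s, hs⟩ := (Submodule.fg_iff_finiteDimensional V).2 hfin
  choose T hT _ using hE.sum_eq
  refine ⟨s.biUnion fun v => T (oddClass 𝒜 v), fun T' hT' => ?_⟩
  set T₀ := s.biUnion fun v => T (oddClass 𝒜 v) with hT₀
  have hvan : ∀ i, ¬ i ∈ T₀ → ∀ v ∈ V, E i (oddClass 𝒜 v) = 0 := by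
    intro i hi
    have : V ≤ LinearMap.ker (E i ∘ₗ oddClass 𝒜) := by
      rw [← hs, Submodule.span_le]
      intro v hv
      exact hT _ i fun h => hi (Finset.mem_biUnion.2 ⟨v, hv, h⟩)
    exact fun v hv => this hv
  have hfil : T'.sort.filter (· ∈ T₀) = T₀.sort := by
    have h1 : (T'.sort.filter (· ∈ T₀)).toFinset = T₀ := by
      ext i
      simp only [List.mem_toFinset, List.mem_filter, Finset.mem_sort, decide_eq_true_eq]
      exact ⟨fun h => h.2, fun h => ⟨hT' h, h⟩⟩
    have h2 := (List.toFinset_sort (r := (· ≤ ·)) (l := T'.sort.filter (· ∈ T₀))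
      ((Finset.sort_nodup T' (· ≤ ·)).filter _)).2 ((Finset.pairwise_sort T' (· ≤ ·)).filter _)
    rw [h1] at h2
    exact h2.symm
  rw [prodExp_filter 𝒜 (· ∈ T₀) hV _ hvan a ha, hfil]

/-- `g` is the product of the exponentials of all the `E i`, in increasing order of `i`:
every element has the same value under `g` and under the finite products over all sufficiently
large finite sets of indices. -/
structure IsSuperExp [LinearOrder ι] (E : ι → OddCotangent 𝒜 →ₗ[k] OddCotangent 𝒜)
    (g : A →ₐ[k] ExteriorOdd 𝒜) : Prop where
  map_mem : ∀ n, ∀ a ∈ 𝒜 n, g a ∈ exteriorGrading 𝒜 n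
  eq_prod : ∀ a, ∃ T₀ : Finset ι, ∀ T, T₀ ⊆ T → g a = prodExp 𝒜 E T.sort a

variable {𝒜} in
/-- An infinite product of exponentials along a resolution of the identity is `a ↦ ε(a) + [a]`, up
to products of at least two elements of a subspace `Q` which contains all the `E i [v]`. -/
theorem IsSuperExp.sub_mem [LinearOrder ι] {g : A →ₐ[k] ExteriorOdd 𝒜} (hg : IsSuperExp 𝒜 E g)
    (hE : IsResolution E) {V : Submodule k A} (hV : IsSubcoalgebra V)
    {Q : Submodule k (OddCotangent 𝒜)} (h : ∀ i, ∀ v ∈ V, E i (oddClass 𝒜 v) ∈ Q) {v : A}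
    (hv : v ∈ V) :
    g v - algebraMap k _ (ε v) - ExteriorAlgebra.ι k (oddClass 𝒜 v) ∈ powGE (extSub 𝒜 Q) 2 := by
  classical
  obtain ⟨T₁, h1⟩ := hg.eq_prod v
  obtain ⟨T₂, h2, _⟩ := hE.sum_eq (oddClass 𝒜 v)
  set T := T₁ ∪ T₂
  have h3 : ∑ i ∈ T, E i (oddClass 𝒜 v) = oddClass 𝒜 v :=
    hE.sum_eq_of_vanish fun i hi => h2 i fun h => hi (Finset.mem_union_right _ h)
  have h4 := prodExp_sub_mem 𝒜 hV T.sort (fun i _ => h i) v hv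
  rw [← h1 T Finset.subset_union_left] at h4
  have h5 : (T.sort.map fun i => E i (oddClass 𝒜 v)).sum = oddClass 𝒜 v := by
    rw [((Finset.sort_perm_toList T (· ≤ ·)).map _).sum_eq, Finset.sum_map_toList, h3]
  rwa [h5] at h4

variable [SuperHopfAlgebra k 𝒜]

/-- The convolution product of two super algebra maps to a super commutative algebra is a super
algebra map. -/
theorem exists_conv_algHom {C : Type*} [Ring C] [Algebra k C] {𝒞 : ZMod 2 → Submodule k C}
    [GradedAlgebra 𝒞] [IsSuperCommutative k 𝒞] (f g : A →ₐ[k] C)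
    (hf : ∀ n, ∀ a ∈ 𝒜 n, f a ∈ 𝒞 n) (hg : ∀ n, ∀ a ∈ 𝒜 n, g a ∈ 𝒞 n) :
    ∃ h : A →ₐ[k] C, (∀ n, ∀ a ∈ 𝒜 n, h a ∈ 𝒞 n) ∧
      ∀ a, h a = LinearMap.mul' k C (TensorProduct.map f.toLinearMap g.toLinearMap (Δ a)) := by
  refine ⟨(GradedTensorProduct.lift 𝒜 𝒜 f g fun i j a b =>
    super_mul_comm (hf i a a.2) (hg j b b.2)).comp (comulHom 𝒜), fun n a ha => ?_, fun a => rfl⟩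
  have : tensorGrading 𝒜 𝒜 n ≤ (𝒞 n).comap
      (LinearMap.mul' k C ∘ₗ TensorProduct.map f.toLinearMap g.toLinearMap) :=
    tensorGrading_le fun i j hij a ha b hb => mul_mem_of_eq (hf i a ha) (hg j b hb) hij
  exact this (comul_mem 𝒜 ha)

variable [IsSuperCommutative k 𝒜]

/-- The exponential of `η` is multiplicative, because `a ↦ [a]` is a derivation along the counit and
all the products `η(u) η(v)` vanish. -/
theorem exists_expLin_algHom (η : OddCotangent 𝒜 →ₗ[k] OddCotangent 𝒜)
    (hη : ∀ u v, ExteriorAlgebra.ι k (η u) * ExteriorAlgebra.ι k (η v) = 0) :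
    ∃ g : A →ₐ[k] ExteriorOdd 𝒜, (∀ n, ∀ a ∈ 𝒜 n, g a ∈ exteriorGrading 𝒜 n) ∧
      g.toLinearMap = expLin 𝒜 η := by
  have happ : ∀ a, expLin 𝒜 η a = algebraMap k _ (ε a) +
    ExteriorAlgebra.ι k (η (oddClass 𝒜 a)) := fun a => rfl
  have h1 : (1 : A) ∈ 𝒜 0 := SetLike.one_mem_graded 𝒜
  refine ⟨AlgHom.ofLinearMap (expLin 𝒜 η) ?_ ?_, fun n a ha => ?_, rfl⟩
  · rw [happ, oddClass_of_even 𝒜 h1, SuperHopfAlgebra.counit_one 𝒜]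
    simp
  · intro a b
    rw [happ, happ, happ, oddClass_mul, SuperHopfAlgebra.counit_mul 𝒜, add_mul, mul_add, mul_add,
      hη, add_zero, map_mul, map_add, map_add, map_smul, map_smul, map_smul, map_smul,
      Algebra.smul_def, Algebra.smul_def, Algebra.commutes (ε b), add_assoc]
  · rw [AlgHom.ofLinearMap_apply, happ]
    rcases zmod_two_cases n with rfl | rfl
    · rw [oddClass_of_even 𝒜 ha, map_zero, map_zero, add_zero]
      exact SetLike.algebraMap_mem_graded _ _
    · rw [counit_of_odd 𝒜 ha, map_zero, zero_add]
      exact CliffordAlgebra.ι_mem_evenOdd_one _ _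

theorem exists_prodExp_algHom
    (hE : ∀ i u v, ExteriorAlgebra.ι k (E i u) * ExteriorAlgebra.ι k (E i v) = 0) (L : List ι) :
    ∃ g : A →ₐ[k] ExteriorOdd 𝒜, (∀ n, ∀ a ∈ 𝒜 n, g a ∈ exteriorGrading 𝒜 n) ∧
      g.toLinearMap = prodExp 𝒜 E L := by
  induction L with
  | nil =>
    obtain ⟨g, hg, hg'⟩ := exists_expLin_algHom 𝒜 0 (by simp)
    exact ⟨g, hg, hg'.trans (by ext a; simp [expLin, prodExp])⟩
  | cons i L ih =>
    obtain ⟨g, hg, hg'⟩ := ih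
    obtain ⟨e, he, he'⟩ := exists_expLin_algHom 𝒜 (E i) (hE i)
    obtain ⟨h, hh, hh'⟩ := exists_conv_algHom 𝒜 e g he hg
    refine ⟨h, hh, ?_⟩
    ext a
    refine (hh' a).trans ?_
    rw [hg', he']
    rfl

/-- The infinite product of exponentials exists. It is an algebra map since any two elements have
the same values under it and under a common finite product. -/
theorem exists_superExp [LinearOrder ι] (hE : IsResolution E) : ∃ g, IsSuperExp 𝒜 E g := by
  classical
  choose T hT using exists_stable 𝒜 hE
  choose G hG hG' using fun S : Finset ι => exists_prodExp_algHom 𝒜 hE.sq_zero S.sort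
  have hGa : ∀ S a, G S a = prodExp 𝒜 E S.sort a := fun S a => LinearMap.congr_fun (hG' S) a
  have hst : ∀ a S, T a ⊆ S → G (T a) a = G S a := fun a S h => by rw [hGa, hGa, hT a S h]
  refine ⟨AlgHom.ofLinearMap
    { toFun := fun a => G (T a) a
      map_add' := fun a b => ?_
      map_smul' := fun r a => ?_ } ?_ ?_,
    ⟨fun n a ha => hG _ n a ha, fun a => ⟨T a, fun S hS => ?_⟩⟩⟩
  · let S := T a ∪ T b ∪ T (a + b)
    rw [hst (a + b) S Finset.subset_union_right,
      hst a S (Finset.subset_union_left.trans Finset.subset_union_left),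
      hst b S (Finset.subset_union_right.trans Finset.subset_union_left), map_add]
  · let S := T a ∪ T (r • a)
    rw [hst (r • a) S Finset.subset_union_right, hst a S Finset.subset_union_left, map_smul]
    rfl
  · exact map_one (G (T 1))
  · intro a b
    let S := T a ∪ T b ∪ T (a * b)
    change G (T (a * b)) (a * b) = G (T a) a * G (T b) b
    rw [hst (a * b) S Finset.subset_union_right,
      hst a S (Finset.subset_union_left.trans Finset.subset_union_left),
      hst b S (Finset.subset_union_right.trans Finset.subset_union_left), map_mul]
  · change G (T a) a = _
    rw [hst a S hS, hGa]

end SuperExp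

section Naturality

variable {k A B : Type*} [Field k] [Ring A] [Algebra k A] [Coalgebra k A]
  [Ring B] [Algebra k B] [Coalgebra k B]
  {𝒜 : ZMod 2 → Submodule k A} [GradedAlgebra 𝒜] {ℬ : ZMod 2 → Submodule k B} [GradedAlgebra ℬ]
  (f : SuperHopfHom 𝒜 ℬ)

theorem SuperHopfHom.map_pr (n : ZMod 2) (a : A) :
    f.toAlgHom (pr 𝒜 n a) = pr ℬ n (f.toAlgHom a) := by
  conv_rhs => rw [← pr_zero_add_pr_one 𝒜 a, map_add, map_add]
  have h0 := f.map_mem 0 _ (pr_mem 𝒜 0 a)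
  have h1 := f.map_mem 1 _ (pr_mem 𝒜 1 a)
  rcases zmod_two_cases n with rfl | rfl
  · rw [pr_of_mem h0, pr_zero_of_odd h1, add_zero]
  · rw [pr_of_mem h1, pr_one_of_even h0, zero_add]

theorem SuperHopfHom.oddClass_map (a : A) :
    oddClass ℬ (f.toAlgHom a) = f.oddCotangentMap (oddClass 𝒜 a) := by
  have : (pr ℬ 1).codRestrict (ℬ 1) (pr_mem ℬ 1) (f.toAlgHom a) =
      f.oddRestrict ((pr 𝒜 1).codRestrict (𝒜 1) (pr_mem 𝒜 1) a) :=
    Subtype.ext (f.map_pr 1 a).symm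
  rw [oddClass, LinearMap.comp_apply, this]
  rfl

variable {ι : Type*} {E : ι → OddCotangent 𝒜 →ₗ[k] OddCotangent 𝒜}
  {E' : ι → OddCotangent ℬ →ₗ[k] OddCotangent ℬ}
  (hEE : ∀ i, E' i ∘ₗ f.oddCotangentMap = f.oddCotangentMap ∘ₗ E i)

include hEE

theorem SuperHopfHom.prodExp_map (L : List ι) (a : A) :
    prodExp ℬ E' L (f.toAlgHom a) =
      ExteriorAlgebra.map f.oddCotangentMap (prodExp 𝒜 E L a) := by
  induction L generalizing a with
  | nil =>
    change algebraMap k (ExteriorOdd ℬ) _ = ExteriorAlgebra.map f.oddCotangentMap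
      (algebraMap k (ExteriorOdd 𝒜) _)
    rw [AlgHom.commutes, f.counit_map]
  | cons i L ih =>
    have he : ∀ a, expLin ℬ (E' i) (f.toAlgHom a) =
        ExteriorAlgebra.map f.oddCotangentMap (expLin 𝒜 (E i) a) := by
      intro a
      change algebraMap k (ExteriorOdd ℬ) (Coalgebra.counit (R := k) (f.toAlgHom a)) +
          ExteriorAlgebra.ι k (E' i (oddClass ℬ (f.toAlgHom a))) =
        ExteriorAlgebra.map f.oddCotangentMap (algebraMap k (ExteriorOdd 𝒜)
          (Coalgebra.counit (R := k) a) + ExteriorAlgebra.ι k (E i (oddClass 𝒜 a)))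
      rw [map_add, AlgHom.commutes, ExteriorAlgebra.map_apply_ι, f.counit_map, f.oddClass_map]
      exact congrArg _ (congrArg _ (LinearMap.congr_fun (hEE i) _))
    simp only [prodExp, LinearMap.comp_apply, f.comul_map]
    generalize Coalgebra.comul (R := k) a = w
    induction w with
    | zero => simp
    | add x y hx hy => simp only [map_add, hx, hy]
    | tmul x y => simp [he, ih]

/-- The product of exponentials is natural in the resolution of the identity. -/
theorem SuperHopfHom.superExp_map [LinearOrder ι] {g : A →ₐ[k] ExteriorOdd 𝒜}
    {g' : B →ₐ[k] ExteriorOdd ℬ} (hg : IsSuperExp 𝒜 E g) (hg' : IsSuperExp ℬ E' g') (a : A) :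
    g' (f.toAlgHom a) = ExteriorAlgebra.map f.oddCotangentMap (g a) := by
  classical
  obtain ⟨T₁, h1⟩ := hg.eq_prod a
  obtain ⟨T₂, h2⟩ := hg'.eq_prod (f.toAlgHom a)
  rw [h1 (T₁ ∪ T₂) Finset.subset_union_left, h2 (T₁ ∪ T₂) Finset.subset_union_right,
    f.prodExp_map hEE]

end Naturality

/-! ### The filtration by exterior degree -/

section ModelFiltration

variable {k A : Type*} [Field k] [Ring A] [Algebra k A] [Coalgebra k A]
  {𝒜 : ZMod 2 → Submodule k A}

/-- The filtration of `F ⊗ ∧(Q)` by the exterior degree, for a subalgebra `F` of `Ā` and a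
subspace `Q` of `W^A`. -/
def modelFil (F : Subalgebra k (EvenQuotient 𝒜)) (Q : Submodule k (OddCotangent 𝒜)) (n : ℕ) :
    Submodule k (Model 𝒜) :=
  Submodule.map₂ (TensorProduct.mk k _ _) (Subalgebra.toSubmodule F) (powGE (extSub 𝒜 Q) n)

variable {F : Subalgebra k (EvenQuotient 𝒜)} {Q : Submodule k (OddCotangent 𝒜)}

theorem tmul_mem_modelFil {n : ℕ} {a : EvenQuotient 𝒜} {w : ExteriorOdd 𝒜} (ha : a ∈ F)
    (hw : w ∈ powGE (extSub 𝒜 Q) n) : a ⊗ₜ[k] w ∈ modelFil F Q n :=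
  Submodule.apply_mem_map₂ _ ha hw

theorem modelFil_le {n : ℕ} {S : Submodule k (Model 𝒜)}
    (h : ∀ a ∈ F, ∀ w ∈ powGE (extSub 𝒜 Q) n, a ⊗ₜ[k] w ∈ S) : modelFil F Q n ≤ S :=
  Submodule.map₂_le.2 h

theorem modelFil_anti {n m : ℕ} (h : n ≤ m) : modelFil F Q m ≤ modelFil F Q n :=
  modelFil_le fun _ ha _ hw => tmul_mem_modelFil ha (powGE_anti _ h hw)

theorem modelFil_mul_le (i j : ℕ) : modelFil F Q i * modelFil F Q j ≤ modelFil F Q (i + j) := by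
  rw [Submodule.mul_le]
  intro x hx y hy
  revert y
  change modelFil F Q j ≤ (modelFil F Q (i + j)).comap (LinearMap.mulLeft k x)
  refine modelFil_le fun b hb w hw => ?_
  revert x
  change modelFil F Q i ≤ (modelFil F Q (i + j)).comap (LinearMap.mulRight k (b ⊗ₜ[k] w))
  refine modelFil_le fun a ha v hv => ?_
  rw [Submodule.mem_comap, LinearMap.mulRight_apply, Algebra.TensorProduct.tmul_mul_tmul]
  exact tmul_mem_modelFil (mul_mem ha hb) (mul_mem_powGE hv hw rfl)

theorem mul_mem_modelFil {i j n : ℕ} {x y : Model 𝒜} (hx : x ∈ modelFil F Q i)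
    (hy : y ∈ modelFil F Q j) (h : i + j = n) : x * y ∈ modelFil F Q n :=
  h ▸ modelFil_mul_le i j (Submodule.mul_mem_mul hx hy)

end ModelFiltration

/-! ### The comodule algebra map attached to a super algebra map -/

section Phi

variable {k A : Type*} [Field k] [Ring A] [Algebra k A] [Coalgebra k A]
  {𝒜 : ZMod 2 → Submodule k A} [GradedAlgebra 𝒜]

local notation "Δ" => Coalgebra.comul (R := k) (A := A)
local notation "ε" => Coalgebra.counit (R := k) (A := A)

variable {F : Subalgebra k (EvenQuotient 𝒜)} {Q : Submodule k (OddCotangent 𝒜)}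

/-- The linear map `a ↦ ∑ ā₁ ⊗ [a₂]`, the part of `phi g` of exterior degree `1`. -/
def coact₁ : A →ₗ[k] EvenQuotient 𝒜 ⊗[k] OddCotangent 𝒜 :=
  TensorProduct.map (toEven 𝒜).toLinearMap (oddClass 𝒜) ∘ₗ Δ

/-- The map `Ā ⊗ W^A → Ā ⊗ ∧(W^A)`. -/
def inclOne (𝒜 : ZMod 2 → Submodule k A) : EvenQuotient 𝒜 ⊗[k] OddCotangent 𝒜 →ₗ[k] Model 𝒜 :=
  TensorProduct.map LinearMap.id (ExteriorAlgebra.ι k)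

/-- `g` agrees with `a ↦ ε(a) + [a]` on `V`, up to products of at least two elements of `Q`. -/
def IsApprox (g : A →ₐ[k] ExteriorOdd 𝒜) (V : Submodule k A)
    (Q : Submodule k (OddCotangent 𝒜)) : Prop :=
  ∀ v ∈ V, oddClass 𝒜 v ∈ Q ∧ g v - algebraMap k _ (ε v) - ExteriorAlgebra.ι k (oddClass 𝒜 v) ∈
    powGE (extSub 𝒜 Q) 2

theorem IsSuperExp.isApprox {ι : Type*} [LinearOrder ι]
    {E : ι → OddCotangent 𝒜 →ₗ[k] OddCotangent 𝒜} {g : A →ₐ[k] ExteriorOdd 𝒜}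
    (hg : IsSuperExp 𝒜 E g) (hE : IsResolution E) {V : Submodule k A} (hV : IsSubcoalgebra V)
    (h : ∀ i, ∀ v ∈ V, E i (oddClass 𝒜 v) ∈ Q) : IsApprox g V Q := by
  refine fun v hv => ⟨?_, hg.sub_mem hE hV h hv⟩
  obtain ⟨T, _, hT⟩ := hE.sum_eq (oddClass 𝒜 v)
  rw [← hT]
  exact Submodule.sum_mem _ fun i _ => h i v hv

theorem IsSuperExp.algebraMapInv_eq {ι : Type*} [LinearOrder ι]
    {E : ι → OddCotangent 𝒜 →ₗ[k] OddCotangent 𝒜} (hE : IsResolution E)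
    {g : A →ₐ[k] ExteriorOdd 𝒜} (hg : IsSuperExp 𝒜 E g) (a : A) :
    ExteriorAlgebra.algebraMapInv (g a) = ε a := by
  have h := hg.sub_mem hE isSubcoalgebra_top (Q := ⊤) (fun _ _ _ => trivial) (v := a) trivial
  have h2 : powGE (extSub 𝒜 ⊤) 2 ≤
      LinearMap.ker (ExteriorAlgebra.algebraMapInv (R := k) (M := OddCotangent 𝒜)).toLinearMap := by
    refine powGE_le fun m hm => ?_
    obtain ⟨r, rfl⟩ := Nat.exists_eq_add_of_le hm
    have h0 : (extSub 𝒜 ⊤).map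
        (ExteriorAlgebra.algebraMapInv (R := k) (M := OddCotangent 𝒜)).toLinearMap = ⊥ := by
      rw [eq_bot_iff]
      rintro _ ⟨_, ⟨w, -, rfl⟩, rfl⟩
      simp [ExteriorAlgebra.algebraMapInv]
    have h1 : (extSub 𝒜 ⊤ ^ (2 + r)).map
        (ExteriorAlgebra.algebraMapInv (R := k) (M := OddCotangent 𝒜)).toLinearMap = ⊥ := by
      rw [pow_add, Submodule.map_mul, Submodule.map_pow, h0, pow_two, Submodule.bot_mul,
        Submodule.bot_mul]
    exact (Submodule.map_le_iff_le_comap.1 h1.le).trans (by rw [LinearMap.ker])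
  have h3 := h2 h
  rw [LinearMap.mem_ker, AlgHom.toLinearMap_apply, map_sub, map_sub, AlgHom.commutes] at h3
  have h4 : ExteriorAlgebra.algebraMapInv (ExteriorAlgebra.ι k (oddClass 𝒜 a)) = (0 : k) := by
    simp [ExteriorAlgebra.algebraMapInv]
  rw [h4, sub_zero, sub_eq_zero] at h3
  exact h3

variable {g : A →ₐ[k] ExteriorOdd 𝒜} {V : Submodule k A}

theorem IsApprox.coact₁_mem (hg : IsApprox g V Q) (hV : IsSubcoalgebra V)
    (hF : ∀ v ∈ V, toEven 𝒜 v ∈ F) {v : A} (hv : v ∈ V) :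
    inclOne 𝒜 (coact₁ v) ∈ modelFil F Q 1 := by
  have h4 : LinearMap.range (TensorProduct.mapIncl V V) ≤ (modelFil F Q 1).comap
      (inclOne 𝒜 ∘ₗ TensorProduct.map (toEven 𝒜).toLinearMap (oddClass 𝒜)) :=
    range_mapIncl_le fun x hx y hy => tmul_mem_modelFil (hF x hx)
      (mem_powGE_one (Submodule.mem_map_of_mem (hg y hy).1))
  exact h4 (hV v hv)

variable [SuperHopfAlgebra k 𝒜]

/-- The map `a ↦ ∑ ā₁ ⊗ g(a₂)` from `A` to `Ā ⊗ ∧(W^A)`, for an algebra map `g`. -/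
def phi (g : A →ₐ[k] ExteriorOdd 𝒜) : A →ₐ[k] Model 𝒜 :=
  (GradedTensorProduct.lift 𝒜 𝒜 (Algebra.TensorProduct.includeLeft.comp (toEven 𝒜))
    (Algebra.TensorProduct.includeRight.comp g) (by
      intro i j a b
      rcases zmod_two_cases i with rfl | rfl
      · simp
      · have h1 := toEven_odd 𝒜 a.2
        simp only [AlgHom.comp_apply, h1, map_zero, mul_zero, zero_mul, smul_zero])).comp
    (comulHom 𝒜)

theorem phi_apply (g : A →ₐ[k] ExteriorOdd 𝒜) (a : A) :
    phi g a = TensorProduct.map (toEven 𝒜).toLinearMap g.toLinearMap (Δ a) := by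
  change LinearMap.mul' k _ (TensorProduct.map _ _ (Δ a)) = _
  generalize Δ a = w
  induction w with
  | zero => simp
  | add x y hx hy => simp only [map_add, hx, hy]
  | tmul x y => simp

theorem phi_mem {g : A →ₐ[k] ExteriorOdd 𝒜} (hg : ∀ n, ∀ a ∈ 𝒜 n, g a ∈ exteriorGrading 𝒜 n)
    (n : ZMod 2) (a : A) (ha : a ∈ 𝒜 n) :
    phi g a ∈ tensorGrading (evenQuotientGrading 𝒜) (exteriorGrading 𝒜) n := by
  rw [phi_apply]
  exact tensorGrading_le (S := (tensorGrading (evenQuotientGrading 𝒜) (exteriorGrading 𝒜) n).comap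
    (TensorProduct.map (toEven 𝒜).toLinearMap g.toLinearMap))
    (fun i j hij x hx y hy => tmul_mem_tensorGrading (Submodule.mem_map_of_mem hx) (hg j y hy) hij)
    (comul_mem 𝒜 ha)

/-- `phi g` is a map of left `Ā`-comodules, by coassociativity. -/
theorem phi_coaction (g : A →ₐ[k] ExteriorOdd 𝒜) (a : A) :
    modelCoaction 𝒜 (phi g a) = (phi g).toLinearMap.lTensor (EvenQuotient 𝒜) (coaction 𝒜 a) := by
  let F := TensorProduct.map (toEven 𝒜).toLinearMap
    (TensorProduct.map (toEven 𝒜).toLinearMap g.toLinearMap)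
  have h1 : ∀ w : A ⊗[k] A, modelCoaction 𝒜 (TensorProduct.map (toEven 𝒜).toLinearMap
      g.toLinearMap w) = F (TensorProduct.assoc k A A A ((Δ).rTensor A w)) := by
    intro w
    induction w with
    | zero => simp
    | add x y hx hy => simp only [map_add, hx, hy]
    | tmul x y =>
      have e : Coalgebra.comul (R := k) (toEven 𝒜 x) =
          TensorProduct.map (toEven 𝒜).toLinearMap (toEven 𝒜).toLinearMap (Δ x) :=
        LinearMap.congr_fun (evenComul_comp 𝒜) x
      rw [TensorProduct.map_tmul, modelCoaction, LinearMap.comp_apply, LinearMap.rTensor_tmul,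
        AlgHom.toLinearMap_apply, e, LinearMap.rTensor_tmul]
      generalize Δ x = u
      induction u with
      | zero => simp
      | add u v hu hv => simp only [map_add, TensorProduct.add_tmul, hu, hv]
      | tmul u v => rfl
  have h2 : ∀ w : A ⊗[k] A, (phi g).toLinearMap.lTensor (EvenQuotient 𝒜)
      ((toEven 𝒜).toLinearMap.rTensor A w) = F ((Δ).lTensor A w) := by
    intro w
    induction w with
    | zero => simp
    | add x y hx hy => simp only [map_add, hx, hy]
    | tmul x y =>
      rw [LinearMap.rTensor_tmul, LinearMap.lTensor_tmul, LinearMap.lTensor_tmul,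
        AlgHom.toLinearMap_apply, AlgHom.toLinearMap_apply, phi_apply]
      rfl
  rw [phi_apply, h1, Coalgebra.coassoc_apply, coaction, LinearMap.comp_apply, h2]

theorem phi_counit {g : A →ₐ[k] ExteriorOdd 𝒜}
    (hg : ∀ a, ExteriorAlgebra.algebraMapInv (g a) = ε a) (a : A) :
    modelCounit 𝒜 (phi g a) = ε a := by
  have h1 : ∀ w : A ⊗[k] A, modelCounit 𝒜 (TensorProduct.map (toEven 𝒜).toLinearMap
      g.toLinearMap w) = LinearMap.mul' k k (TensorProduct.map ε ε w) := by
    intro w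
    induction w with
    | zero => simp
    | add x y hx hy => simp only [map_add, hx, hy]
    | tmul x y =>
      change evenCounit 𝒜 (toEven 𝒜 x) * ExteriorAlgebra.algebraMapInv (g y) = ε x * ε y
      rw [hg]
      rfl
  rw [phi_apply, h1]
  exact counit_conv ε a

/-- The parts of `phi g v` of exterior degree `0` and `1` are `v̄ ⊗ 1` and `∑ v̄₁ ⊗ [v₂]`. -/
theorem IsApprox.phi_sub_mem_two (hg : IsApprox g V Q) (hV : IsSubcoalgebra V)
    (hF : ∀ v ∈ V, toEven 𝒜 v ∈ F) {v : A} (hv : v ∈ V) :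
    phi g v - toEven 𝒜 v ⊗ₜ[k] 1 - inclOne 𝒜 (coact₁ v) ∈ modelFil F Q 2 := by
  let cε : A →ₗ[k] ExteriorOdd 𝒜 := counitTo (ExteriorOdd 𝒜)
  let G : A ⊗[k] A →ₗ[k] Model 𝒜 := TensorProduct.map (toEven 𝒜).toLinearMap
    (g.toLinearMap - cε - ExteriorAlgebra.ι k ∘ₗ oddClass 𝒜)
  have h1 : toEven 𝒜 v ⊗ₜ[k] (1 : ExteriorOdd 𝒜) =
      TensorProduct.map (toEven 𝒜).toLinearMap cε (Δ v) := by
    have e := congrArg (TensorProduct.map (toEven 𝒜).toLinearMap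
      (Algebra.linearMap k (ExteriorOdd 𝒜))) (Coalgebra.lTensor_counit_comul (R := k) v)
    rw [TensorProduct.map_tmul, Algebra.linearMap_apply, map_one] at e
    rw [← AlgHom.toLinearMap_apply, ← e, LinearMap.lTensor, ← LinearMap.comp_apply,
      ← TensorProduct.map_comp, LinearMap.comp_id]
    rfl
  have h2 : inclOne 𝒜 (coact₁ v) = TensorProduct.map (toEven 𝒜).toLinearMap
      (ExteriorAlgebra.ι k ∘ₗ oddClass 𝒜) (Δ v) := by
    rw [inclOne, coact₁, LinearMap.comp_apply, ← LinearMap.comp_apply, ← TensorProduct.map_comp,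
      LinearMap.id_comp]
  have h3 : phi g v - toEven 𝒜 v ⊗ₜ[k] 1 - inclOne 𝒜 (coact₁ v) = G (Δ v) := by
    rw [phi_apply, h1, h2]
    generalize Δ v = u
    induction u with
    | zero => simp
    | add x y hx hy => rw [map_add, map_add, map_add, map_add, ← hx, ← hy]; abel
    | tmul x y => simp only [G, TensorProduct.map_tmul, LinearMap.sub_apply, TensorProduct.tmul_sub]
  rw [h3]
  have h4 : LinearMap.range (TensorProduct.mapIncl V V) ≤ (modelFil F Q 2).comap G :=
    range_mapIncl_le fun x hx y hy => tmul_mem_modelFil (hF x hx) (hg y hy).2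
  exact h4 (hV v hv)

theorem IsApprox.phi_sub_mem_one (hg : IsApprox g V Q) (hV : IsSubcoalgebra V)
    (hF : ∀ v ∈ V, toEven 𝒜 v ∈ F) {v : A} (hv : v ∈ V) :
    phi g v - toEven 𝒜 v ⊗ₜ[k] 1 ∈ modelFil F Q 1 := by
  have h := add_mem (modelFil_anti one_le_two (hg.phi_sub_mem_two hV hF hv))
    (hg.coact₁_mem hV hF hv)
  rwa [sub_add_cancel] at h

theorem IsApprox.phi_mem_zero (hg : IsApprox g V Q) (hV : IsSubcoalgebra V)
    (hF : ∀ v ∈ V, toEven 𝒜 v ∈ F) {v : A} (hv : v ∈ V) : phi g v ∈ modelFil F Q 0 := by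
  have h := add_mem (modelFil_anti zero_le_one (hg.phi_sub_mem_one hV hF hv))
    (tmul_mem_modelFil (n := 0) (hF v hv) (by simpa using algebraMap_mem_powGE (extSub 𝒜 Q) 1))
  rwa [sub_add_cancel] at h

theorem IsApprox.phi_odd_mem (hg : IsApprox g V Q) (hV : IsSubcoalgebra V)
    (hF : ∀ v ∈ V, toEven 𝒜 v ∈ F) {v : A} (hv : v ∈ V) (hv1 : v ∈ 𝒜 1) :
    phi g v ∈ modelFil F Q 1 := by
  have h := hg.phi_sub_mem_one hV hF hv
  rwa [toEven_odd 𝒜 hv1, TensorProduct.zero_tmul, sub_zero] at h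

/-- An odd element `v` with `∑ v̄₁ ⊗ [v₂] = 1 ⊗ w` is sent to `1 ⊗ w`, up to degree `2`. -/
theorem IsApprox.phi_sub_mem_of_coact₁ (hg : IsApprox g V Q) (hV : IsSubcoalgebra V)
    (hF : ∀ v ∈ V, toEven 𝒜 v ∈ F) {v : A} (hv : v ∈ V) (hv1 : v ∈ 𝒜 1) {w : OddCotangent 𝒜}
    (hw : coact₁ v = 1 ⊗ₜ[k] w) :
    phi g v - 1 ⊗ₜ[k] ExteriorAlgebra.ι k w ∈ modelFil F Q 2 := by
  have h := hg.phi_sub_mem_two hV hF hv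
  rw [toEven_odd 𝒜 hv1, TensorProduct.zero_tmul, sub_zero, hw] at h
  exact h

end Phi

/-! ### The filtration by powers of the odd ideal -/

section OddFiltration

variable {k A : Type*} [Field k] [Ring A] [Algebra k A] (𝒜 : ZMod 2 → Submodule k A)

/-- The `n`-th power of the ideal generated by `A₁`, as a subspace. -/
def oddPow (n : ℕ) : Submodule k A := ⊤ * 𝒜 1 ^ n

variable {𝒜}

theorem mul_mem_oddPow_left {n : ℕ} (a : A) {x : A} (hx : x ∈ oddPow 𝒜 n) :
    a * x ∈ oddPow 𝒜 n := by
  have h : (⊤ : Submodule k A) * oddPow 𝒜 n ≤ oddPow 𝒜 n := by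
    rw [oddPow, ← mul_assoc]
    exact mul_le_mul' le_top le_rfl
  exact h (Submodule.mul_mem_mul trivial hx)

theorem oddPow_zero : oddPow 𝒜 0 = ⊤ := by
  rw [oddPow, pow_zero, mul_one]

theorem mem_oddPow_one {a : A} (ha : a ∈ 𝒜 1) : a ∈ oddPow 𝒜 1 := by
  rw [oddPow, pow_one]
  simpa using Submodule.mul_mem_mul (show (1 : A) ∈ (⊤ : Submodule k A) from trivial) ha

theorem oddPow_anti {n m : ℕ} (h : n ≤ m) : oddPow 𝒜 m ≤ oddPow 𝒜 n := by
  obtain ⟨r, rfl⟩ := Nat.exists_eq_add_of_le' h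
  rw [oddPow, pow_add, ← mul_assoc]
  exact mul_le_mul' le_top le_rfl

variable [GradedAlgebra 𝒜] [IsSuperCommutative k 𝒜]

theorem odd_mul_top_le {U : Submodule k A} (hU : U ≤ 𝒜 1) : U * ⊤ ≤ ⊤ * U := by
  rw [Submodule.mul_le]
  intro u hu a _
  have h : u * a = (pr 𝒜 0 a - pr 𝒜 1 a) * u := by
    conv_lhs => rw [← pr_zero_add_pr_one 𝒜 a]
    rw [mul_add, ← even_mul_comm (pr_mem 𝒜 0 a), odd_mul_comm (hU hu) (pr_mem 𝒜 1 a), sub_mul,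
      sub_eq_add_neg]
  rw [h]
  exact Submodule.mul_mem_mul trivial hu

theorem odd_pow_mul_top_le {U : Submodule k A} (hU : U ≤ 𝒜 1) (n : ℕ) : U ^ n * ⊤ ≤ ⊤ * U ^ n := by
  induction n with
  | zero => rw [pow_zero, one_mul, mul_one]
  | succ n ih =>
    calc U ^ (n + 1) * ⊤ = U ^ n * (U * ⊤) := by rw [pow_succ, mul_assoc]
      _ ≤ U ^ n * (⊤ * U) := mul_le_mul' le_rfl (odd_mul_top_le hU)
      _ = (U ^ n * ⊤) * U := by rw [mul_assoc]
      _ ≤ (⊤ * U ^ n) * U := mul_le_mul' ih le_rfl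
      _ = ⊤ * U ^ (n + 1) := by rw [pow_succ, mul_assoc]

theorem top_mul_pow_mul_le {U : Submodule k A} (hU : U ≤ 𝒜 1) (i j : ℕ) :
    (⊤ * U ^ i) * (⊤ * U ^ j) ≤ ⊤ * U ^ (i + j) :=
  calc (⊤ * U ^ i) * (⊤ * U ^ j) = ⊤ * (U ^ i * ⊤) * U ^ j := by simp only [mul_assoc]
    _ ≤ ⊤ * (⊤ * U ^ i) * U ^ j :=
      mul_le_mul' (mul_le_mul' le_rfl (odd_pow_mul_top_le hU i)) le_rfl
    _ = (⊤ * ⊤) * U ^ (i + j) := by simp only [mul_assoc, pow_add]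
    _ ≤ ⊤ * U ^ (i + j) := mul_le_mul' le_top le_rfl

theorem mul_mem_oddPow {i j n : ℕ} {x y : A} (hx : x ∈ oddPow 𝒜 i) (hy : y ∈ oddPow 𝒜 j)
    (h : i + j = n) : x * y ∈ oddPow 𝒜 n :=
  h ▸ top_mul_pow_mul_le le_rfl i j (Submodule.mul_mem_mul hx hy)

/-- A space of odd elements that generates the odd ideal up to its square generates each power of it
up to the next one. -/
theorem oddPow_le_of_le {U : Submodule k A} (hU : U ≤ 𝒜 1) (h : 𝒜 1 ≤ ⊤ * U ⊔ oddPow 𝒜 2)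
    (n : ℕ) : oddPow 𝒜 n ≤ ⊤ * U ^ n ⊔ oddPow 𝒜 (n + 1) := by
  have h1 : ∀ i, ⊤ * U ^ i ≤ oddPow 𝒜 i := fun i =>
    mul_le_mul' le_rfl (pow_le_pow_left' hU i)
  have h2 : ∀ {i j m}, i + j = m → oddPow 𝒜 i * oddPow 𝒜 j ≤ oddPow 𝒜 m := fun {i j m} e =>
    Submodule.mul_le.2 fun x hx y hy => mul_mem_oddPow hx hy e
  induction n with
  | zero => rw [pow_zero, mul_one]; exact le_sup_of_le_left le_top
  | succ n ih =>
    have e : oddPow 𝒜 (n + 1) = oddPow 𝒜 n * 𝒜 1 := by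
      rw [oddPow, oddPow, pow_succ, mul_assoc]
    have h3 : 𝒜 1 ≤ oddPow 𝒜 1 := fun x hx => mem_oddPow_one hx
    calc oddPow 𝒜 (n + 1) = oddPow 𝒜 n * 𝒜 1 := e
      _ ≤ (⊤ * U ^ n ⊔ oddPow 𝒜 (n + 1)) * 𝒜 1 := mul_le_mul' ih le_rfl
      _ = ⊤ * U ^ n * 𝒜 1 ⊔ oddPow 𝒜 (n + 1) * 𝒜 1 := Submodule.sup_mul _ _ _
      _ ≤ ⊤ * U ^ (n + 1) ⊔ oddPow 𝒜 (n + 1 + 1) := by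
        refine sup_le ?_ (le_sup_of_le_right ((mul_le_mul' le_rfl h3).trans (h2 rfl)))
        calc ⊤ * U ^ n * 𝒜 1 ≤ ⊤ * U ^ n * (⊤ * U ⊔ oddPow 𝒜 2) := mul_le_mul' le_rfl h
          _ = ⊤ * U ^ n * (⊤ * U ^ 1) ⊔ ⊤ * U ^ n * oddPow 𝒜 2 := by
            rw [Submodule.mul_sup, pow_one]
          _ ≤ _ := sup_le_sup (top_mul_pow_mul_le hU n 1)
            ((mul_le_mul' (h1 n) le_rfl).trans (h2 rfl))

/-- The kernel of `A → Ā` is `A A₁`. -/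
theorem mem_oddPow_one_of_mem_oddIdeal {a : A} (h : a ∈ oddIdeal 𝒜) : a ∈ oddPow 𝒜 1 := by
  have hJ : ∀ x : A, x ∈ oddPow 𝒜 1 → ∀ b, x * b ∈ oddPow 𝒜 1 := fun x hx b =>
    mul_mem_oddPow hx (j := 0) (by rw [oddPow_zero]; trivial) rfl
  let J : TwoSidedIdeal A := TwoSidedIdeal.mk' (oddPow 𝒜 1) (zero_mem _)
    (fun ha hb => add_mem ha hb) (fun ha => neg_mem ha) (fun hx => mul_mem_oddPow_left _ hx)
    (fun hx => hJ _ hx _)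
  have hmem : ∀ x, x ∈ J ↔ x ∈ oddPow 𝒜 1 := fun x => TwoSidedIdeal.mem_mk' _ _ _ _ _ _ _
  rw [oddIdeal, TwoSidedIdeal.mem_asIdeal] at h
  have h2 : TwoSidedIdeal.span (𝒜 1 : Set A) ≤ J :=
    TwoSidedIdeal.span_le.2 fun x hx => (hmem x).2 (mem_oddPow_one hx)
  exact (hmem a).1 (h2 h)

end OddFiltration

/-! ### Odd coinvariants -/

section Coinvariants

variable {k A : Type*} [Field k] [Ring A] [Algebra k A] [Coalgebra k A]
  (𝒜 : ZMod 2 → Submodule k A) [GradedAlgebra 𝒜] [SuperHopfAlgebra k 𝒜]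

local notation "Δ" => Coalgebra.comul (R := k) (A := A)
local notation "ε" => Coalgebra.counit (R := k) (A := A)

theorem toEven_anti_pr_zero (x : A) :
    toEven 𝒜 (anti 𝒜 (pr 𝒜 0 x)) = toEven 𝒜 (anti 𝒜 x) := by
  conv_rhs => rw [← pr_zero_add_pr_one 𝒜 x, map_add, map_add,
    toEven_odd 𝒜 (SuperHopfAlgebra.antipode_mem 1 _ (pr_mem 𝒜 1 x)), add_zero]

/-- The coaction `A → Ā ⊗ A` as an algebra map. -/
def coactionHom : A →ₐ[k] EvenQuotient 𝒜 ⊗[k] A :=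
  (GradedTensorProduct.lift 𝒜 𝒜 (Algebra.TensorProduct.includeLeft.comp (toEven 𝒜))
    Algebra.TensorProduct.includeRight (by
      intro i j a b
      rcases zmod_two_cases i with rfl | rfl
      · simp
      · have h1 := toEven_odd 𝒜 a.2
        simp only [AlgHom.comp_apply, h1, map_zero, mul_zero, zero_mul, smul_zero])).comp
    (comulHom 𝒜)

theorem coactionHom_apply (a : A) :
    coactionHom 𝒜 a = TensorProduct.map (toEven 𝒜).toLinearMap LinearMap.id (Δ a) := by
  change LinearMap.mul' k _ (TensorProduct.map _ _ (Δ a)) = _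
  generalize Δ a = w
  induction w with
  | zero => simp
  | add x y hx hy => simp only [map_add, hx, hy]
  | tmul x y => simp

variable {𝒜}

theorem coact₁_eq (a : A) :
    coact₁ (𝒜 := 𝒜) a = (oddClass 𝒜).lTensor (EvenQuotient 𝒜) (coactionHom 𝒜 a) := by
  rw [coactionHom_apply, coact₁, LinearMap.comp_apply]
  generalize Δ a = w
  induction w with
  | zero => simp
  | add x y hx hy => simp only [map_add, hx, hy]
  | tmul x y => simp

theorem coact₁_pr_one (a : A) : coact₁ (𝒜 := 𝒜) (pr 𝒜 1 a) = coact₁ a := by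
  rw [coact₁, LinearMap.comp_apply, LinearMap.comp_apply, comul_pr]
  generalize Δ a = w
  induction w with
  | zero => simp
  | add x y hx hy => simp only [map_add, hx, hy]
  | tmul x y =>
    have h1 : toEven 𝒜 (pr 𝒜 1 x) = 0 := toEven_odd 𝒜 (pr_mem 𝒜 1 x)
    have h2 : toEven 𝒜 (pr 𝒜 0 x) = toEven 𝒜 x := by
      conv_rhs => rw [← pr_zero_add_pr_one 𝒜 x, map_add, h1, add_zero]
    rw [tensorPr, LinearMap.add_apply, map_add]
    simp only [TensorProduct.map_tmul, AlgHom.toLinearMap_apply, h1, h2, oddClass_pr_one,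
      TensorProduct.zero_tmul, add_zero]

/-- `coact₁` is linear over the even elements: for an even `a`, only the even `a₁` and `a₂` matter
in `∑ ā₁ b̄₁ ⊗ [a₂ b₂]`, and then `[a₂ b₂] = ε(a₂) [b₂]`. -/
theorem coact₁_even_mul [IsSuperCommutative k 𝒜] {a : A} (ha : a ∈ 𝒜 0) (b : A) :
    coact₁ (𝒜 := 𝒜) (a * b) =
      (LinearMap.mulLeft k (toEven 𝒜 a)).rTensor (OddCotangent 𝒜) (coact₁ b) := by
  have key : ∀ (z : A ⊗[k] A) (w : EvenQuotient 𝒜 ⊗[k] A), z ∈ tensorGrading 𝒜 𝒜 0 →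
      (oddClass 𝒜).lTensor (EvenQuotient 𝒜)
        (TensorProduct.map (toEven 𝒜).toLinearMap LinearMap.id z * w) =
      (LinearMap.mulLeft k (LinearMap.mul' k _ (TensorProduct.map (toEven 𝒜).toLinearMap
        (counitTo (EvenQuotient 𝒜)) z))).rTensor (OddCotangent 𝒜)
        ((oddClass 𝒜).lTensor (EvenQuotient 𝒜) w) := by
    intro z w hz
    induction w with
    | zero => simp
    | add x y hx hy => rw [mul_add, map_add, map_add, map_add, hx, hy]
    | tmul q v =>
      refine eq_of_mem_tensorGrading (F := (oddClass 𝒜).lTensor (EvenQuotient 𝒜) ∘ₗ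
        LinearMap.mulRight k (q ⊗ₜ[k] v) ∘ₗ
          TensorProduct.map (toEven 𝒜).toLinearMap LinearMap.id)
        (G := LinearMap.mulRight k q |>.comp (LinearMap.mul' k _ ∘ₗ
          TensorProduct.map (toEven 𝒜).toLinearMap (counitTo (EvenQuotient 𝒜))) |> fun l =>
            (TensorProduct.mk k _ _).flip (oddClass 𝒜 v) ∘ₗ l) ?_ hz
      intro i j hij x hx y hy
      rcases zmod_two_cases i with rfl | rfl
      · obtain rfl : j = 0 := by simpa using hij
        simp [oddClass_mul, oddClass_of_even 𝒜 hy, counitTo, Algebra.algebraMap_eq_smul_one,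
          TensorProduct.smul_tmul', TensorProduct.tmul_smul, -Ideal.Quotient.mkₐ_eq_mk]
      · have h1 := toEven_odd 𝒜 hx
        simp [h1, -Ideal.Quotient.mkₐ_eq_mk]
  rw [coact₁_eq, map_mul, coactionHom_apply 𝒜 a, key _ _ (comul_mem 𝒜 ha), ← coact₁_eq]
  congr 2
  exact congrArg _ (conv_counit (toEven 𝒜).toLinearMap a)

/-- The map `x ↦ ∑ S((x₁)₀) (x₂)₁`, which produces odd elements that are coinvariant for `Ā` up to
the square of the odd ideal. -/
def oddCoinv (𝒜 : ZMod 2 → Submodule k A) [GradedAlgebra 𝒜] [SuperHopfAlgebra k 𝒜] : A →ₗ[k] A :=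
  LinearMap.mul' k A ∘ₗ TensorProduct.map (anti 𝒜 ∘ₗ pr 𝒜 0) (pr 𝒜 1) ∘ₗ Δ

theorem anti_mem {n : ZMod 2} {a : A} (ha : a ∈ 𝒜 n) : anti 𝒜 a ∈ 𝒜 n :=
  SuperHopfAlgebra.antipode_mem n a ha

theorem oddCoinv_mem (x : A) : oddCoinv 𝒜 x ∈ 𝒜 1 := by
  rw [oddCoinv, LinearMap.comp_apply, LinearMap.comp_apply]
  generalize Δ x = w
  induction w with
  | zero => simp
  | add x y hx hy => rw [map_add, map_add]; exact add_mem hx hy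
  | tmul x y => exact mul_mem_of_eq (anti_mem (pr_mem 𝒜 0 x)) (pr_mem 𝒜 1 y) (zero_add 1)

theorem oddCoinv_of_even {x : A} (hx : x ∈ 𝒜 0) : oddCoinv 𝒜 x = 0 := by
  refine eq_of_mem_tensorGrading (F := LinearMap.mul' k A ∘ₗ
    TensorProduct.map (anti 𝒜 ∘ₗ pr 𝒜 0) (pr 𝒜 1)) (G := 0) ?_ (comul_mem 𝒜 hx)
  intro i j hij x hx y hy
  rcases zmod_two_cases i with rfl | rfl
  · obtain rfl : j = 0 := by simpa using hij
    simp [pr_one_of_even hy, -GradedAlgebra.proj_apply]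
  · simp [pr_zero_of_odd hx, -GradedAlgebra.proj_apply]

variable [IsSuperCommutative k 𝒜]

/-- The part of exterior degree `1` of the image of `oddCoinv 𝒜 x` is `1 ⊗ [x]`: the antipode
cancels the first tensor factor of the coaction. -/
theorem coact₁_oddCoinv (x : A) : coact₁ (𝒜 := 𝒜) (oddCoinv 𝒜 x) = 1 ⊗ₜ[k] oddClass 𝒜 x := by
  let T : A ⊗[k] (A ⊗[k] A) →ₗ[k] EvenQuotient 𝒜 ⊗[k] OddCotangent 𝒜 :=
    (LinearMap.mul' k _).rTensor _ ∘ₗ (TensorProduct.assoc k _ _ _).symm.toLinearMap ∘ₗ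
      TensorProduct.map ((toEven 𝒜).toLinearMap ∘ₗ anti 𝒜)
        (TensorProduct.map (toEven 𝒜).toLinearMap (oddClass 𝒜))
  have h1 : ∀ w : A ⊗[k] A, coact₁ (𝒜 := 𝒜) (LinearMap.mul' k A
      (TensorProduct.map (anti 𝒜 ∘ₗ pr 𝒜 0) (pr 𝒜 1) w)) = T ((Δ).lTensor A w) := by
    intro w
    induction w with
    | zero => simp
    | add x y hx hy => simp only [map_add, hx, hy]
    | tmul x y =>
      rw [TensorProduct.map_tmul, LinearMap.mul'_apply, LinearMap.comp_apply,
        coact₁_even_mul (anti_mem (pr_mem 𝒜 0 x)), coact₁_pr_one, toEven_anti_pr_zero,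
        LinearMap.lTensor_tmul]
      rw [coact₁, LinearMap.comp_apply]
      generalize Δ y = u
      induction u with
      | zero => simp
      | add u v hu hv => simp only [map_add, TensorProduct.tmul_add, hu, hv]
      | tmul u v => rfl
  have h2 : ∀ w : A ⊗[k] A, T (TensorProduct.assoc k A A A ((Δ).rTensor A w)) =
      (TensorProduct.map (Algebra.linearMap k (EvenQuotient 𝒜) ∘ₗ ε) (oddClass 𝒜)) w := by
    intro w
    induction w with
    | zero => simp
    | add x y hx hy => simp only [map_add, hx, hy]
    | tmul x y =>
      have e := congrArg (toEven 𝒜) (LinearMap.congr_fun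
        (SuperHopfAlgebra.mul_antipode_rTensor_comul (k := k) (𝒜 := 𝒜)) x)
      simp only [LinearMap.comp_apply, Algebra.linearMap_apply, AlgHom.commutes] at e
      rw [TensorProduct.map_tmul, LinearMap.rTensor_tmul,
        LinearMap.comp_apply (Algebra.linearMap k (EvenQuotient 𝒜)), Algebra.linearMap_apply, ← e]
      generalize Δ x = u
      induction u with
      | zero => simp
      | add u v hu hv => simp only [map_add, TensorProduct.add_tmul, hu, hv]
      | tmul u v =>
        rw [LinearMap.rTensor_tmul, LinearMap.mul'_apply, map_mul]
        rfl
  have h3 : TensorProduct.map (Algebra.linearMap k (EvenQuotient 𝒜) ∘ₗ ε) (oddClass 𝒜) (Δ x) =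
      1 ⊗ₜ[k] oddClass 𝒜 x := by
    have e := congrArg (TensorProduct.map (Algebra.linearMap k (EvenQuotient 𝒜)) (oddClass 𝒜))
      (Coalgebra.rTensor_counit_comul (R := k) x)
    rw [TensorProduct.map_tmul, Algebra.linearMap_apply, map_one] at e
    rw [← e]
    generalize Δ x = w
    induction w with
    | zero => simp
    | add x y hx hy => simp only [map_add, hx, hy]
    | tmul x y => rfl
  rw [oddCoinv, LinearMap.comp_apply, LinearMap.comp_apply, h1, ← Coalgebra.coassoc_apply, h2, h3]

/-- Up to the square of the odd ideal, `oddCoinv` is linear over the even elements acting through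
the counit. The antipode is multiplicative, so that the factor `∑ S(a₁) a₂ = ε(a)` splits off; the
terms with odd `a₁` and `a₂` contain two odd factors. -/
theorem oddCoinv_even_mul_sub_mem {a : A} (ha : a ∈ 𝒜 0) (b : A) :
    oddCoinv 𝒜 (a * b) - ε a • oddCoinv 𝒜 b ∈ oddPow 𝒜 2 := by
  let P : A ⊗[k] A →ₗ[k] A := LinearMap.mul' k A ∘ₗ TensorProduct.map (anti 𝒜 ∘ₗ pr 𝒜 0) (pr 𝒜 1)
  let T : A ⊗[k] A →ₗ[k] A := LinearMap.mul' k A ∘ₗ (anti 𝒜).rTensor A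
  let O := GradedTensorProduct.of k 𝒜 𝒜
  have h4 : ∀ x ∈ 𝒜 1, ∀ y ∈ 𝒜 1, ∀ z : A, ∀ w, x * y * z * w ∈ oddPow 𝒜 2 := by
    intro x hx y hy z w
    have h := mul_mem_oddPow (mem_oddPow_one hx) (mem_oddPow_one hy) (n := 2) rfl
    have h0 : ∀ z : A, z ∈ oddPow 𝒜 0 := fun z => by rw [oddPow_zero]; trivial
    exact mul_mem_oddPow (mul_mem_oddPow h (h0 z) rfl) (h0 w) rfl
  have key : ∀ (z w : A ⊗[k] A), z ∈ tensorGrading 𝒜 𝒜 0 →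
      P (O.symm (O z * O w)) - T z * P w ∈ oddPow 𝒜 2 := by
    intro z w hz
    have hhom : ∀ n, ∀ u ∈ 𝒜 n, ∀ v,
        P (O.symm (O z * O (u ⊗ₜ[k] v))) - T z * P (u ⊗ₜ[k] v) ∈ oddPow 𝒜 2 := by
      intro n u hu v
      let G : A ⊗[k] A →ₗ[k] A := P ∘ₗ O.symm.toLinearMap ∘ₗ LinearMap.mulRight k (O (u ⊗ₜ[k] v)) ∘ₗ
        O.toLinearMap - LinearMap.mulRight k (P (u ⊗ₜ[k] v)) ∘ₗ T
      change z ∈ (oddPow 𝒜 2).comap G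
      refine tensorGrading_le ?_ hz
      intro i j hij x hx y hy
      have e1 : P (u ⊗ₜ[k] v) = anti 𝒜 (pr 𝒜 0 u) * pr 𝒜 1 v := rfl
      have e2 : T (x ⊗ₜ[k] y) = anti 𝒜 x * y := rfl
      have e3 : P (O.symm (O (x ⊗ₜ[k] y) * O (u ⊗ₜ[k] v))) =
          (-1 : ℤˣ) ^ (j * n) • (anti 𝒜 (pr 𝒜 0 (x * u)) * pr 𝒜 1 (y * v)) := by
        have e := GradedTensorProduct.tmul_coe_mul_coe_tmul 𝒜 𝒜 x ⟨y, hy⟩ ⟨u, hu⟩ v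
        have e' := congrArg (fun t => P (O.symm t)) e
        refine e'.trans ?_
        simp only [Units.smul_def, map_zsmul]
        rfl
      rw [Submodule.mem_comap]
      change P (O.symm (O (x ⊗ₜ[k] y) * O (u ⊗ₜ[k] v))) - T (x ⊗ₜ[k] y) * P (u ⊗ₜ[k] v) ∈ _
      rw [e1, e2, e3]
      rcases zmod_two_cases i with rfl | rfl
      · obtain rfl : j = 0 := by simpa using hij
        rw [pr_zero_mul, pr_one_mul, pr_of_mem hx, pr_of_mem hy, pr_one_of_even hx,
          pr_one_of_even hy, zero_mul, zero_mul, zero_mul, add_zero, add_zero, anti_mul, uzpow_zero,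
          one_smul]
        have : anti 𝒜 x * y * (anti 𝒜 (pr 𝒜 0 u) * pr 𝒜 1 v) =
            anti 𝒜 x * anti 𝒜 (pr 𝒜 0 u) * (y * pr 𝒜 1 v) := by
          rw [mul_assoc, mul_assoc, ← mul_assoc y, even_mul_comm hy, mul_assoc]
        rw [this, sub_self]
        exact zero_mem _
      · obtain rfl : j = 1 := (by decide : ∀ j : ZMod 2, 1 + j = 0 → j = 1) j hij
        rw [pr_zero_mul, pr_one_mul, pr_of_mem hx, pr_of_mem hy, pr_zero_of_odd hx,
          pr_zero_of_odd hy, zero_mul, zero_mul, zero_add, zero_add, anti_mul]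
        refine sub_mem ?_ ?_
        · have h5 : anti 𝒜 x * anti 𝒜 (pr 𝒜 1 u) * (y * pr 𝒜 0 v) ∈ oddPow 𝒜 2 := by
            have := h4 _ (anti_mem hx) _ (anti_mem (pr_mem 𝒜 1 u)) y (pr 𝒜 0 v)
            rwa [mul_assoc] at this
          rw [Units.smul_def]
          exact zsmul_mem h5 _
        · have := h4 _ (anti_mem hx) _ hy (anti 𝒜 (pr 𝒜 0 u)) (pr 𝒜 1 v)
          rwa [mul_assoc] at this
    induction w with
    | zero => simp
    | add x y hx hy =>
      have := add_mem hx hy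
      rw [map_add, mul_add, map_add, map_add, map_add, mul_add, add_sub_add_comm]
      exact this
    | tmul u v =>
      have := add_mem (hhom 0 _ (pr_mem 𝒜 0 u) v) (hhom 1 _ (pr_mem 𝒜 1 u) v)
      rw [← add_sub_add_comm, ← map_add P, ← map_add O.symm, ← mul_add, ← mul_add, ← map_add O,
        ← map_add P, ← TensorProduct.add_tmul, pr_zero_add_pr_one] at this
      exact this
  have h5 : oddCoinv 𝒜 (a * b) = P (O.symm (O (Δ a) * O (Δ b))) := by
    have e := SuperHopfAlgebra.comul_mul (𝒜 := 𝒜) a b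
    exact congrArg (fun t => P (O.symm t)) e
  have h6 : T (Δ a) = algebraMap k A (ε a) :=
    LinearMap.congr_fun (SuperHopfAlgebra.mul_antipode_rTensor_comul (k := k) (𝒜 := 𝒜)) a
  have h7 := key (Δ a) (Δ b) (comul_mem 𝒜 ha)
  rw [← h5, h6, ← Algebra.smul_def] at h7
  exact h7

/-- Up to the square of the odd ideal, `oddCoinv 𝒜 x` depends only on the class `[x]`. -/
theorem oddCoinv_mem_oddPow {x : A} (hx : oddClass 𝒜 x = 0) : oddCoinv 𝒜 x ∈ oddPow 𝒜 2 := by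
  have h1 : pr 𝒜 1 x ∈ (𝒜 0 ⊓ LinearMap.ker ε) * 𝒜 1 := by
    rwa [← oddClass_eq_zero_iff 𝒜 (pr_mem 𝒜 1 x), oddClass_pr_one]
  have h2 : (𝒜 0 ⊓ LinearMap.ker ε) * 𝒜 1 ≤ (oddPow 𝒜 2).comap (oddCoinv 𝒜) := by
    rw [Submodule.mul_le]
    rintro a ⟨ha, ha'⟩ b _
    have h := oddCoinv_even_mul_sub_mem ha b
    rw [SetLike.mem_coe, LinearMap.mem_ker] at ha'
    rwa [ha', zero_smul, sub_zero] at h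
  rw [← pr_zero_add_pr_one 𝒜 x, map_add, oddCoinv_of_even (pr_mem 𝒜 0 x), zero_add]
  exact h2 h1

/-- The odd part of `x` is `∑ x₁ P(x₂)` up to the square of the odd ideal, where `P` is
`oddCoinv`. -/
theorem mul_oddCoinv_sub_mem (x : A) :
    LinearMap.mul' k A ((oddCoinv 𝒜).lTensor A (Δ x)) - pr 𝒜 1 x ∈ oddPow 𝒜 2 := by
  let T : (A →ₗ[k] A) → A ⊗[k] (A ⊗[k] A) →ₗ[k] A := fun S => LinearMap.mul' k A ∘ₗ
    TensorProduct.map LinearMap.id (LinearMap.mul' k A ∘ₗ TensorProduct.map S (pr 𝒜 1))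
  -- `T S` at `∑ x₁ ⊗ x₂ ⊗ x₃` is `∑ x₁ S(x₂) (x₃)₁`; the odd part of `x₂` only contributes to the
  -- square of the odd ideal
  have h1 : LinearMap.mul' k A ((oddCoinv 𝒜).lTensor A (Δ x)) =
      T (anti 𝒜 ∘ₗ pr 𝒜 0) ((Δ).lTensor A (Δ x)) := by
    generalize Δ x = w
    induction w with
    | zero => simp
    | add x y hx hy => simp only [map_add, hx, hy]
    | tmul x y => rfl
  have h2 : T (anti 𝒜) ((Δ).lTensor A (Δ x)) = pr 𝒜 1 x := by
    have h3 : ∀ w : A ⊗[k] A, T (anti 𝒜) (TensorProduct.assoc k A A A ((Δ).rTensor A w)) =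
        LinearMap.mul' k A (TensorProduct.map (Algebra.linearMap k A ∘ₗ ε) (pr 𝒜 1) w) := by
      intro w
      induction w with
      | zero => simp
      | add x y hx hy => simp only [map_add, hx, hy]
      | tmul x y =>
        have e := LinearMap.congr_fun
          (SuperHopfAlgebra.mul_antipode_lTensor_comul (k := k) (𝒜 := 𝒜)) x
        rw [LinearMap.comp_apply, LinearMap.comp_apply] at e
        rw [LinearMap.rTensor_tmul, TensorProduct.map_tmul, LinearMap.mul'_apply, ← e]
        generalize Δ x = u
        induction u with
        | zero => simp
        | add u v hu hv => simp only [map_add, TensorProduct.add_tmul, add_mul, hu, hv]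
        | tmul u v =>
          change u * (anti 𝒜 v * pr 𝒜 1 y) = u * anti 𝒜 v * pr 𝒜 1 y
          rw [mul_assoc]
    rw [← Coalgebra.coassoc_apply, h3]
    exact counit_conv (pr 𝒜 1) x
  rw [h1, ← h2, ← LinearMap.sub_apply, ← Submodule.mem_comap]
  generalize (Δ).lTensor A (Δ x) = w
  induction w with
  | zero => exact zero_mem _
  | add x y hx hy => exact add_mem hx hy
  | tmul x y =>
    induction y with
    | zero => rw [TensorProduct.tmul_zero]; exact zero_mem _
    | add y z hy hz => rw [TensorProduct.tmul_add]; exact add_mem hy hz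
    | tmul y z =>
      change x * (anti 𝒜 (pr 𝒜 0 y) * pr 𝒜 1 z) - x * (anti 𝒜 y * pr 𝒜 1 z) ∈ oddPow 𝒜 2
      rw [← mul_sub, ← sub_mul, ← map_sub]
      refine mul_mem_oddPow_left _ (mul_mem_oddPow (i := 1) (j := 1) (mem_oddPow_one (anti_mem ?_))
        (mem_oddPow_one (pr_mem 𝒜 1 z)) rfl)
      conv => arg 2; arg 2; rw [← pr_zero_add_pr_one 𝒜 y]
      rw [sub_add_cancel_left]
      exact neg_mem (pr_mem 𝒜 1 y)

end Coinvariants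

/-! ### The kernel of `phi` and the powers of the odd ideal -/

section Separation

variable {k A : Type*} [Field k] [Ring A] [Algebra k A] [Coalgebra k A]
  {𝒜 : ZMod 2 → Submodule k A} [GradedAlgebra 𝒜] [SuperHopfAlgebra k 𝒜]

local notation "Δ" => Coalgebra.comul (R := k) (A := A)
local notation "ε" => Coalgebra.counit (R := k) (A := A)

theorem phi_mem_modelFil {g : A →ₐ[k] ExteriorOdd 𝒜} (hg : IsApprox g ⊤ ⊤) {n : ℕ} {x : A}
    (hx : x ∈ oddPow 𝒜 n) : phi g x ∈ modelFil ⊤ ⊤ n := by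
  have h0 : ∀ a, phi g a ∈ modelFil ⊤ ⊤ 0 := fun a =>
    hg.phi_mem_zero (F := ⊤) isSubcoalgebra_top (fun _ _ => trivial) (v := a) trivial
  have h1 : ∀ a ∈ 𝒜 1, phi g a ∈ modelFil ⊤ ⊤ 1 := fun a ha =>
    hg.phi_odd_mem (F := ⊤) isSubcoalgebra_top (fun _ _ => trivial) trivial ha
  have h2 : ∀ n, 𝒜 1 ^ n ≤ (modelFil ⊤ ⊤ n).comap (phi g).toLinearMap := by
    intro n
    induction n with
    | zero => exact fun a _ => h0 a
    | succ n ih =>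
      rw [pow_succ, Submodule.mul_le]
      intro a ha b hb
      rw [Submodule.mem_comap, AlgHom.toLinearMap_apply, map_mul]
      exact mul_mem_modelFil (ih ha) (h1 b hb) rfl
  have h3 : oddPow 𝒜 n ≤ (modelFil ⊤ ⊤ n).comap (phi g).toLinearMap := by
    rw [oddPow, Submodule.mul_le]
    intro a _ b hb
    rw [Submodule.mem_comap, AlgHom.toLinearMap_apply, map_mul]
    exact mul_mem_modelFil (h0 a) (h2 n hb) (zero_add n)
  exact h3 hx

variable [IsSuperCommutative k 𝒜]

/-- There is a section of `A₁ → W^A` which is coinvariant for `Ā` up to the square of the odd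
ideal, and whose image generates the odd ideal up to its square. -/
theorem exists_coinvariant_section (g : A →ₐ[k] ExteriorOdd 𝒜) (hg : IsApprox g ⊤ ⊤) :
    ∃ θ : OddCotangent 𝒜 →ₗ[k] A, (∀ w, θ w ∈ 𝒜 1) ∧
      (∀ w, phi g (θ w) - 1 ⊗ₜ[k] ExteriorAlgebra.ι k w ∈ modelFil ⊤ ⊤ 2) ∧
      𝒜 1 ≤ ⊤ * LinearMap.range θ ⊔ oddPow 𝒜 2 := by
  obtain ⟨s, hs⟩ := (oddClass 𝒜).exists_rightInverse_of_surjective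
    (LinearMap.range_eq_top.2 fun w => (oddClass_surjective 𝒜 w).imp fun _ h => h.2)
  have hs' : ∀ w, oddClass 𝒜 (s w) = w := LinearMap.congr_fun hs
  have hθ : ∀ x, (oddCoinv 𝒜 ∘ₗ s) (oddClass 𝒜 x) - oddCoinv 𝒜 x ∈ oddPow 𝒜 2 := by
    intro x
    rw [LinearMap.comp_apply, ← map_sub]
    exact oddCoinv_mem_oddPow (by rw [map_sub, hs', sub_self])
  refine ⟨oddCoinv 𝒜 ∘ₗ s, fun w => oddCoinv_mem _, fun w => ?_, fun x hx => ?_⟩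
  · refine hg.phi_sub_mem_of_coact₁ (F := ⊤) isSubcoalgebra_top (fun _ _ => trivial) trivial
      (oddCoinv_mem _) ?_
    rw [coact₁_oddCoinv, hs']
  · have h1 := mul_oddCoinv_sub_mem (𝒜 := 𝒜) x
    rw [pr_of_mem hx] at h1
    have h2 : ∀ w : A ⊗[k] A, LinearMap.mul' k A ((oddCoinv 𝒜).lTensor A w) ∈
        ⊤ * LinearMap.range (oddCoinv 𝒜 ∘ₗ s) ⊔ oddPow 𝒜 2 := by
      intro w
      induction w with
      | zero => simp
      | add x y hx hy => rw [map_add, map_add]; exact add_mem hx hy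
      | tmul x y =>
        rw [LinearMap.lTensor_tmul, LinearMap.mul'_apply,
          ← sub_sub_cancel ((oddCoinv 𝒜 ∘ₗ s) (oddClass 𝒜 y)) (oddCoinv 𝒜 y), mul_sub]
        exact sub_mem
          (Submodule.mem_sup_left (Submodule.mul_mem_mul trivial ⟨_, rfl⟩))
          (Submodule.mem_sup_right (mul_mem_oddPow_left _ (hθ y)))
    have h3 := sub_mem (h2 (Δ x)) (Submodule.mem_sup_right h1)
    rwa [sub_sub_cancel] at h3

/-- The kernel of `phi g` is contained in all powers of the odd ideal. A linear section of `A → Ā`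
and a coinvariant section of `A₁ → W^A` give a map `Ψ` in the other direction, such that `Ψ (phi g
x) - x` is in `I ^ (n + 1)` for every `x` in `I ^ n`. -/
theorem mem_oddPow_of_phi_eq_zero (hk : ringChar k ≠ 2) {g : A →ₐ[k] ExteriorOdd 𝒜}
    (hg : IsApprox g ⊤ ⊤) {x : A} (hx : phi g x = 0) (n : ℕ) : x ∈ oddPow 𝒜 n := by
  obtain ⟨θ, hθ1, hθ2, hθ3⟩ := exists_coinvariant_section g hg
  -- odd elements have square zero, so the section extends to an algebra map
  let Θ : ExteriorOdd 𝒜 →ₐ[k] A := ExteriorAlgebra.lift k ⟨θ, fun w => odd_sq_zero hk (hθ1 w)⟩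
  have hΘι : ∀ w, Θ (ExteriorAlgebra.ι k w) = θ w := fun w => ExteriorAlgebra.lift_ι_apply _ _ _ _
  have hrange : LinearMap.range θ = (extSub 𝒜 ⊤).map Θ.toLinearMap := by
    ext x
    constructor
    · rintro ⟨w, rfl⟩
      exact ⟨_, ⟨w, trivial, rfl⟩, hΘι w⟩
    · rintro ⟨_, ⟨w, -, rfl⟩, rfl⟩
      exact ⟨w, (hΘι w).symm⟩
  have hrange1 : LinearMap.range θ ≤ 𝒜 1 := by rintro _ ⟨w, rfl⟩; exact hθ1 w
  obtain ⟨s, hs⟩ := (toEven 𝒜).toLinearMap.exists_rightInverse_of_surjective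
    (LinearMap.range_eq_top.2 Ideal.Quotient.mk_surjective)
  have hs' : ∀ w, toEven 𝒜 (s w) = w := LinearMap.congr_fun hs
  have hs1 : ∀ a, s (toEven 𝒜 a) - a ∈ oddPow 𝒜 1 := fun a =>
    mem_oddPow_one_of_mem_oddIdeal (Ideal.Quotient.eq_zero_iff_mem.1
      (show toEven 𝒜 (s (toEven 𝒜 a) - a) = 0 by rw [map_sub, hs', sub_self]))
  -- a left inverse of `phi g` on the associated graded spaces, see `key` below
  let Ψ : Model 𝒜 →ₗ[k] A := LinearMap.mul' k A ∘ₗ TensorProduct.map s Θ.toLinearMap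
  have hΨ : ∀ a w, Ψ (a ⊗ₜ[k] w) = s a * Θ w := fun _ _ => rfl
  have hΘpow : ∀ m, (extSub 𝒜 ⊤ ^ m).map Θ.toLinearMap = LinearMap.range θ ^ m := fun m => by
    rw [Submodule.map_pow, hrange]
  have hΘ1 : ∀ m, extSub 𝒜 ⊤ ^ m ≤ (oddPow 𝒜 m).comap Θ.toLinearMap := fun m => by
    rw [← Submodule.map_le_iff_le_comap, hΘpow]
    intro x hx
    rw [oddPow, ← one_mul x]
    exact Submodule.mul_mem_mul trivial (pow_le_pow_left' hrange1 m hx)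
  have hΨ1 : ∀ n, modelFil ⊤ ⊤ n ≤ (oddPow 𝒜 n).comap Ψ := fun n => by
    refine modelFil_le fun a _ w hw => mul_mem_oddPow_left _ ?_
    have : powGE (extSub 𝒜 ⊤) n ≤ (oddPow 𝒜 n).comap Θ.toLinearMap := powGE_le fun m hm =>
      (hΘ1 m).trans (Submodule.comap_mono (oddPow_anti hm))
    exact this hw
  -- `phi g ∘ Θ` is the inclusion of `∧(W^A)`, up to terms of higher exterior degree
  have hφ1 : ∀ n, extSub 𝒜 ⊤ ^ n ≤ (modelFil ⊤ ⊤ (n + 1)).comap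
      ((phi g).toLinearMap ∘ₗ Θ.toLinearMap - TensorProduct.mk k _ _ 1) := by
    intro n
    induction n with
    | zero =>
      rw [pow_zero, Submodule.one_le]
      rw [Submodule.mem_comap]
      change phi g (Θ 1) - 1 ⊗ₜ 1 ∈ modelFil ⊤ ⊤ _
      rw [map_one, map_one, Algebra.TensorProduct.one_def, sub_self]
      exact zero_mem _
    | succ n ih =>
      rw [pow_succ, Submodule.mul_le]
      rintro a ha _ ⟨w, -, rfl⟩
      have h1 : phi g (Θ a) ∈ modelFil ⊤ ⊤ n := phi_mem_modelFil hg (hΘ1 n ha)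
      have h2 : phi g (Θ a) - 1 ⊗ₜ a ∈ modelFil ⊤ ⊤ (n + 1) := ih ha
      have h3 : (1 : EvenQuotient 𝒜) ⊗ₜ[k] ExteriorAlgebra.ι k w ∈ modelFil ⊤ ⊤ 1 :=
        tmul_mem_modelFil trivial (mem_powGE_one ⟨w, trivial, rfl⟩)
      have h4 := add_mem (mul_mem_modelFil h1 (hθ2 w) rfl) (mul_mem_modelFil h2 h3 rfl)
      rw [Submodule.mem_comap]
      change phi g (Θ (a * ExteriorAlgebra.ι k w)) - 1 ⊗ₜ (a * ExteriorAlgebra.ι k w) ∈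
        modelFil ⊤ ⊤ _
      rw [map_mul, map_mul, hΘι]
      have e : (1 : EvenQuotient 𝒜) ⊗ₜ[k] (a * ExteriorAlgebra.ι k w) =
          1 ⊗ₜ[k] a * 1 ⊗ₜ[k] ExteriorAlgebra.ι k w := by
        rw [Algebra.TensorProduct.tmul_mul_tmul, one_mul]
      rw [e]
      convert h4 using 1
      rw [mul_sub, sub_mul, sub_add_sub_cancel]
  -- `I ^ n` is spanned by the `a * Θ τ` with `τ` of degree `n`, up to `I ^ (n + 1)`
  have key : ∀ n, oddPow 𝒜 n ≤ (oddPow 𝒜 (n + 1)).comap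
      (Ψ ∘ₗ (phi g).toLinearMap - LinearMap.id) := by
    intro n
    refine (oddPow_le_of_le hrange1 hθ3 n).trans (sup_le ?_ ?_)
    · rw [Submodule.mul_le]
      intro a _ t ht
      rw [← hΘpow] at ht
      obtain ⟨τ, hτ, rfl⟩ := ht
      rw [Submodule.mem_comap]
      change Ψ (phi g (a * Θ τ)) - a * Θ τ ∈ oddPow 𝒜 (n + 1)
      have h1 : phi g a - toEven 𝒜 a ⊗ₜ 1 ∈ modelFil ⊤ ⊤ 1 :=
        hg.phi_sub_mem_one (F := ⊤) isSubcoalgebra_top (fun _ _ => trivial) trivial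
      have h2 : phi g (Θ τ) ∈ modelFil ⊤ ⊤ n := phi_mem_modelFil hg (hΘ1 n hτ)
      have h3 : phi g (Θ τ) - 1 ⊗ₜ τ ∈ modelFil ⊤ ⊤ (n + 1) := hφ1 n hτ
      have h4 : toEven 𝒜 a ⊗ₜ[k] (1 : ExteriorOdd 𝒜) ∈ modelFil ⊤ ⊤ 0 :=
        tmul_mem_modelFil trivial (by simpa using algebraMap_mem_powGE (extSub 𝒜 ⊤) 1)
      have h5 : phi g (a * Θ τ) - toEven 𝒜 a ⊗ₜ τ ∈ modelFil ⊤ ⊤ (n + 1) := by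
        have e : toEven 𝒜 a ⊗ₜ[k] τ = toEven 𝒜 a ⊗ₜ[k] 1 * 1 ⊗ₜ[k] τ := by
          rw [Algebra.TensorProduct.tmul_mul_tmul, one_mul, mul_one]
        rw [e, map_mul]
        convert add_mem (mul_mem_modelFil h1 h2 (add_comm 1 n))
          (mul_mem_modelFil h4 h3 (zero_add _)) using 1
        rw [mul_sub, sub_mul, sub_add_sub_cancel]
      have h6 := hΨ1 _ h5
      rw [Submodule.mem_comap, map_sub, hΨ] at h6
      have h7 := add_mem h6 (mul_mem_oddPow (hs1 a) (hΘ1 n hτ) (add_comm 1 n))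
      convert h7 using 1
      rw [AlgHom.toLinearMap_apply, sub_mul]
      abel
    · intro y hy
      have h1 : Ψ (phi g y) ∈ oddPow 𝒜 (n + 1) := hΨ1 _ (phi_mem_modelFil hg hy)
      exact sub_mem h1 hy
  induction n with
  | zero => rw [oddPow_zero]; trivial
  | succ n ih =>
    have h := key n ih
    rw [Submodule.mem_comap, LinearMap.sub_apply, LinearMap.comp_apply, AlgHom.toLinearMap_apply,
      hx, map_zero, zero_sub] at h
    exact neg_mem_iff.1 h

end Separation

/-! ### Nilpotency -/

section Nilpotent

variable {k R : Type*} [Field k] [Ring R] [Algebra k R]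

/-- A finite-dimensional space of square-zero elements is nilpotent: its powers are images of
exterior powers. -/
theorem pow_eq_bot_of_sq_zero {U : Submodule k R} [FiniteDimensional k U]
    (hU : ∀ u ∈ U, u * u = 0) {n : ℕ} (hn : Module.finrank k U < n) : U ^ n = ⊥ := by
  let Θ : ExteriorAlgebra k U →ₐ[k] R := ExteriorAlgebra.lift k ⟨U.subtype, fun u => hU u u.2⟩
  have h1 : LinearMap.range (ExteriorAlgebra.ι k (M := U)) ^ n = ⊥ := by
    have h := exteriorPower.finrank_eq (R := k) (M := U) (n := n)
    rw [Nat.choose_eq_zero_of_lt hn] at h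
    exact Submodule.finrank_eq_zero.1 h
  have h2 : (LinearMap.range (ExteriorAlgebra.ι k (M := U))).map Θ.toLinearMap = U := by
    rw [← LinearMap.range_comp]
    have : Θ.toLinearMap ∘ₗ ExteriorAlgebra.ι k = U.subtype :=
      LinearMap.ext fun u => ExteriorAlgebra.lift_ι_apply _ _ _ _
    rw [this, Submodule.range_subtype]
  rw [← h2, ← Submodule.map_pow, h1, Submodule.map_bot]

theorem extSub_pow_eq_bot {A : Type*} [Ring A] [Algebra k A] [Coalgebra k A]
    {𝒜 : ZMod 2 → Submodule k A} (Q : Submodule k (OddCotangent 𝒜)) [FiniteDimensional k Q]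
    {n : ℕ} (hn : Module.finrank k Q < n) : extSub 𝒜 Q ^ n = ⊥ := by
  have : FiniteDimensional k (extSub 𝒜 Q) := inferInstanceAs
    (FiniteDimensional k (Q.map (ExteriorAlgebra.ι k)))
  refine pow_eq_bot_of_sq_zero ?_ (lt_of_le_of_lt ?_ hn)
  · rintro _ ⟨w, -, rfl⟩
    exact ExteriorAlgebra.ι_sq_zero w
  · exact Submodule.finrank_map_le (ExteriorAlgebra.ι k) Q

variable {A : Type*} [Ring A] [Algebra k A] {𝒜 : ZMod 2 → Submodule k A} [GradedAlgebra 𝒜]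
  [IsSuperCommutative k 𝒜]

/-- If `A` is generated by homogeneous elements, then `A₁` is contained in the left ideal generated
by the odd generators. -/
theorem odd_le_of_adjoin_eq_top {s : Set A} (hs : ∀ a ∈ s, a ∈ 𝒜 0 ∨ a ∈ 𝒜 1)
    (h : Algebra.adjoin k s = ⊤) : 𝒜 1 ≤ ⊤ * Submodule.span k (s ∩ 𝒜 1) := by
  set U := Submodule.span k (s ∩ 𝒜 1) with hU
  have hU1 : U ≤ 𝒜 1 := Submodule.span_le.2 Set.inter_subset_right
  have hl : ∀ a : A, ∀ x ∈ ⊤ * U, a * x ∈ ⊤ * U := fun a x hx => by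
    have : (⊤ : Submodule k A) * (⊤ * U) ≤ ⊤ * U := by
      rw [← mul_assoc]; exact mul_le_mul' le_top le_rfl
    exact this (Submodule.mul_mem_mul trivial hx)
  have hr : ∀ a : A, ∀ x ∈ ⊤ * U, x * a ∈ ⊤ * U := fun a x hx => by
    have : (⊤ * U) * (⊤ : Submodule k A) ≤ ⊤ * U := by
      rw [mul_assoc]
      refine (mul_le_mul' le_rfl (odd_mul_top_le hU1)).trans ?_
      rw [← mul_assoc]; exact mul_le_mul' le_top le_rfl
    exact this (Submodule.mul_mem_mul hx trivial)
  have key : ∀ a ∈ Algebra.adjoin k s, pr 𝒜 1 a ∈ ⊤ * U := by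
    intro a ha
    induction ha using Algebra.adjoin_induction with
    | mem x hx =>
      rcases hs x hx with h0 | h1
      · rw [pr_one_of_even h0]; exact zero_mem _
      · rw [pr_of_mem h1, ← one_mul x]
        exact Submodule.mul_mem_mul trivial (Submodule.subset_span ⟨hx, h1⟩)
    | algebraMap r =>
      rw [pr_one_of_even (SetLike.algebraMap_mem_graded 𝒜 r)]; exact zero_mem _
    | add x y _ _ hx hy => rw [map_add]; exact add_mem hx hy
    | mul x y _ _ hx hy => rw [pr_one_mul]; exact add_mem (hl _ _ hy) (hr _ _ hx)
  intro a ha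
  rw [← pr_of_mem ha]
  exact key a (h ▸ Algebra.mem_top)

/-- In a finitely generated super commutative algebra the odd ideal is nilpotent. -/
theorem exists_oddPow_eq_bot (hk : ringChar k ≠ 2) {s : Set A} (hfin : s.Finite)
    (hs : ∀ a ∈ s, a ∈ 𝒜 0 ∨ a ∈ 𝒜 1) (h : Algebra.adjoin k s = ⊤) : ∃ n, oddPow 𝒜 n = ⊥ := by
  have h1 := odd_le_of_adjoin_eq_top hs h
  set U := Submodule.span k (s ∩ 𝒜 1) with hU
  have hU1 : U ≤ 𝒜 1 := Submodule.span_le.2 Set.inter_subset_right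
  have : FiniteDimensional k U :=
    FiniteDimensional.span_of_finite k (hfin.subset Set.inter_subset_left)
  have h0 := pow_eq_bot_of_sq_zero (fun u hu => odd_sq_zero hk (hU1 hu))
    (Nat.lt_succ_self (Module.finrank k U))
  have h2 : ∀ n, oddPow 𝒜 n ≤ ⊤ * U ^ n := by
    intro n
    induction n with
    | zero => rw [oddPow, pow_zero, pow_zero]
    | succ n ih =>
      calc oddPow 𝒜 (n + 1) = oddPow 𝒜 n * 𝒜 1 := by rw [oddPow, oddPow, pow_succ, mul_assoc]
        _ ≤ (⊤ * U ^ n) * (⊤ * U ^ 1) := mul_le_mul' ih (by rwa [pow_one])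
        _ ≤ _ := top_mul_pow_mul_le hU1 n 1
  refine ⟨Module.finrank k U + 1, ?_⟩
  rw [← le_bot_iff]
  refine (h2 _).trans ?_
  rw [h0, Submodule.mul_bot]

end Nilpotent

/-! ### Sub super Hopf algebras -/

section SubSuperAlgebra

variable {k A : Type*} [Field k] [Ring A] [Algebra k A] (𝒜 : ZMod 2 → Submodule k A)

/-- The grading of a subalgebra of a super algebra. -/
def subGrading (D : Subalgebra k A) (i : ZMod 2) : Submodule k D := (𝒜 i).comap D.val.toLinearMap

variable [GradedAlgebra 𝒜]

/-- A subalgebra which contains the homogeneous components of its elements. -/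
class IsSuperSubalgebra (D : Subalgebra k A) : Prop where
  pr_mem : ∀ i, ∀ a ∈ D, pr 𝒜 i a ∈ D

theorem isSuperSubalgebra_adjoin {s : Set A} (hs : ∀ a ∈ s, a ∈ 𝒜 0 ∨ a ∈ 𝒜 1) :
    IsSuperSubalgebra 𝒜 (Algebra.adjoin k s) := by
  have key : ∀ a ∈ Algebra.adjoin k s,
      pr 𝒜 0 a ∈ Algebra.adjoin k s ∧ pr 𝒜 1 a ∈ Algebra.adjoin k s := by
    intro a ha
    induction ha using Algebra.adjoin_induction with
    | mem x hx =>
      have := Algebra.subset_adjoin (R := k) hx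
      rcases hs x hx with h0 | h1
      · rw [pr_one_of_even h0, pr_of_mem h0]; exact ⟨this, zero_mem _⟩
      · rw [pr_zero_of_odd h1, pr_of_mem h1]; exact ⟨zero_mem _, this⟩
    | algebraMap r =>
      have h0 : algebraMap k A r ∈ 𝒜 0 := SetLike.algebraMap_mem_graded 𝒜 r
      rw [pr_one_of_even h0, pr_of_mem h0]
      exact ⟨Subalgebra.algebraMap_mem _ r, zero_mem _⟩
    | add x y _ _ hx hy => rw [map_add, map_add]; exact ⟨add_mem hx.1 hy.1, add_mem hx.2 hy.2⟩
    | mul x y _ _ hx hy =>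
      rw [pr_zero_mul, pr_one_mul]
      exact ⟨add_mem (mul_mem hx.1 hy.1) (mul_mem hx.2 hy.2),
        add_mem (mul_mem hx.1 hy.2) (mul_mem hx.2 hy.1)⟩
  refine ⟨fun i a ha => ?_⟩
  rcases zmod_two_cases i with rfl | rfl
  · exact (key a ha).1
  · exact (key a ha).2

variable (D : Subalgebra k A) [IsSuperSubalgebra 𝒜 D]

/-- The projection of a super subalgebra to its component of parity `i`. -/
def subPr (i : ZMod 2) : D →ₗ[k] D :=
  (pr 𝒜 i ∘ₗ D.val.toLinearMap).codRestrict (Subalgebra.toSubmodule D)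
    fun a => IsSuperSubalgebra.pr_mem i _ a.2

/-- The component of parity `i` of an element of a super subalgebra. -/
def subComponent (i : ZMod 2) : D →ₗ[k] subGrading 𝒜 D i :=
  (subPr 𝒜 D i).codRestrict (subGrading 𝒜 D i) fun a => pr_mem 𝒜 i (a : A)

instance : DirectSum.Decomposition (subGrading 𝒜 D) :=
  DirectSum.Decomposition.ofLinearMap (subGrading 𝒜 D)
    (DirectSum.lof k (ZMod 2) (fun i => subGrading 𝒜 D i) 0 ∘ₗ subComponent 𝒜 D 0 +
      DirectSum.lof k (ZMod 2) (fun i => subGrading 𝒜 D i) 1 ∘ₗ subComponent 𝒜 D 1)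
    (by
      ext a
      rw [LinearMap.comp_apply, LinearMap.add_apply, map_add, LinearMap.comp_apply,
        LinearMap.comp_apply, DirectSum.coeLinearMap_lof, DirectSum.coeLinearMap_lof]
      exact pr_zero_add_pr_one 𝒜 (a : A))
    (by
      refine DirectSum.linearMap_ext k fun i => LinearMap.ext fun x => ?_
      have hx : (x : D).1 ∈ 𝒜 i := x.2
      rw [LinearMap.comp_apply, LinearMap.comp_apply, DirectSum.coeLinearMap_lof,
        LinearMap.add_apply, LinearMap.comp_apply, LinearMap.comp_apply, LinearMap.comp_apply,
        LinearMap.id_apply]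
      rcases zmod_two_cases i with rfl | rfl
      · have h0 : subComponent 𝒜 D 0 x = x := Subtype.ext (Subtype.ext (pr_of_mem hx))
        have h1 : subComponent 𝒜 D 1 x = 0 := Subtype.ext (Subtype.ext (pr_one_of_even hx))
        rw [h0, h1, map_zero, add_zero]
      · have h1 : subComponent 𝒜 D 1 x = x := Subtype.ext (Subtype.ext (pr_of_mem hx))
        have h0 : subComponent 𝒜 D 0 x = 0 := Subtype.ext (Subtype.ext (pr_zero_of_odd hx))
        rw [h0, h1, map_zero, zero_add])

instance : GradedAlgebra (subGrading 𝒜 D) where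
  one_mem := SetLike.one_mem_graded 𝒜
  mul_mem _ _ _ _ ha hb := SetLike.mul_mem_graded (A := 𝒜) ha hb

theorem coe_pr_sub (i : ZMod 2) (a : D) : (pr (subGrading 𝒜 D) i a : A) = pr 𝒜 i (a : A) := by
  have h : ∀ j, (pr (subGrading 𝒜 D) j a : A) ∈ 𝒜 j := fun j => pr_mem (subGrading 𝒜 D) j a
  have e : (pr (subGrading 𝒜 D) 0 a : A) + (pr (subGrading 𝒜 D) 1 a : A) = a :=
    congrArg Subtype.val (pr_zero_add_pr_one (subGrading 𝒜 D) a)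
  rw [← e, map_add]
  rcases zmod_two_cases i with rfl | rfl
  · rw [pr_of_mem (h 0), pr_zero_of_odd (h 1), add_zero]
  · rw [pr_of_mem (h 1), pr_one_of_even (h 0), zero_add]

instance [IsSuperCommutative k 𝒜] : IsSuperCommutative k (subGrading 𝒜 D) where
  even_comm _ ha b := Subtype.ext (even_mul_comm (𝒜 := 𝒜) ha (b : A))
  odd_anticomm _ ha _ hb := Subtype.ext (odd_mul_comm (𝒜 := 𝒜) ha hb)

/-- The inclusion `D ⊗ D → A ⊗ A`. -/
abbrev subTensor (D : Subalgebra k A) : D ⊗[k] D →ₗ[k] A ⊗[k] A :=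
  TensorProduct.map D.val.toLinearMap D.val.toLinearMap

theorem subTensor_injective (D : Subalgebra k A) : Function.Injective (subTensor D) :=
  TensorProduct.map_injective_of_flat_flat _ _ Subtype.val_injective Subtype.val_injective

theorem tensorPr_subTensor (n : ZMod 2) (z : D ⊗[k] D) :
    tensorPr 𝒜 𝒜 n (subTensor D z) =
      subTensor D (tensorPr (subGrading 𝒜 D) (subGrading 𝒜 D) n z) := by
  induction z with
  | zero => simp
  | add x y hx hy => simp only [map_add, hx, hy]
  | tmul x y =>
    simp only [tensorPr, LinearMap.add_apply, TensorProduct.map_tmul, map_add,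
      AlgHom.toLinearMap_apply, Subalgebra.val_apply, coe_pr_sub]

/-- The inclusion `D ⊗ D → A ⊗ A` is multiplicative for the graded products. -/
theorem subTensor_mul (z w : D ⊗[k] D) :
    GradedTensorProduct.of k 𝒜 𝒜 (subTensor D z) * GradedTensorProduct.of k 𝒜 𝒜 (subTensor D w) =
      GradedTensorProduct.of k 𝒜 𝒜 (subTensor D
        ((GradedTensorProduct.of k (subGrading 𝒜 D) (subGrading 𝒜 D)).symm
          (GradedTensorProduct.of k (subGrading 𝒜 D) (subGrading 𝒜 D) z *
            GradedTensorProduct.of k (subGrading 𝒜 D) (subGrading 𝒜 D) w))) := by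
  induction z with
  | zero => simp
  | add x y hx hy => simp only [map_add, add_mul, hx, hy]
  | tmul x y =>
    induction w with
    | zero => simp
    | add x y hx hy => simp only [map_add, mul_add, hx, hy]
    | tmul u v =>
      have hhom : ∀ i j, ∀ y ∈ subGrading 𝒜 D i, ∀ u ∈ subGrading 𝒜 D j,
          GradedTensorProduct.of k 𝒜 𝒜 (subTensor D (x ⊗ₜ y)) *
            GradedTensorProduct.of k 𝒜 𝒜 (subTensor D (u ⊗ₜ v)) =
          GradedTensorProduct.of k 𝒜 𝒜 (subTensor D
          ((GradedTensorProduct.of k (subGrading 𝒜 D) (subGrading 𝒜 D)).symm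
          (GradedTensorProduct.of k (subGrading 𝒜 D) (subGrading 𝒜 D) (x ⊗ₜ y) *
            GradedTensorProduct.of k (subGrading 𝒜 D) (subGrading 𝒜 D) (u ⊗ₜ v)))) := by
        intro i j y hy u hu
        have e1 := GradedTensorProduct.tmul_coe_mul_coe_tmul 𝒜 𝒜 (x : A) ⟨y, hy⟩ ⟨u, hu⟩ (v : A)
        have e2 := GradedTensorProduct.tmul_coe_mul_coe_tmul (subGrading 𝒜 D) (subGrading 𝒜 D)
          x ⟨y, hy⟩ ⟨u, hu⟩ v
        refine e1.trans ?_
        refine Eq.trans ?_ (congrArg (fun t => GradedTensorProduct.of k 𝒜 𝒜 (subTensor D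
          ((GradedTensorProduct.of k (subGrading 𝒜 D) (subGrading 𝒜 D)).symm t))) e2).symm
        simp only [Units.smul_def, map_zsmul]
        rfl
      have h := fun i j => hhom i j _ (pr_mem _ i y) _ (pr_mem _ j u)
      rw [← pr_zero_add_pr_one (subGrading 𝒜 D) y, ← pr_zero_add_pr_one (subGrading 𝒜 D) u]
      simp only [TensorProduct.tmul_add, TensorProduct.add_tmul, map_add, mul_add, add_mul, h]

end SubSuperAlgebra

/-! ### Restriction of the super Hopf structure -/

section Restriction

variable {k A D : Type*} [Field k] [AddCommGroup A] [Module k A] [AddCommGroup D] [Module k D]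
  (i : D →ₗ[k] A) (δ : D →ₗ[k] D ⊗[k] D) (δ' : A →ₗ[k] A ⊗[k] A)

theorem map_assoc_rTensor (h : ∀ a, TensorProduct.map i i (δ a) = δ' (i a)) (w : D ⊗[k] D) :
    TensorProduct.map i (TensorProduct.map i i) (TensorProduct.assoc k D D D (δ.rTensor D w)) =
      TensorProduct.assoc k A A A (δ'.rTensor A (TensorProduct.map i i w)) := by
  induction w with
  | zero => simp
  | add x y hx hy => simp only [map_add, hx, hy]
  | tmul x y =>
    rw [LinearMap.rTensor_tmul, TensorProduct.map_tmul, LinearMap.rTensor_tmul, ← h]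
    generalize δ x = u
    induction u with
    | zero => simp
    | add u v hu hv => simp only [map_add, TensorProduct.add_tmul, hu, hv]
    | tmul u v => rfl

theorem map_lTensor_comul (h : ∀ a, TensorProduct.map i i (δ a) = δ' (i a)) (w : D ⊗[k] D) :
    TensorProduct.map i (TensorProduct.map i i) (δ.lTensor D w) =
      δ'.lTensor A (TensorProduct.map i i w) := by
  induction w with
  | zero => simp
  | add x y hx hy => simp only [map_add, hx, hy]
  | tmul x y => rw [LinearMap.lTensor_tmul, TensorProduct.map_tmul, h]; rfl

end Restriction

section SubHopf

variable {k A : Type*} [Field k] [Ring A] [Algebra k A] [Coalgebra k A]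

local notation "Δ" => Coalgebra.comul (R := k) (A := A)
local notation "ε" => Coalgebra.counit (R := k) (A := A)

/-- A subalgebra which is a subcoalgebra. -/
class IsSubbialgebra (D : Subalgebra k A) : Prop where
  comul_mem : IsSubcoalgebra (Subalgebra.toSubmodule D)

section Coalgebra

variable (D : Subalgebra k A) [IsSubbialgebra D]

/-- The restriction of the coproduct to a subalgebra which is a subcoalgebra. -/
def subComul : D →ₗ[k] D ⊗[k] D :=
  (LinearEquiv.ofInjective (subTensor D) (subTensor_injective D)).symm.toLinearMap ∘ₗ
    (Δ ∘ₗ D.val.toLinearMap).codRestrict (LinearMap.range (subTensor D))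
      fun a => IsSubbialgebra.comul_mem (D := D) _ a.2

theorem subTensor_subComul (a : D) : subTensor D (subComul D a) = Δ (a : A) := by
  have h := LinearEquiv.ofInjective_apply (h := subTensor_injective D) (subTensor D) (subComul D a)
  rw [← h, subComul, LinearMap.comp_apply, LinearEquiv.coe_coe, LinearEquiv.apply_symm_apply]
  rfl

instance : Coalgebra k D where
  comul := subComul D
  counit := ε ∘ₗ D.val.toLinearMap
  coassoc := by
    ext a
    have hinj : Function.Injective (TensorProduct.map D.val.toLinearMap (subTensor D)) :=
      TensorProduct.map_injective_of_flat_flat _ _ Subtype.val_injective (subTensor_injective D)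
    apply hinj
    change TensorProduct.map D.val.toLinearMap (subTensor D)
      (TensorProduct.assoc k D D D ((subComul D).rTensor D (subComul D a))) =
        TensorProduct.map D.val.toLinearMap (subTensor D) ((subComul D).lTensor D (subComul D a))
    have h1 := map_assoc_rTensor D.val.toLinearMap (subComul D) Δ (subTensor_subComul D)
    have h2 := map_lTensor_comul D.val.toLinearMap (subComul D) Δ (subTensor_subComul D)
    rw [subTensor, h1, h2, subTensor_subComul, Coalgebra.coassoc_apply]
  rTensor_counit_comp_comul := by
    ext a
    have hinj : Function.Injective (D.val.toLinearMap.lTensor k) :=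
      Module.Flat.lTensor_preserves_injective_linearMap _ Subtype.val_injective
    apply hinj
    have h1 : ∀ w : D ⊗[k] D, D.val.toLinearMap.lTensor k
        ((ε ∘ₗ D.val.toLinearMap).rTensor D w) = (ε).rTensor A (subTensor D w) := by
      intro w
      induction w with
      | zero => simp
      | add x y hx hy => simp only [map_add, hx, hy]
      | tmul x y => rfl
    change D.val.toLinearMap.lTensor k ((ε ∘ₗ D.val.toLinearMap).rTensor D (subComul D a)) = _
    rw [h1, subTensor_subComul, Coalgebra.rTensor_counit_comul]
    rfl
  lTensor_counit_comp_comul := by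
    ext a
    have hinj : Function.Injective (D.val.toLinearMap.rTensor k) :=
      Module.Flat.rTensor_preserves_injective_linearMap _ Subtype.val_injective
    apply hinj
    have h1 : ∀ w : D ⊗[k] D, D.val.toLinearMap.rTensor k
        ((ε ∘ₗ D.val.toLinearMap).lTensor D w) = (ε).lTensor A (subTensor D w) := by
      intro w
      induction w with
      | zero => simp
      | add x y hx hy => simp only [map_add, hx, hy]
      | tmul x y => rfl
    change D.val.toLinearMap.rTensor k ((ε ∘ₗ D.val.toLinearMap).lTensor D (subComul D a)) = _
    rw [h1, subTensor_subComul, Coalgebra.lTensor_counit_comul]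
    rfl

theorem subTensor_comul (a : D) :
    subTensor D (Coalgebra.comul (R := k) a) = Δ (a : A) := subTensor_subComul D a

end Coalgebra

variable (𝒜 : ZMod 2 → Submodule k A) [GradedAlgebra 𝒜] [SuperHopfAlgebra k 𝒜]

/-- A sub super Hopf algebra. -/
class IsSubSuperHopf (D : Subalgebra k A) : Prop extends IsSuperSubalgebra 𝒜 D,
    IsSubbialgebra D where
  anti_mem : ∀ a ∈ D, anti 𝒜 a ∈ D

/-- The restriction of the antipode to a sub super Hopf algebra. -/
def subAnti (D : Subalgebra k A) [IsSubSuperHopf 𝒜 D] : D →ₗ[k] D :=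
  (anti 𝒜 ∘ₗ D.val.toLinearMap).codRestrict (Subalgebra.toSubmodule D)
    fun a => IsSubSuperHopf.anti_mem _ a.2

instance (D : Subalgebra k A) [IsSubSuperHopf 𝒜 D] : SuperHopfAlgebra k (subGrading 𝒜 D) where
  comul_mem n a ha := by
    have h : tensorPr (subGrading 𝒜 D) (subGrading 𝒜 D) n (Coalgebra.comul (R := k) a) =
        Coalgebra.comul (R := k) a := by
      apply subTensor_injective D
      rw [← tensorPr_subTensor, subTensor_comul]
      exact tensorPr_of_mem (comul_mem 𝒜 ha)
    rw [← h]
    exact tensorPr_mem _ _ n _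
  comul_one := by
    have h : Coalgebra.comul (R := k) (1 : D) = 1 ⊗ₜ[k] 1 := by
      apply subTensor_injective D
      rw [subTensor_comul]
      exact SuperHopfAlgebra.comul_one (𝒜 := 𝒜)
    rw [h]
    rfl
  comul_mul a b := by
    apply (GradedTensorProduct.of k (subGrading 𝒜 D) (subGrading 𝒜 D)).symm.injective
    apply subTensor_injective D
    apply (GradedTensorProduct.of k 𝒜 𝒜).injective
    rw [← subTensor_mul, GradedTensorProduct.of_symm_of, subTensor_comul, subTensor_comul,
      subTensor_comul]
    exact SuperHopfAlgebra.comul_mul (a : A) (b : A)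
  counit_odd a ha := counit_of_odd 𝒜 (a := (a : A)) ha
  counit_one := SuperHopfAlgebra.counit_one 𝒜
  counit_mul a b := SuperHopfAlgebra.counit_mul (𝒜 := 𝒜) (a : A) (b : A)
  antipode := subAnti 𝒜 D
  antipode_mem n a ha := anti_mem (𝒜 := 𝒜) (a := (a : A)) ha
  mul_antipode_rTensor_comul := by
    ext a
    have h : ∀ w : D ⊗[k] D, (LinearMap.mul' k D ((subAnti 𝒜 D).rTensor D w) : A) =
        LinearMap.mul' k A ((anti 𝒜).rTensor A (subTensor D w)) := by
      intro w
      induction w with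
      | zero => simp
      | add x y hx hy => rw [map_add, map_add, map_add, map_add, map_add, ← hx, ← hy]; rfl
      | tmul x y => rfl
    refine (h _).trans ?_
    rw [subTensor_comul]
    exact LinearMap.congr_fun
      (SuperHopfAlgebra.mul_antipode_rTensor_comul (k := k) (𝒜 := 𝒜)) (a : A)
  mul_antipode_lTensor_comul := by
    ext a
    have h : ∀ w : D ⊗[k] D, (LinearMap.mul' k D ((subAnti 𝒜 D).lTensor D w) : A) =
        LinearMap.mul' k A ((anti 𝒜).lTensor A (subTensor D w)) := by
      intro w
      induction w with
      | zero => simp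
      | add x y hx hy => rw [map_add, map_add, map_add, map_add, map_add, ← hx, ← hy]; rfl
      | tmul x y => rfl
    refine (h _).trans ?_
    rw [subTensor_comul]
    exact LinearMap.congr_fun
      (SuperHopfAlgebra.mul_antipode_lTensor_comul (k := k) (𝒜 := 𝒜)) (a : A)

/-! ### Finitely generated sub super Hopf algebras -/

variable {𝒜}

/-- It suffices to test the coproduct on generators, since it is multiplicative for the graded
product of `A ⊗ A`. -/
theorem isSubcoalgebra_of_adjoin {s : Set A} [IsSuperSubalgebra 𝒜 (Algebra.adjoin k s)]
    (h : ∀ a ∈ s, Δ a ∈ LinearMap.range (subTensor (Algebra.adjoin k s))) :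
    IsSubbialgebra (Algebra.adjoin k s) := by
  set D := Algebra.adjoin k s with hD
  let Γ : Subalgebra k (GradedTensorProduct k 𝒜 𝒜) :=
    { carrier := {z | (GradedTensorProduct.of k 𝒜 𝒜).symm z ∈ LinearMap.range (subTensor D)}
      add_mem' := fun ha hb => (LinearMap.range (subTensor D)).add_mem ha hb
      mul_mem' := by
        rintro a b ⟨z, hz⟩ ⟨w, hw⟩
        have h := subTensor_mul 𝒜 D z w
        rw [hz, hw] at h
        exact ⟨_, congrArg (GradedTensorProduct.of k 𝒜 𝒜).symm h.symm⟩
      algebraMap_mem' := fun r => ⟨algebraMap k D r ⊗ₜ 1, rfl⟩ }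
  have h1 : D ≤ Γ.comap (comulHom 𝒜) := Algebra.adjoin_le h
  exact ⟨fun a ha => h1 ha⟩

/-- If `D` contains the antipodes of the elements of a subcoalgebra `V`, then their coproducts are
in `D ⊗ D`, by `comul_anti`. -/
theorem comul_anti_mem {D : Subalgebra k A} [IsSuperSubalgebra 𝒜 D] {V : Submodule k A}
    (hV : IsSubcoalgebra V) (hVD : ∀ v ∈ V, anti 𝒜 v ∈ D) {v : A} (hv : v ∈ V) :
    Δ (anti 𝒜 v) ∈ LinearMap.range (subTensor D) := by
  have h := comul_anti 𝒜 v
  have h1 : LinearMap.range (TensorProduct.mapIncl V V) ≤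
      (LinearMap.range (subTensor D)).comap ((GradedTensorProduct.of k 𝒜 𝒜).symm.toLinearMap ∘ₗ
        LinearMap.mul' k _ ∘ₗ (TensorProduct.map
        ((GradedTensorProduct.includeRight 𝒜 𝒜).toLinearMap ∘ₗ anti 𝒜)
        ((GradedTensorProduct.includeLeft 𝒜 𝒜).toLinearMap ∘ₗ anti 𝒜))) := by
    refine range_mapIncl_le fun x hx y hy => ?_
    have h2 := subTensor_mul 𝒜 D (1 ⊗ₜ ⟨_, hVD x hx⟩) (⟨_, hVD y hy⟩ ⊗ₜ 1)
    exact ⟨_, congrArg (GradedTensorProduct.of k 𝒜 𝒜).symm h2.symm⟩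
  have h3 := h1 (hV v hv)
  rw [Submodule.mem_comap, LinearMap.comp_apply, LinearMap.comp_apply, ← h] at h3
  exact h3

/-- The homogeneous components of the elements of a subcoalgebra span a subcoalgebra. -/
theorem IsSubcoalgebra.homogeneous {V : Submodule k A} (hV : IsSubcoalgebra V) :
    IsSubcoalgebra (V.map (pr 𝒜 0) ⊔ V.map (pr 𝒜 1)) := by
  set V' := V.map (pr 𝒜 0) ⊔ V.map (pr 𝒜 1)
  have hpr : ∀ i, ∀ v ∈ V, pr 𝒜 i v ∈ V' := by
    intro i v hv
    rcases zmod_two_cases i with rfl | rfl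
    · exact Submodule.mem_sup_left ⟨v, hv, rfl⟩
    · exact Submodule.mem_sup_right ⟨v, hv, rfl⟩
  have key : ∀ n, ∀ v ∈ V, Δ (pr 𝒜 n v) ∈ LinearMap.range (TensorProduct.mapIncl V' V') := by
    intro n v hv
    rw [comul_pr]
    have h : LinearMap.range (TensorProduct.mapIncl V V) ≤
        (LinearMap.range (TensorProduct.mapIncl V' V')).comap (tensorPr 𝒜 𝒜 n) :=
      range_mapIncl_le fun x hx y hy => add_mem
        (tmul_mem_range_mapIncl (hpr 0 x hx) (hpr n y hy))
        (tmul_mem_range_mapIncl (hpr 1 x hx) (hpr (n + 1) y hy))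
    exact h (hV v hv)
  have h : V' ≤ (LinearMap.range (TensorProduct.mapIncl V' V')).comap Δ := by
    refine sup_le ?_ ?_ <;> rintro _ ⟨v, hv, rfl⟩
    · exact key 0 v hv
    · exact key 1 v hv
  exact fun v hv => h hv

variable [IsSuperCommutative k 𝒜]

/-- Every finite set is contained in a sub super Hopf algebra which is generated by finitely many
homogeneous elements. -/
theorem exists_subSuperHopf (F : Set A) (hF : F.Finite) : ∃ t : Set A, t.Finite ∧
    (∀ a ∈ t, a ∈ 𝒜 0 ∨ a ∈ 𝒜 1) ∧ IsSubSuperHopf 𝒜 (Algebra.adjoin k t) ∧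
      F ⊆ Algebra.adjoin k t := by
  choose V hVfin hcV hV using exists_finiteDimensional_subcoalgebra (k := k) (C := A)
  have : Finite F := hF
  have hfin : FiniteDimensional k (⨆ c : F, V c : Submodule k A) :=
    Submodule.finiteDimensional_iSup _
  have hsub := IsSubcoalgebra.iSup fun c : F => hV c
  set V₀ := (⨆ c : F, V c : Submodule k A)
  obtain ⟨s, hs⟩ := (Submodule.fg_iff_finiteDimensional V₀).2 hfin
  set V' := V₀.map (pr 𝒜 0) ⊔ V₀.map (pr 𝒜 1) with hV'
  have hV'sub : IsSubcoalgebra V' := hsub.homogeneous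
  let s' : Set A := pr 𝒜 0 '' s ∪ pr 𝒜 1 '' s
  have hs' : V' = Submodule.span k s' := by
    rw [hV', ← hs, Submodule.map_span, Submodule.map_span, ← Submodule.span_union]
  have hs'hom : ∀ a ∈ s', a ∈ 𝒜 0 ∨ a ∈ 𝒜 1 := by
    rintro _ (⟨a, -, rfl⟩ | ⟨a, -, rfl⟩)
    · exact Or.inl (pr_mem 𝒜 0 a)
    · exact Or.inr (pr_mem 𝒜 1 a)
  have hs'fin : s'.Finite := (s.finite_toSet.image _).union (s.finite_toSet.image _)
  -- the antipode is an involution, so that this set is stable under it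
  let t : Set A := s' ∪ anti 𝒜 '' s'
  have ht : ∀ a ∈ t, a ∈ 𝒜 0 ∨ a ∈ 𝒜 1 := by
    rintro _ (h | ⟨a, h, rfl⟩)
    · exact hs'hom _ h
    · exact (hs'hom _ h).imp anti_mem anti_mem
  have : IsSuperSubalgebra 𝒜 (Algebra.adjoin k t) := isSuperSubalgebra_adjoin 𝒜 ht
  have hV'D : V' ≤ Subalgebra.toSubmodule (Algebra.adjoin k t) := by
    rw [hs', Submodule.span_le]
    exact fun a ha => Algebra.subset_adjoin (Or.inl ha)
  have hSV'D : ∀ v ∈ V', anti 𝒜 v ∈ Algebra.adjoin k t := by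
    change V' ≤ (Subalgebra.toSubmodule (Algebra.adjoin k t)).comap (anti 𝒜)
    rw [hs', Submodule.span_le]
    exact fun a ha => Algebra.subset_adjoin (Or.inr ⟨a, ha, rfl⟩)
  have hmem : ∀ a ∈ s', a ∈ V' := fun a ha => hs' ▸ Submodule.subset_span ha
  have hD : IsSubbialgebra (Algebra.adjoin k t) := by
    refine isSubcoalgebra_of_adjoin (𝒜 := 𝒜) ?_
    rintro _ (h | ⟨a, h, rfl⟩)
    · exact mapIncl_mono hV'D hV'D (hV'sub _ (hmem _ h))
    · exact comul_anti_mem hV'sub hSV'D (hmem _ h)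
  refine ⟨t, hs'fin.union (hs'fin.image _), ht, { anti_mem := ?_ }, ?_⟩
  · have h : Algebra.adjoin k t ≤ (Algebra.adjoin k t).comap (antiHom 𝒜) := by
      refine Algebra.adjoin_le ?_
      rintro _ (h | ⟨a, h, rfl⟩)
      · exact hSV'D _ (hmem _ h)
      · change anti 𝒜 (anti 𝒜 a) ∈ Algebra.adjoin k t
        rw [anti_anti]
        exact hV'D (hmem _ h)
    exact h
  · intro a ha
    have h : a ∈ V₀ := Submodule.mem_iSup_of_mem ⟨a, ha⟩ (hcV a)
    rw [← pr_zero_add_pr_one 𝒜 a]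
    exact hV'D (add_mem (Submodule.mem_sup_left ⟨a, h, rfl⟩) (Submodule.mem_sup_right ⟨a, h, rfl⟩))

end SubHopf

/-! ### Injectivity -/

section Injectivity

variable {k A : Type*} [Field k] [Ring A] [Algebra k A] {𝒜 : ZMod 2 → Submodule k A}

/-- Membership in a power of the odd ideal only involves finitely many elements of `A`. -/
theorem exists_finite_mem_oddPow {n : ℕ} {x : A} (hx : x ∈ oddPow 𝒜 n) :
    ∃ F : Set A, F.Finite ∧ ∀ D : Submodule k A, F ⊆ D → x ∈ D * (D ⊓ 𝒜 1) ^ n := by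
  have h1 : ∀ n, ∀ x ∈ 𝒜 1 ^ n, ∃ F : Set A, F.Finite ∧ ∀ D : Submodule k A, F ⊆ D →
      x ∈ (D ⊓ 𝒜 1) ^ n := by
    intro n
    induction n with
    | zero => exact fun x hx => ⟨∅, Set.finite_empty, fun D _ => by rwa [pow_zero] at hx ⊢⟩
    | succ n ih =>
      intro x hx
      rw [pow_succ] at hx
      induction hx using Submodule.mul_induction_on' with
      | mem_mul_mem a ha b hb =>
        obtain ⟨F, hF, h⟩ := ih a ha
        refine ⟨insert b F, hF.insert b, fun D hD => ?_⟩
        rw [pow_succ]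
        exact Submodule.mul_mem_mul (h D ((Set.subset_insert _ _).trans hD))
          ⟨hD (Set.mem_insert _ _), hb⟩
      | add a _ b _ ha hb =>
        obtain ⟨F, hF, h⟩ := ha
        obtain ⟨F', hF', h'⟩ := hb
        exact ⟨F ∪ F', hF.union hF', fun D hD => add_mem (h D (Set.subset_union_left.trans hD))
          (h' D (Set.subset_union_right.trans hD))⟩
  rw [oddPow] at hx
  induction hx using Submodule.mul_induction_on' with
  | mem_mul_mem a ha b hb =>
    obtain ⟨F, hF, h⟩ := h1 n b hb
    exact ⟨insert a F, hF.insert a, fun D hD => Submodule.mul_mem_mul (hD (Set.mem_insert _ _))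
      (h D ((Set.subset_insert _ _).trans hD))⟩
  | add a _ b _ ha hb =>
    obtain ⟨F, hF, h⟩ := ha
    obtain ⟨F', hF', h'⟩ := hb
    exact ⟨F ∪ F', hF.union hF', fun D hD => add_mem (h D (Set.subset_union_left.trans hD))
      (h' D (Set.subset_union_right.trans hD))⟩

theorem mem_oddPow_subGrading {D : Subalgebra k A} {n : ℕ} {x : D}
    (hx : (x : A) ∈ Subalgebra.toSubmodule D * (Subalgebra.toSubmodule D ⊓ 𝒜 1) ^ n) :
    x ∈ oddPow (subGrading 𝒜 D) n := by
  have h1 : (⊤ : Submodule k D).map D.val.toLinearMap = Subalgebra.toSubmodule D := by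
    ext a
    exact ⟨fun ⟨b, _, hb⟩ => hb ▸ b.2, fun ha => ⟨⟨a, ha⟩, trivial, rfl⟩⟩
  have h2 : (subGrading 𝒜 D 1).map D.val.toLinearMap = Subalgebra.toSubmodule D ⊓ 𝒜 1 := by
    ext a
    exact ⟨fun ⟨b, hb, e⟩ => e ▸ ⟨b.2, hb⟩, fun ha => ⟨⟨a, ha.1⟩, ha.2, rfl⟩⟩
  rw [← h2, ← Submodule.map_pow, ← h1, ← Submodule.map_mul] at hx
  obtain ⟨y, hy, e⟩ := hx
  rwa [← Subtype.val_injective e]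

variable [Coalgebra k A]

/-- A subcoalgebra of `A` contained in `D` is a subcoalgebra of `D`. -/
theorem IsSubcoalgebra.comap_val {V : Submodule k A} (hV : IsSubcoalgebra V) (D : Subalgebra k A)
    [IsSubbialgebra D] (hVD : V ≤ Subalgebra.toSubmodule D) :
    IsSubcoalgebra (V.comap D.val.toLinearMap) := by
  intro v hv
  have h : LinearMap.range (TensorProduct.mapIncl V V) ≤
      (LinearMap.range (TensorProduct.mapIncl (V.comap D.val.toLinearMap)
        (V.comap D.val.toLinearMap))).map (subTensor D) :=
    range_mapIncl_le fun x hx y hy => ⟨⟨x, hVD hx⟩ ⊗ₜ ⟨y, hVD hy⟩,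
      tmul_mem_range_mapIncl (x := (⟨x, hVD hx⟩ : D)) (y := (⟨y, hVD hy⟩ : D)) hx hy, rfl⟩
  obtain ⟨z, hz, e⟩ := h (hV v hv)
  change _ = Coalgebra.comul (R := k) (v : A) at e
  rw [← subTensor_comul] at e
  rwa [← subTensor_injective D e]

variable [GradedAlgebra 𝒜] [SuperHopfAlgebra k 𝒜]

/-- An element of a subcoalgebra `V` whose odd classes span a space of dimension less than `n`
is sent to `0` when it lies in the `n`-th power of the odd ideal. -/
theorem phi_eq_zero_of_mem_oddPow {g : A →ₐ[k] ExteriorOdd 𝒜} {V : Submodule k A}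
    {U : Submodule k (OddCotangent 𝒜)} [FiniteDimensional k U] (hV : IsSubcoalgebra V)
    (hgV : IsApprox g V U) (hg : IsApprox g ⊤ ⊤) {n : ℕ} (hn : Module.finrank k U < n) {x : A}
    (hxV : x ∈ V) (hx : x ∈ oddPow 𝒜 n) : phi g x = 0 := by
  obtain ⟨r, hr⟩ := U.subtype.exists_leftInverse_of_injective U.ker_subtype
  -- `phi g x` is in `Ā ⊗ ∧(U)`, hence fixed by the retraction `ρ`. It also has degree at least `n`,
  -- and `∧(U)` vanishes in these degrees.
  let ρ : ExteriorOdd 𝒜 →ₐ[k] ExteriorOdd 𝒜 := ExteriorAlgebra.map (U.subtype ∘ₗ r)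
  have hρι : ∀ w, ρ (ExteriorAlgebra.ι k w) = ExteriorAlgebra.ι k (r w : OddCotangent 𝒜) :=
    fun w => ExteriorAlgebra.map_apply_ι _ _
  let M : Model 𝒜 →ₗ[k] Model 𝒜 := TensorProduct.map LinearMap.id ρ.toLinearMap
  have h1 : modelFil ⊤ U 0 ≤ LinearMap.eqLocus M LinearMap.id := by
    refine modelFil_le fun a _ w hw => ?_
    have h2 : powGE (extSub 𝒜 U) 0 ≤
        Subalgebra.toSubmodule (AlgHom.equalizer ρ (AlgHom.id k _)) := by
      refine powGE_le fun m _ => ?_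
      induction m with
      | zero => rw [pow_zero, Submodule.one_le]; exact one_mem (AlgHom.equalizer ρ (AlgHom.id k _))
      | succ m ih =>
        rw [pow_succ, Submodule.mul_le]
        rintro a ha _ ⟨u, hu, rfl⟩
        refine mul_mem (s := AlgHom.equalizer ρ (AlgHom.id k _)) (ih (Nat.zero_le _) ha) ?_
        change ρ _ = _
        rw [hρι]
        exact congrArg _ (congrArg Subtype.val (LinearMap.congr_fun hr ⟨u, hu⟩))
    have h3 : ρ w = w := h2 hw
    change a ⊗ₜ ρ w = a ⊗ₜ w
    rw [h3]
  have h2 : modelFil ⊤ ⊤ n ≤ LinearMap.ker M := by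
    refine modelFil_le fun a _ w hw => ?_
    have e : (extSub 𝒜 ⊤).map ρ.toLinearMap ≤ extSub 𝒜 U := by
      rintro _ ⟨_, ⟨w, -, rfl⟩, rfl⟩
      exact ⟨_, (r w).2, (hρι w).symm⟩
    have h3 : ρ w ∈ powGE (extSub 𝒜 U) n :=
      powGE_mono e n (map_powGE ρ _ n ▸ Submodule.mem_map_of_mem hw)
    rw [powGE_eq_bot (extSub_pow_eq_bot U hn), Submodule.mem_bot] at h3
    change a ⊗ₜ ρ w = 0
    rw [h3, TensorProduct.tmul_zero]
  have h3 : M (phi g x) = phi g x := h1 (hgV.phi_mem_zero (F := ⊤) hV (fun _ _ => trivial) hxV)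
  rw [← h3]
  exact h2 (phi_mem_modelFil hg hx)

variable [IsSuperCommutative k 𝒜]

/-- `phi g` is injective. An element of the kernel is in all powers of the odd ideal of `A`, hence
in a high power of the odd ideal of a suitable finitely generated sub super Hopf algebra `D`. There
it is in the kernel of an injective map `phi γ`, which need not be the restriction of `phi g`. -/
theorem phi_injective (hk : ringChar k ≠ 2) {g : A →ₐ[k] ExteriorOdd 𝒜} (hg : IsApprox g ⊤ ⊤) :
    Function.Injective (phi g) := by
  classical
  rw [injective_iff_map_eq_zero]
  intro x hx
  obtain ⟨V, hVfin, hxV, hV⟩ := exists_finiteDimensional_subcoalgebra (k := k) x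
  obtain ⟨s, hs⟩ := (Submodule.fg_iff_finiteDimensional V).2 hVfin
  -- `n` is larger than the dimension of the space of odd classes of `V` in any `D` containing `V`
  set n := Module.finrank k V + 1 with hn
  obtain ⟨F, hF, hFx⟩ := exists_finite_mem_oddPow (mem_oddPow_of_phi_eq_zero hk hg hx n)
  obtain ⟨t, htfin, hthom, hD, hFD⟩ := exists_subSuperHopf (𝒜 := 𝒜) (F ∪ s)
    (hF.union s.finite_toSet)
  set D := Algebra.adjoin k t with hDdef
  have hVD : V ≤ Subalgebra.toSubmodule D := by
    rw [← hs, Submodule.span_le]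
    exact Set.subset_union_right.trans hFD
  let x' : D := ⟨x, hVD hxV⟩
  have hx' : x' ∈ oddPow (subGrading 𝒜 D) n :=
    mem_oddPow_subGrading (hFx _ (Set.subset_union_left.trans hFD))
  set V' := V.comap D.val.toLinearMap with hV'def
  have hV' : IsSubcoalgebra V' := hV.comap_val D hVD
  have hinj : Function.Injective (D.val.toLinearMap.restrict (p := V') (q := V) fun _ h => h) :=
    fun a b h => Subtype.ext (Subtype.ext (congrArg (fun z : V => (z : A)) h))
  have hV'fin : FiniteDimensional k V' := FiniteDimensional.of_injective _ hinj
  set U := V'.map (oddClass (subGrading 𝒜 D)) with hUdef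
  have hUn : Module.finrank k U < n := lt_of_le_of_lt (Submodule.finrank_map_le _ _)
    (Nat.lt_succ_of_le (LinearMap.finrank_le_finrank_of_injective hinj))
  obtain ⟨ι, E, hE, hEU⟩ := exists_resolution (fun _ : Unit => U) (fun _ _ _ => le_rfl)
  let _ : LinearOrder ι := linearOrderOfSTO WellOrderingRel
  obtain ⟨γ, hγ⟩ := exists_superExp (subGrading 𝒜 D) hE
  have h1 : IsApprox γ V' U :=
    hγ.isApprox hE hV' fun i v hv => hEU () i _ (Submodule.mem_map_of_mem hv)
  have h2 : IsApprox γ ⊤ ⊤ := hγ.isApprox hE isSubcoalgebra_top fun _ _ _ => trivial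
  -- the kernel of `phi γ` is trivial by `mem_oddPow_of_phi_eq_zero`, as the odd ideal of `D` is
  -- nilpotent
  have h3 : phi γ x' = 0 := phi_eq_zero_of_mem_oddPow hV' h1 h2 hUn hxV hx'
  let t' : Set D := Subtype.val ⁻¹' t
  obtain ⟨m, hm⟩ := exists_oddPow_eq_bot (𝒜 := subGrading 𝒜 D) (s := t') hk
    (htfin.preimage Subtype.val_injective.injOn) (fun a ha => hthom _ ha)
    Algebra.adjoin_adjoin_coe_preimage
  have h4 := mem_oddPow_of_phi_eq_zero hk h2 h3 m
  rw [hm, Submodule.mem_bot] at h4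
  exact congrArg Subtype.val h4

end Injectivity

/-! ### Surjectivity -/

section Surjectivity

variable {k A : Type*} [Field k] [Ring A] [Algebra k A] [Coalgebra k A]
  (𝒜 : ZMod 2 → Submodule k A)

/-- Only finitely many `E i` are nonzero on a finite-dimensional subspace. -/
theorem IsResolution.finiteDimensional_iSup {W ι : Type*} [AddCommGroup W] [Module k W]
    {E : ι → W →ₗ[k] W} (hE : IsResolution E) (U : Submodule k W) [FiniteDimensional k U] :
    FiniteDimensional k (⨆ i, U.map (E i) : Submodule k W) := by
  classical
  obtain ⟨s, hs⟩ := (Submodule.fg_iff_finiteDimensional U).2 inferInstance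
  choose T hT _ using hE.sum_eq
  have h : ⨆ i, U.map (E i) ≤ Submodule.span k
      (s.biUnion fun u => (T u).image fun i => E i u : Finset W) := by
    refine iSup_le fun i => ?_
    rw [← hs, Submodule.map_span, Submodule.span_le]
    rintro _ ⟨u, hu, rfl⟩
    by_cases hi : i ∈ T u
    · exact Submodule.subset_span (Finset.mem_biUnion.2 ⟨u, hu, Finset.mem_image_of_mem _ hi⟩)
    · rw [hT u i hi]; exact zero_mem _
  exact Submodule.finiteDimensional_of_le h

variable [GradedAlgebra 𝒜]

/-- The subspace of `W^A` spanned by the classes of the elements of a subalgebra. -/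
def oddSpan (D : Subalgebra k A) : Submodule k (OddCotangent 𝒜) :=
  (Subalgebra.toSubmodule D).map (oddClass 𝒜)

/-- The `w ∈ W^A` such that `1 ⊗ w` is in the image of `phi g`. -/
def liftable {𝒜 : ZMod 2 → Submodule k A} [GradedAlgebra 𝒜] [SuperHopfAlgebra k 𝒜]
    (g : A →ₐ[k] ExteriorOdd 𝒜) : Submodule k (OddCotangent 𝒜) :=
  (LinearMap.range (phi g).toLinearMap).comap
    (TensorProduct.mk k (EvenQuotient 𝒜) (ExteriorOdd 𝒜) 1 ∘ₗ ExteriorAlgebra.ι k)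

variable [SuperHopfAlgebra k 𝒜]

/-- A finite set of generators of a sub super Hopf algebra. -/
def SubHopfGenerators : Type _ :=
  {t : Set A // t.Finite ∧ IsSubSuperHopf 𝒜 (Algebra.adjoin k t)}

open scoped Classical in
instance : LinearOrder (SubHopfGenerators 𝒜) := linearOrderOfSTO WellOrderingRel

instance : WellFoundedLT (SubHopfGenerators 𝒜) := ⟨WellOrderingRel.isWellOrder.wf⟩

/-- A chain of subspaces of `W^A`, which starts from `L` and adds the finitely generated sub super
Hopf algebras one by one. -/
def oddChain (L : Submodule k (OddCotangent 𝒜)) (t : SubHopfGenerators 𝒜) :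
    Submodule k (OddCotangent 𝒜) :=
  L ⊔ ⨆ t' ≤ t, oddSpan 𝒜 (Algebra.adjoin k t'.1)

theorem oddChain_monotone (L : Submodule k (OddCotangent 𝒜)) : Monotone (oddChain 𝒜 L) :=
  fun _ _ h => sup_le_sup le_rfl (biSup_mono fun _ h' => h'.trans h)

theorem le_oddChain (L : Submodule k (OddCotangent 𝒜)) (t : SubHopfGenerators 𝒜) :
    L ≤ oddChain 𝒜 L t := le_sup_left

variable {𝒜} in
theorem oddCoinv_mem_of_isSubSuperHopf (D : Subalgebra k A) [IsSubSuperHopf 𝒜 D] {v : A}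
    (hv : v ∈ D) : oddCoinv 𝒜 v ∈ D := by
  have h : LinearMap.range (TensorProduct.mapIncl (Subalgebra.toSubmodule D)
      (Subalgebra.toSubmodule D)) ≤ (Subalgebra.toSubmodule D).comap
        (LinearMap.mul' k A ∘ₗ TensorProduct.map (anti 𝒜 ∘ₗ pr 𝒜 0) (pr 𝒜 1)) :=
    range_mapIncl_le fun x hx y hy => mul_mem (S := Subalgebra k A)
      (IsSubSuperHopf.anti_mem _ (IsSuperSubalgebra.pr_mem 0 x hx))
      (IsSuperSubalgebra.pr_mem 1 y hy)
  exact h (IsSubbialgebra.comul_mem (D := D) v hv)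

variable [IsSuperCommutative k 𝒜]

theorem finiteDimensional_oddSpan {t : Set A} (ht : t.Finite) :
    FiniteDimensional k (oddSpan 𝒜 (Algebra.adjoin k t)) := by
  have h : ∀ a ∈ Algebra.adjoin k t, oddClass 𝒜 a ∈ Submodule.span k (oddClass 𝒜 '' t) := by
    intro a ha
    induction ha using Algebra.adjoin_induction with
    | mem x hx => exact Submodule.subset_span ⟨x, hx, rfl⟩
    | algebraMap r =>
      rw [oddClass_of_even 𝒜 (SetLike.algebraMap_mem_graded 𝒜 r)]; exact zero_mem _
    | add x y _ _ hx hy => rw [map_add]; exact add_mem hx hy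
    | mul x y _ _ hx hy =>
      rw [oddClass_mul]; exact add_mem (Submodule.smul_mem _ _ hy) (Submodule.smul_mem _ _ hx)
  have : FiniteDimensional k (Submodule.span k (oddClass 𝒜 '' t)) :=
    FiniteDimensional.span_of_finite k (ht.image _)
  have h' : oddSpan 𝒜 (Algebra.adjoin k t) ≤ Submodule.span k (oddClass 𝒜 '' t) := by
    rintro _ ⟨a, ha, rfl⟩
    exact h a ha
  exact Submodule.finiteDimensional_of_le h'

variable {𝒜} {g : A →ₐ[k] ExteriorOdd 𝒜}

/-- Let `D` be a sub super Hopf algebra and `Q ⊆ W^A` a finite-dimensional subspace on which `g`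
is controlled. If `Q` is spanned by liftable elements and classes of elements of `D`, then
`D̄ ⊗ ∧(Q)` is in the image of `phi g`. The proof is by descending induction on the exterior
degree, which is bounded. -/
theorem modelFil_le_range (D : Subalgebra k A) [IsSubSuperHopf 𝒜 D]
    (Q : Submodule k (OddCotangent 𝒜)) [FiniteDimensional k Q]
    (hg : IsApprox g (Subalgebra.toSubmodule D) Q) (hQ : Q ≤ liftable g ⊔ oddSpan 𝒜 D) :
    modelFil (D.map (toEven 𝒜)) Q 0 ≤ LinearMap.range (phi g).toLinearMap := by
  set F := D.map (toEven 𝒜) with hFdef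
  have hD : IsSubcoalgebra (Subalgebra.toSubmodule D) := IsSubbialgebra.comul_mem
  have hF : ∀ v ∈ Subalgebra.toSubmodule D, toEven 𝒜 v ∈ F := fun v hv => ⟨v, hv, rfl⟩
  have htmul : ∀ {n w}, w ∈ powGE (extSub 𝒜 Q) n → 1 ⊗ₜ[k] w ∈ modelFil F Q n :=
    fun hw => tmul_mem_modelFil (one_mem F) hw
  have h1 : ∀ w ∈ Q, ∃ y, phi g y - 1 ⊗ₜ ExteriorAlgebra.ι k w ∈ modelFil F Q 2 := by
    intro w hw
    -- a liftable element `u` is hit exactly, a class `[v]` by `oddCoinv 𝒜 v` up to degree `2`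
    obtain ⟨u, ⟨y, hy⟩, _, ⟨v, hv, rfl⟩, rfl⟩ := Submodule.mem_sup.1 (hQ hw)
    refine ⟨y + oddCoinv 𝒜 v, ?_⟩
    have h2 := hg.phi_sub_mem_of_coact₁ hD hF (oddCoinv_mem_of_isSubSuperHopf D hv)
      (oddCoinv_mem v) (coact₁_oddCoinv v)
    have h3 : phi g y = 1 ⊗ₜ ExteriorAlgebra.ι k u := hy
    rw [map_add, h3, map_add, TensorProduct.tmul_add, add_sub_add_left_eq_sub]
    exact h2
  have h2 : ∀ n, ∀ τ ∈ extSub 𝒜 Q ^ n, ∃ y, phi g y - 1 ⊗ₜ τ ∈ modelFil F Q (n + 1) := by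
    intro n
    induction n with
    | zero =>
      intro τ hτ
      rw [pow_zero, Submodule.mem_one] at hτ
      obtain ⟨r, rfl⟩ := hτ
      refine ⟨algebraMap k A r, ?_⟩
      rw [AlgHom.commutes, Algebra.algebraMap_eq_smul_one, Algebra.algebraMap_eq_smul_one,
        TensorProduct.tmul_smul, Algebra.TensorProduct.one_def, sub_self]
      exact zero_mem _
    | succ n ih =>
      intro τ hτ
      rw [pow_succ] at hτ
      induction hτ using Submodule.mul_induction_on' with
      | mem_mul_mem a ha b hb =>
        obtain ⟨w, hw, rfl⟩ := hb
        obtain ⟨y, hy⟩ := ih a ha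
        obtain ⟨z, hz⟩ := h1 w hw
        have h3 := htmul (pow_le_powGE (extSub 𝒜 Q) le_rfl ha)
        have h4 : phi g y ∈ modelFil F Q n := by
          have := add_mem (modelFil_anti n.le_succ hy) h3
          rwa [sub_add_cancel] at this
        have h5 := htmul (mem_powGE_one (q := extSub 𝒜 Q) ⟨w, hw, rfl⟩)
        refine ⟨y * z, ?_⟩
        have e : (1 : EvenQuotient 𝒜) ⊗ₜ[k] (a * ExteriorAlgebra.ι k w) =
            1 ⊗ₜ[k] a * 1 ⊗ₜ[k] ExteriorAlgebra.ι k w := by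
          rw [Algebra.TensorProduct.tmul_mul_tmul, one_mul]
        rw [e, map_mul]
        convert add_mem (mul_mem_modelFil h4 hz rfl) (mul_mem_modelFil hy h5 rfl) using 1
        rw [mul_sub, sub_mul, sub_add_sub_cancel]
      | add a _ b _ ha hb =>
        obtain ⟨y, hy⟩ := ha
        obtain ⟨z, hz⟩ := hb
        refine ⟨y + z, ?_⟩
        rw [map_add, TensorProduct.tmul_add, add_sub_add_comm]
        exact add_mem hy hz
  have step : ∀ n, modelFil F Q (n + 1) ≤ LinearMap.range (phi g).toLinearMap →
      modelFil F Q n ≤ LinearMap.range (phi g).toLinearMap := by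
    intro n hn
    refine modelFil_le ?_
    rintro _ ⟨d, hd, rfl⟩ w hw
    rw [powGE_eq_sup] at hw
    obtain ⟨τ, hτ, σ, hσ, rfl⟩ := Submodule.mem_sup.1 hw
    obtain ⟨y, hy⟩ := h2 n τ hτ
    have h3 := htmul (pow_le_powGE (extSub 𝒜 Q) le_rfl hτ)
    have h4 : phi g y ∈ modelFil F Q n := by
      have := add_mem (modelFil_anti n.le_succ hy) h3
      rwa [sub_add_cancel] at this
    have h5 := hg.phi_sub_mem_one hD hF hd
    have h6 : toEven 𝒜 d ⊗ₜ[k] (1 : ExteriorOdd 𝒜) ∈ modelFil F Q 0 :=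
      tmul_mem_modelFil (hF d hd) (by simpa using algebraMap_mem_powGE (extSub 𝒜 Q) 1)
    have h7 : phi g (d * y) - toEven 𝒜 d ⊗ₜ τ ∈ modelFil F Q (n + 1) := by
      have e : toEven 𝒜 d ⊗ₜ[k] τ = toEven 𝒜 d ⊗ₜ[k] 1 * 1 ⊗ₜ[k] τ := by
        rw [Algebra.TensorProduct.tmul_mul_tmul, one_mul, mul_one]
      rw [e, map_mul]
      convert add_mem (mul_mem_modelFil h5 h4 (add_comm 1 n))
        (mul_mem_modelFil h6 hy (zero_add _)) using 1
      rw [mul_sub, sub_mul, sub_add_sub_cancel]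
    have h8 : phi g (d * y) ∈ LinearMap.range (phi g).toLinearMap := ⟨d * y, rfl⟩
    have h9 := sub_mem h8 (hn h7)
    rw [sub_sub_cancel] at h9
    rw [TensorProduct.tmul_add]
    exact add_mem h9 (hn (tmul_mem_modelFil (hF d hd) hσ))
  have top : modelFil F Q (Module.finrank k Q + 1) ≤ LinearMap.range (phi g).toLinearMap := by
    refine modelFil_le fun a _ w hw => ?_
    rw [powGE_eq_bot (extSub_pow_eq_bot Q (Nat.lt_succ_self _)), Submodule.mem_bot] at hw
    rw [hw, TensorProduct.tmul_zero]
    exact zero_mem _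
  exact Nat.decreasingInduction (motive := fun n _ => modelFil F Q n ≤ _) (fun n _ => step n) top
    (Nat.zero_le _)

variable {ι : Type*} [LinearOrder ι] {E : ι → OddCotangent 𝒜 →ₗ[k] OddCotangent 𝒜}

/-- `phi g` is surjective if the resolution preserves the chain `oddChain 𝒜 L`, where `L` consists
of elements already known to be liftable: by induction along the chain, all the classes of the
finitely generated sub super Hopf algebras are liftable. -/
theorem phi_surjective (hE : IsResolution E) (hg : IsSuperExp 𝒜 E g)
    (L : Submodule k (OddCotangent 𝒜)) (hL : L ≤ liftable g)
    (hEL : ∀ t i, ∀ u ∈ oddChain 𝒜 L t, E i u ∈ oddChain 𝒜 L t) :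
    Function.Surjective (phi g) := by
  have key : ∀ t : SubHopfGenerators 𝒜, oddSpan 𝒜 (Algebra.adjoin k t.1) ≤ liftable g ∧
      ∀ a ∈ Algebra.adjoin k t.1, toEven 𝒜 a ⊗ₜ 1 ∈ LinearMap.range (phi g).toLinearMap := by
    intro t
    induction t using WellFoundedLT.induction with
    | ind t ih =>
      have := finiteDimensional_oddSpan 𝒜 t.2.1
      have := t.2.2
      have hfin := hE.finiteDimensional_iSup (oddSpan 𝒜 (Algebra.adjoin k t.1))
      set D := Algebra.adjoin k t.1 with hDdef
      set Q := ⨆ i, (oddSpan 𝒜 D).map (E i) with hQdef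
      have hEQ : ∀ i, ∀ v ∈ Subalgebra.toSubmodule D, E i (oddClass 𝒜 v) ∈ Q := fun i v hv =>
        Submodule.mem_iSup_of_mem i ⟨_, ⟨v, hv, rfl⟩, rfl⟩
      have happ : IsApprox g (Subalgebra.toSubmodule D) Q :=
        hg.isApprox hE IsSubbialgebra.comul_mem hEQ
      have hspan : oddSpan 𝒜 D ≤ oddChain 𝒜 L t := le_sup_of_le_right
        (le_iSup₂ (f := fun t' (_ : t' ≤ t) => oddSpan 𝒜 (Algebra.adjoin k t'.1)) t le_rfl)
      have hchain : oddChain 𝒜 L t ≤ liftable g ⊔ oddSpan 𝒜 D := by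
        refine sup_le (le_sup_of_le_left hL) (iSup₂_le fun t' ht' => ?_)
        rcases eq_or_lt_of_le ht' with rfl | h
        · exact le_sup_right
        · exact le_sup_of_le_left (ih t' h).1
      have hQ : Q ≤ liftable g ⊔ oddSpan 𝒜 D := by
        refine (iSup_le fun i => ?_ : Q ≤ oddChain 𝒜 L t).trans hchain
        rintro _ ⟨u, hu, rfl⟩
        exact hEL t i u (hspan hu)
      have h := modelFil_le_range D Q happ hQ
      have h1 : (1 : ExteriorOdd 𝒜) ∈ powGE (extSub 𝒜 Q) 0 := by
        simpa using algebraMap_mem_powGE (extSub 𝒜 Q) 1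
      refine ⟨?_, fun a ha => h (tmul_mem_modelFil ⟨a, ha, rfl⟩ h1)⟩
      rintro _ ⟨v, hv, rfl⟩
      exact h (tmul_mem_modelFil (one_mem _)
        (powGE_anti _ zero_le_one (mem_powGE_one ⟨_, (happ v hv).1, rfl⟩)))
  have hex : ∀ a : A, ∃ t : SubHopfGenerators 𝒜, a ∈ Algebra.adjoin k t.1 := by
    intro a
    obtain ⟨t, h1, _, h2, h3⟩ := exists_subSuperHopf (𝒜 := 𝒜) {a} (Set.finite_singleton a)
    exact ⟨⟨t, h1, h2⟩, h3 rfl⟩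
  have heven : ∀ a : EvenQuotient 𝒜, a ⊗ₜ 1 ∈ (phi g).range := by
    intro a
    obtain ⟨a, rfl⟩ := Ideal.Quotient.mk_surjective a
    obtain ⟨t, ht⟩ := hex a
    exact (key t).2 a ht
  have hodd : ∀ w : ExteriorOdd 𝒜, 1 ⊗ₜ w ∈ (phi g).range := by
    have h : ((phi g).range.comap (Algebra.TensorProduct.includeRight
        (R := k) (A := EvenQuotient 𝒜) (B := ExteriorOdd 𝒜))) = ⊤ := by
      rw [← top_le_iff, ← CliffordAlgebra.adjoin_range_ι]
      refine Algebra.adjoin_le ?_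
      rintro _ ⟨w, rfl⟩
      obtain ⟨a, -, rfl⟩ := oddClass_surjective 𝒜 w
      obtain ⟨t, ht⟩ := hex a
      exact (key t).1 ⟨a, ht, rfl⟩
    intro w
    exact (h ▸ Algebra.mem_top : w ∈ (phi g).range.comap _)
  intro x
  change x ∈ (phi g).range
  induction x using TensorProduct.induction_on with
  | zero => exact zero_mem _
  | add x y hx hy => exact add_mem hx hy
  | tmul a w =>
    have e : a ⊗ₜ[k] w = a ⊗ₜ[k] 1 * 1 ⊗ₜ[k] w := by
      rw [Algebra.TensorProduct.tmul_mul_tmul, one_mul, mul_one]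
    rw [e]
    exact mul_mem (heven a) (hodd w)

end Surjectivity

/-! ### The decomposition -/

section Main

variable {k A : Type*} [Field k] [Ring A] [Algebra k A] [Coalgebra k A]
  {𝒜 : ZMod 2 → Submodule k A} [GradedAlgebra 𝒜] [SuperHopfAlgebra k 𝒜]

/-- The decomposition attached to a resolution of the identity of `W^A` which is adapted to a
chain `oddChain 𝒜 L`. -/
def decompositionOfSuperExp [IsSuperCommutative k 𝒜] (hk : ringChar k ≠ 2) {ι : Type*}
    [LinearOrder ι] {E : ι → OddCotangent 𝒜 →ₗ[k] OddCotangent 𝒜} (hE : IsResolution E)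
    {g : A →ₐ[k] ExteriorOdd 𝒜} (hg : IsSuperExp 𝒜 E g) (L : Submodule k (OddCotangent 𝒜))
    (hL : L ≤ liftable g) (hEL : ∀ t i, ∀ u ∈ oddChain 𝒜 L t, E i u ∈ oddChain 𝒜 L t) :
    Decomposition 𝒜 where
  toAlgEquiv := AlgEquiv.ofBijective (phi g)
    ⟨phi_injective hk (hg.isApprox hE isSubcoalgebra_top fun _ _ _ => trivial),
      phi_surjective hE hg L hL hEL⟩
  map_mem := phi_mem hg.map_mem
  map_coaction := phi_coaction g
  map_counit := phi_counit (hg.algebraMapInv_eq hE)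

variable {B : Type*} [Ring B] [Algebra k B] [Coalgebra k B]
  {ℬ : ZMod 2 → Submodule k B} [GradedAlgebra ℬ] [SuperHopfAlgebra k ℬ]

/-- The maps `phi g` and `phi g'` are compatible with `f` as soon as `g` and `g'` are. -/
theorem SuperHopfHom.phi_map (f : SuperHopfHom 𝒜 ℬ) {g : A →ₐ[k] ExteriorOdd 𝒜}
    {g' : B →ₐ[k] ExteriorOdd ℬ}
    (h : ∀ a, g' (f.toAlgHom a) = ExteriorAlgebra.map f.oddCotangentMap (g a)) (a : A) :
    phi g' (f.toAlgHom a) = f.modelMap (phi g a) := by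
  rw [phi_apply, phi_apply, f.comul_map]
  generalize Coalgebra.comul (R := k) a = w
  induction w with
  | zero => simp
  | add x y hx hy => simp only [map_add, hx, hy]
  | tmul x y =>
    rw [TensorProduct.map_tmul, TensorProduct.map_tmul, TensorProduct.map_tmul]
    exact congrArg (toEven ℬ (f.toAlgHom x) ⊗ₜ[k] ·) (h y)

/-- The identity of a super Hopf algebra. -/
def SuperHopfHom.id (𝒜 : ZMod 2 → Submodule k A) : SuperHopfHom 𝒜 𝒜 where
  toAlgHom := AlgHom.id k A
  map_mem _ _ ha := ha
  counit_map _ := rfl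
  comul_map _ := (LinearMap.congr_fun TensorProduct.map_id _).symm

variable [IsSuperCommutative k 𝒜] [IsSuperCommutative k ℬ]

/-- Every map of super commutative Hopf algebras is compatible with some decompositions. -/
theorem SuperHopfHom.exists_decomposition (hk : ringChar k ≠ 2) (f : SuperHopfHom 𝒜 ℬ) :
    ∃ (φA : Decomposition 𝒜) (φB : Decomposition ℬ),
      ∀ a : A, φB.toAlgEquiv (f.toAlgHom a) = f.modelMap (φA.toAlgEquiv a) := by
  classical
  obtain ⟨ι, E, E', hE, hE', hEE, hEA, hEB⟩ := exists_compatible_resolutions f.oddCotangentMap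
    (oddChain 𝒜 ⊥) (oddChain_monotone 𝒜 ⊥)
    (oddChain ℬ (LinearMap.range f.oddCotangentMap)) (oddChain_monotone ℬ _) (le_oddChain ℬ _)
  let _ : LinearOrder ι := linearOrderOfSTO WellOrderingRel
  obtain ⟨g, hg⟩ := exists_superExp 𝒜 hE
  obtain ⟨g', hg'⟩ := exists_superExp ℬ hE'
  have hmap := f.phi_map (f.superExp_map hEE hg hg')
  let φA := decompositionOfSuperExp hk hE hg ⊥ bot_le hEA
  refine ⟨φA, decompositionOfSuperExp hk hE' hg' (LinearMap.range f.oddCotangentMap) ?_ hEB,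
    hmap⟩
  -- `φA` is surjective, so the elements `1 ⊗ W^f(u)` are values of `phi g'`
  rintro _ ⟨u, rfl⟩
  obtain ⟨a, ha⟩ := φA.toAlgEquiv.surjective (1 ⊗ₜ ExteriorAlgebra.ι k u)
  refine ⟨f.toAlgHom a, (hmap a).trans ?_⟩
  have ha' : phi g a = 1 ⊗ₜ ExteriorAlgebra.ι k u := ha
  rw [ha', SuperHopfHom.modelMap, Algebra.TensorProduct.map_tmul, map_one,
    ExteriorAlgebra.map_apply_ι]
  rfl

end Main

end SuperHopf

end

open SuperHopf in
theorem theorem4p1 {k : Type*} [Field k] (hk : ringChar k ≠ 2)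
    {A : Type*} [Ring A] [Algebra k A] [Coalgebra k A]
    (𝒜 : ZMod 2 → Submodule k A) [GradedAlgebra 𝒜] [SuperHopfAlgebra k 𝒜]
    [IsSuperCommutative k 𝒜] :
    Nonempty (Decomposition 𝒜) ∧
      ∀ {B : Type*} [Ring B] [Algebra k B] [Coalgebra k B]
        (ℬ : ZMod 2 → Submodule k B) [GradedAlgebra ℬ] [SuperHopfAlgebra k ℬ]
        [IsSuperCommutative k ℬ] (f : SuperHopfHom 𝒜 ℬ),
        ∃ (φA : Decomposition 𝒜) (φB : Decomposition ℬ),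
          ∀ a : A, φB.toAlgEquiv (f.toAlgHom a) = f.modelMap (φA.toAlgEquiv a) := by
  refine ⟨?_, fun ℬ => fun f => f.exists_decomposition hk⟩
  obtain ⟨φ, -, -⟩ := (SuperHopfHom.id 𝒜).exists_decomposition hk
  exact ⟨φ⟩
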